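/- Let $\varepsilon>0$ and $\beta>1/2$ be constants. Let $(\Gamma_i)_{i\in\mathbb N}$ be a sequence of finite simple graphs, where $\Gamma_i$ has $n=n_i$ vertices and $n_i\to\infty$ as $i\to\infty$. Suppose that $\Gamma_i$ has minimum degree $d_i$, where $d_i=\beta n_i$ up to rounding, i.e. $|d_i-\beta n_i|\le 1$, and that at least $\varepsilon n_i$ vertices of $\Gamma_i$ have degree exactly $d_i$. Let $(c_i)$ be a sequence of reals and let $p_i\in[0,1]$ satisfy, for all large $i$, $$p_i=\frac{\log n_i+\log\log n_i+c_i}{\beta n_i}.$$ Let $\Gamma_{i,p_i}$ be the random subgraph of $\Gamma_i$, on the same vertex set, in which each edge of $\Gamma_i$ is retained independently with probability $p_i$. Then $$\lim_{i\to\infty}\Pr[\Gamma_{i,p_i}\text{ contains a Hamilton cycle}]=\begin{cases}0,& c_i\to-\infty,\\ 1,& c_i\to\infty.\end{cases}$$ Furthermore, if every $\Gamma_i$ is $d_i$-regular and $c_i\to c$ for some constant $c\in\mathbb R$, then $$\lim_{i\to\infty}\Pr[\Gamma_{i,p_i}\text{ contains a Hamilton cycle}]=e^{-e^{-c}}.$$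 -/

import Mathlib

open MeasureTheory ProbabilityTheory Filter Topology

/-- The law of the random subgraph of `Γ` (on the same vertex set) in which every edge of `Γ` is
retained independently with probability `p`: the edge set is a `p`-Bernoulli subset of the edge
set of `Γ`. -/
noncomputable def randomSubgraph {V : Type*} (Γ : SimpleGraph V) (p : unitInterval) :
    Measure (SimpleGraph V) :=
  (setBernoulli Γ.edgeSet p).map SimpleGraph.fromEdgeSet

/-- The probability that the random subgraph of `Γ` with retention probability `p` contains a
Hamilton cycle. -/
noncomputable def probHamiltonian {V : Type*} [Fintype V] [DecidableEq V]
    (Γ : SimpleGraph V) (p : unitInterval) : ℝ :=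
  (randomSubgraph Γ p).real {G | G.IsHamiltonian}

/-! A Hamilton cycle forces every degree to be at least two, and at this density that is
asymptotically the only obstruction. Two facts are needed: a random subgraph of minimum degree at
least two is rarely non-Hamiltonian, and the number of vertices of degree at most one is
asymptotically Poisson.

For the first fact (`eventually_bprob_not_isHamiltonian_le`), with `P` the edge probability, write
the retained edges as a union of independent sets `R`, `A`, `B` of densities `3P/4`, `P/8` and at
least `P/8`. A vertex is small if it meets fewer than 28 edges of `R`. Typically small vertices are
at pairwise distance at least five, few edges of `A ∪ B` meet them, codegrees are at most two, small
sets span few edges of `R`, and larger sets have escaping edges. Then `R` together with the edges of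
`A ∪ B` at small vertices expands linear-sized sets by a factor two (`expansion_of_typical`) and is
connected. By Pósa's lemma (`exists_card_extNbr_lt`) its longest paths have linearly many starts,
and linearly many ends for each start.

Since `β > 1/2`, any two degrees of `Γ` sum to `n` plus a linear excess. Hence a longest path from
`x` to `y` has linearly many `w` for which `yw` and `xw⁺` are both edges of `Γ`, where `w⁺` is the
successor of `w`. If `yw ∈ A` and `xw⁺ ∈ B`, the path gets longer or closes to a Hamilton cycle
(`isHamiltonian_or_exists_longer`). If no Hamilton cycle exists, some extension of `R` by at most
`3n` edges admits no such pair (`exists_noBooster`). For a fixed extension this has probability `exp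
(-Ω(n log n))`, which beats the `exp (O(n log log n))` cost of summing over extensions
(`bprob₂_exists_noBooster_le`).

For the second fact, the stars of `k` vertices of degree `d` are independent up to the few edges
among them. The `k`-th binomial moment of the number of low vertices therefore tends to that of a
Poisson variable, since `n (1 - p)^d (1 + d p) → exp (-c)`, and the Bonferroni inequalities finish
(`tendsto_bprob_forall_two_le`).

Regular graphs combine both facts directly. The cases `c → ±∞` reduce to constant `c` by
monotonicity in `p`: the lower one uses only the `ε n` vertices of minimum degree, the upper one a
first moment bound over all vertices. -/

/-! ### Expectations over Bernoulli random subsets of a finite set -/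

section Bernoulli

variable {ι : Type*} [DecidableEq ι]

/-- The expectation of `f S`, where `S` is a `p`-Bernoulli random subset of the finite set `E`. -/
noncomputable def bexp (E : Finset ι) (p : ℝ) (f : Finset ι → ℝ) : ℝ :=
  ∑ S ∈ E.powerset, p ^ S.card * (1 - p) ^ (E \ S).card * f S

open Classical in
/-- The probability of `Q S`, where `S` is a `p`-Bernoulli random subset of the finite set `E`. -/
noncomputable def bprob (E : Finset ι) (p : ℝ) (Q : Finset ι → Prop) : ℝ :=
  bexp E p fun S => if Q S then 1 else 0

lemma bexp_congr {E : Finset ι} {p : ℝ} {f g : Finset ι → ℝ} (h : ∀ S ⊆ E, f S = g S) :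
    bexp E p f = bexp E p g :=
  Finset.sum_congr rfl fun S hS => by rw [h S (Finset.mem_powerset.1 hS)]

lemma bexp_mono {E : Finset ι} {p : ℝ} (hp0 : 0 ≤ p) (hp1 : p ≤ 1) {f g : Finset ι → ℝ}
    (h : ∀ S ⊆ E, f S ≤ g S) : bexp E p f ≤ bexp E p g := by
  refine Finset.sum_le_sum fun S hS => ?_
  have : 0 ≤ 1 - p := by linarith
  exact mul_le_mul_of_nonneg_left (h S (Finset.mem_powerset.1 hS)) (by positivity)

@[simp] lemma bexp_empty (p : ℝ) (f : Finset ι → ℝ) : bexp ∅ p f = f ∅ := by simp [bexp]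

lemma bexp_insert {E : Finset ι} {e : ι} (he : e ∉ E) (p : ℝ) (f : Finset ι → ℝ) :
    bexp (insert e E) p f = p * bexp E p (fun S => f (insert e S)) + (1 - p) * bexp E p f := by
  unfold bexp
  rw [Finset.sum_powerset_insert he, add_comm, Finset.mul_sum, Finset.mul_sum]
  congr 1
  · refine Finset.sum_congr rfl fun S hS => ?_
    have hS := Finset.mem_powerset.1 hS
    have h1 : e ∉ S := fun h => he (hS h)
    rw [Finset.card_insert_of_notMem h1, Finset.insert_sdiff_insert,
      Finset.sdiff_insert_of_notMem he]
    ring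
  · refine Finset.sum_congr rfl fun S hS => ?_
    have hS := Finset.mem_powerset.1 hS
    have h1 : e ∉ S := fun h => he (hS h)
    rw [Finset.insert_sdiff_of_notMem _ h1, Finset.card_insert_of_notMem (by simp [he])]
    ring

lemma bexp_const (E : Finset ι) (p c : ℝ) : bexp E p (fun _ => c) = c := by
  induction E using Finset.induction_on with
  | empty => simp
  | insert e E he ih => rw [bexp_insert he, ih]; ring

lemma bexp_add (E : Finset ι) (p : ℝ) (f g : Finset ι → ℝ) :
    bexp E p (fun S => f S + g S) = bexp E p f + bexp E p g := by
  simp only [bexp, mul_add, Finset.sum_add_distrib]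

lemma bexp_sum {κ : Type*} (E : Finset ι) (p : ℝ) (s : Finset κ) (f : κ → Finset ι → ℝ) :
    bexp E p (fun S => ∑ k ∈ s, f k S) = ∑ k ∈ s, bexp E p (f k) := by
  simp only [bexp, Finset.mul_sum]
  exact Finset.sum_comm

lemma bexp_const_mul (E : Finset ι) (p c : ℝ) (f : Finset ι → ℝ) :
    bexp E p (fun S => c * f S) = c * bexp E p f := by
  simp only [bexp, Finset.mul_sum]
  exact Finset.sum_congr rfl fun S _ => by ring

lemma bexp_mul_const (E : Finset ι) (p c : ℝ) (f : Finset ι → ℝ) :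
    bexp E p (fun S => f S * c) = bexp E p f * c := by
  simp only [mul_comm _ c, bexp_const_mul]

lemma bexp_nonneg {E : Finset ι} {p : ℝ} (hp0 : 0 ≤ p) (hp1 : p ≤ 1) {f : Finset ι → ℝ}
    (h : ∀ S ⊆ E, 0 ≤ f S) : 0 ≤ bexp E p f := by
  simpa [bexp_const] using bexp_mono hp0 hp1 (f := fun _ => 0) h

/-- The union of independent Bernoulli subsets is a Bernoulli subset. -/
lemma bexp_union (E : Finset ι) (p q : ℝ) (f : Finset ι → ℝ) :
    bexp E p (fun S => bexp E q fun T => f (S ∪ T)) = bexp E (p + q - p * q) f := by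
  induction E using Finset.induction_on generalizing f with
  | empty => simp
  | insert e E he ih =>
    have h1 : ∀ S : Finset ι, bexp (insert e E) q (fun T => f (insert e S ∪ T)) =
        bexp E q fun T => f (insert e (S ∪ T)) := by
      intro S
      rw [bexp_insert he]
      simp only [Finset.insert_union, Finset.union_insert, Finset.insert_idem]
      ring
    have h2 : ∀ S : Finset ι, bexp (insert e E) q (fun T => f (S ∪ T)) =
        q * bexp E q (fun T => f (insert e (S ∪ T))) + (1 - q) * bexp E q fun T => f (S ∪ T) := by
      intro S
      rw [bexp_insert he]
      simp only [Finset.union_insert]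
    rw [bexp_insert he]
    simp only [h1, h2, bexp_add, bexp_const_mul]
    rw [ih (fun T => f (insert e T)), ih f, bexp_insert he]
    ring

/-- Coupling: a `q`-random set is the union of a `p`-random set and an independent random set of
density `(q - p) / (1 - p)`, and `f` can only grow under the union. -/
lemma bexp_mono_param {E : Finset ι} {p q : ℝ} (hp0 : 0 ≤ p) (hpq : p ≤ q) (hq1 : q ≤ 1)
    {f : Finset ι → ℝ} (hf : ∀ S T, S ⊆ T → T ⊆ E → f S ≤ f T) : bexp E p f ≤ bexp E q f := by
  rcases eq_or_lt_of_le (hpq.trans hq1) with rfl | hp1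
  · rw [le_antisymm hpq hq1]
  have h1 : 0 < 1 - p := by linarith
  have hr : p + (q - p) / (1 - p) - p * ((q - p) / (1 - p)) = q := by field_simp; ring
  rw [← hr, ← bexp_union]
  refine bexp_mono hp0 hp1.le fun S hS => ?_
  have h := bexp_mono (E := E) (p := (q - p) / (1 - p)) (div_nonneg (by linarith) h1.le)
    ((div_le_one h1).2 (by linarith)) (f := fun _ => f S) (g := fun T => f (S ∪ T))
    fun T hT => hf _ _ Finset.subset_union_left (Finset.union_subset hS hT)
  rwa [bexp_const] at h

/-- Expectations factor over disjoint sets. -/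
lemma bexp_union_mul {A B : Finset ι} (hAB : Disjoint A B) (p : ℝ) (f g : Finset ι → ℝ) :
    bexp (A ∪ B) p (fun S => f (S ∩ A) * g (S ∩ B)) = bexp A p f * bexp B p g := by
  induction A using Finset.induction_on generalizing f with
  | empty =>
    simp only [Finset.empty_union, Finset.inter_empty, bexp_empty]
    rw [← bexp_const_mul]
    exact bexp_congr fun S hS => by rw [Finset.inter_eq_left.2 hS]
  | insert e A he ih =>
    rw [Finset.disjoint_insert_left] at hAB
    have heAB : e ∉ A ∪ B := by simp [he, hAB.1]
    rw [Finset.insert_union, bexp_insert heAB, bexp_insert he, add_mul, mul_assoc, mul_assoc,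
      ← ih hAB.2, ← ih hAB.2]
    congr 2
    · refine bexp_congr fun S hS => ?_
      rw [← Finset.insert_inter_distrib, Finset.insert_inter_of_notMem hAB.1]
    · refine bexp_congr fun S hS => ?_
      rw [Finset.inter_insert_of_notMem fun h => heAB (hS h)]

lemma bexp_inter {E A : Finset ι} (hA : A ⊆ E) (p : ℝ) (f : Finset ι → ℝ) :
    bexp E p (fun S => f (S ∩ A)) = bexp A p f := by
  have h := bexp_union_mul (Finset.disjoint_sdiff (s := A) (t := E)) p f (fun _ => 1)
  rwa [Finset.union_sdiff_of_subset hA, bexp_const, mul_one, funext fun S => mul_one _] at h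

lemma bexp_prod_inter {κ : Type*} {E : Finset ι} (K : Finset κ) (A : κ → Finset ι)
    (hA : ∀ k ∈ K, A k ⊆ E) (hdis : (K : Set κ).PairwiseDisjoint A) (p : ℝ)
    (f : κ → Finset ι → ℝ) :
    bexp E p (fun S => ∏ k ∈ K, f k (S ∩ A k)) = ∏ k ∈ K, bexp (A k) p (f k) := by
  classical
  induction K using Finset.induction_on generalizing E with
  | empty => simp [bexp_const]
  | insert k K hk ih =>
    have hsub : ∀ j ∈ K, A j ⊆ E \ A k := fun j hj => by
      rw [Finset.subset_sdiff]
      refine ⟨hA j (Finset.mem_insert_of_mem hj), hdis (by simp [hj]) (by simp) ?_⟩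
      rintro rfl; exact hk hj
    have h1 := ih hsub (hdis.subset (by simp))
    rw [Finset.prod_insert hk, ← h1, ← bexp_union_mul Finset.disjoint_sdiff,
      Finset.union_sdiff_of_subset (hA k (by simp))]
    refine bexp_congr fun S hS => ?_
    rw [Finset.prod_insert hk]
    congr 1
    refine Finset.prod_congr rfl fun j hj => ?_
    congr 1
    rw [Finset.inter_assoc, Finset.inter_eq_right.2 (hsub j hj)]

lemma bexp_prod_ite {E A : Finset ι} (hA : A ⊆ E) (p : ℝ) (a b : ι → ℝ) :
    bexp E p (fun S => ∏ e ∈ A, if e ∈ S then a e else b e) =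
      ∏ e ∈ A, (p * a e + (1 - p) * b e) := by
  have h := bexp_prod_inter (E := E) A (fun e => {e}) (by simpa using fun k hk => hA hk)
    (by intro i _ j _ hij; simpa using hij) p (fun e T => if e ∈ T then a e else b e)
  simp only [Finset.mem_inter, Finset.mem_singleton, and_true] at h
  rw [h]
  refine Finset.prod_congr rfl fun e _ => ?_
  rw [← insert_empty_eq, bexp_insert (by simp)]
  simp

/-- Expectations of products over pairs of independent Bernoulli subsets. -/
lemma bexp_bexp_prod_ite {E A : Finset ι} (hA : A ⊆ E) (p q : ℝ) (a b c d : ι → ℝ) :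
    bexp E p (fun S => bexp E q fun T =>
      ∏ e ∈ A, if e ∈ S then (if e ∈ T then a e else b e) else (if e ∈ T then c e else d e)) =
      ∏ e ∈ A, (p * (q * a e + (1 - q) * b e) + (1 - p) * (q * c e + (1 - q) * d e)) := by
  rw [← bexp_prod_ite hA]
  refine bexp_congr fun S _ => ?_
  have := bexp_prod_ite hA q (fun e => if e ∈ S then a e else c e)
    (fun e => if e ∈ S then b e else d e)
  calc _ = _ := bexp_congr (g := fun T => ∏ e ∈ A, if e ∈ T then (if e ∈ S then a e else c e) else
            (if e ∈ S then b e else d e)) fun T _ => Finset.prod_congr rfl fun e _ => by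
              split_ifs <;> rfl
    _ = _ := this
    _ = _ := Finset.prod_congr rfl fun e _ => by split_ifs <;> rfl

/-- The probability generating function of a binomial variable, from which the Chernoff bounds
follow. -/
lemma bexp_pow_card_inter {E A : Finset ι} (hA : A ⊆ E) (p x : ℝ) :
    bexp E p (fun S => x ^ (S ∩ A).card) = (1 - p + p * x) ^ A.card := by
  have h := bexp_prod_ite hA p (fun _ => x) (fun _ => 1)
  rw [Finset.prod_const] at h
  rw [show 1 - p + p * x = p * x + (1 - p) * 1 by ring, ← h]
  refine bexp_congr fun S _ => ?_
  rw [Finset.prod_ite, Finset.prod_const, Finset.prod_const_one, mul_one, Finset.inter_comm,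
    Finset.filter_mem_eq_inter]

lemma bprob_mono {E : Finset ι} {p : ℝ} (hp0 : 0 ≤ p) (hp1 : p ≤ 1) {Q Q' : Finset ι → Prop}
    (h : ∀ S ⊆ E, Q S → Q' S) : bprob E p Q ≤ bprob E p Q' := by
  refine bexp_mono hp0 hp1 fun S hS => ?_
  by_cases h1 : Q S
  · simp [h1, h S hS h1]
  · simp only [h1, if_false]; split_ifs <;> norm_num

lemma bprob_congr {E : Finset ι} {p : ℝ} {Q Q' : Finset ι → Prop}
    (h : ∀ S ⊆ E, (Q S ↔ Q' S)) : bprob E p Q = bprob E p Q' :=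
  bexp_congr fun S hS => by classical exact if_congr (h S hS) rfl rfl

lemma bprob_nonneg {E : Finset ι} {p : ℝ} (hp0 : 0 ≤ p) (hp1 : p ≤ 1) (Q : Finset ι → Prop) :
    0 ≤ bprob E p Q :=
  bexp_nonneg hp0 hp1 fun S _ => by split_ifs <;> norm_num

lemma bprob_le_one {E : Finset ι} {p : ℝ} (hp0 : 0 ≤ p) (hp1 : p ≤ 1) (Q : Finset ι → Prop) :
    bprob E p Q ≤ 1 := by
  rw [← bexp_const E p 1]
  exact bexp_mono hp0 hp1 fun S _ => by split_ifs <;> norm_num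

lemma bprob_not (E : Finset ι) (p : ℝ) (Q : Finset ι → Prop) :
    bprob E p (fun S => ¬ Q S) = 1 - bprob E p Q := by
  rw [eq_sub_iff_add_eq, bprob, bprob, ← bexp_add]
  refine Eq.trans (bexp_congr fun S _ => ?_) (bexp_const E p 1)
  by_cases h : Q S <;> simp [h]

lemma bprob_le_bexp {E : Finset ι} {p : ℝ} (hp0 : 0 ≤ p) (hp1 : p ≤ 1) {Q : Finset ι → Prop}
    {f : Finset ι → ℝ} (h0 : ∀ S ⊆ E, 0 ≤ f S) (h1 : ∀ S ⊆ E, Q S → 1 ≤ f S) :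
    bprob E p Q ≤ bexp E p f := by
  refine bexp_mono hp0 hp1 fun S hS => ?_
  split_ifs with h
  · exact h1 S hS h
  · exact h0 S hS

lemma bprob_or_le {E : Finset ι} {p : ℝ} (hp0 : 0 ≤ p) (hp1 : p ≤ 1) (Q Q' : Finset ι → Prop) :
    bprob E p (fun S => Q S ∨ Q' S) ≤ bprob E p Q + bprob E p Q' := by
  rw [bprob, bprob, bprob, ← bexp_add]
  refine bexp_mono hp0 hp1 fun S _ => ?_
  by_cases h : Q S <;> by_cases h' : Q' S <;> simp [h, h']

lemma bprob_exists_le {κ : Type*} {E : Finset ι} {p : ℝ} (hp0 : 0 ≤ p) (hp1 : p ≤ 1)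
    (s : Finset κ) (Q : κ → Finset ι → Prop) :
    bprob E p (fun S => ∃ k ∈ s, Q k S) ≤ ∑ k ∈ s, bprob E p (Q k) := by
  classical
  simp only [bprob]
  rw [← bexp_sum]
  refine bexp_mono hp0 hp1 fun S _ => ?_
  split_ifs with h
  · obtain ⟨k, hk, hQ⟩ := h
    calc (1 : ℝ) = if Q k S then 1 else 0 := by rw [if_pos hQ]
      _ ≤ _ := Finset.single_le_sum (f := fun k => if Q k S then (1 : ℝ) else 0)
        (fun k _ => by split_ifs <;> norm_num) hk
  · exact Finset.sum_nonneg fun k _ => by split_ifs <;> norm_num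

lemma bprob_subset {E A : Finset ι} (hA : A ⊆ E) (p : ℝ) :
    bprob E p (fun S => A ⊆ S) = p ^ A.card := by
  have h := bexp_prod_ite hA p (fun _ => 1) (fun _ => 0)
  rw [Finset.prod_const] at h
  rw [show p ^ A.card = (p * 1 + (1 - p) * 0) ^ A.card by simp, ← h, bprob]
  refine bexp_congr fun S _ => ?_
  split_ifs with hs
  · rw [Finset.prod_congr rfl (g := fun _ => 1) fun e he => if_pos (hs he)]; simp
  · obtain ⟨e, heA, heS⟩ := Finset.not_subset.1 hs
    rw [Finset.prod_eq_zero heA (if_neg heS)]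

lemma bprob_disjoint {E A : Finset ι} (hA : A ⊆ E) (p : ℝ) :
    bprob E p (fun S => Disjoint A S) = (1 - p) ^ A.card := by
  have h := bexp_prod_ite hA p (fun _ => 0) (fun _ => 1)
  rw [Finset.prod_const] at h
  rw [show (1 - p) ^ A.card = (p * 0 + (1 - p) * 1) ^ A.card by simp, ← h, bprob]
  refine bexp_congr fun S _ => ?_
  split_ifs with hs
  · rw [Finset.prod_congr rfl (g := fun _ => 1) fun e he =>
      if_neg (Finset.disjoint_left.1 hs he)]; simp
  · obtain ⟨e, heA, heS⟩ := Finset.not_disjoint_iff.1 hs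
    symm
    apply Finset.prod_eq_zero heA
    exact if_pos heS

lemma one_sub_pow_le_exp {p : ℝ} (hp1 : p ≤ 1) (k : ℕ) : (1 - p) ^ k ≤ Real.exp (-p * k) := by
  rw [mul_comm, Real.exp_nat_mul]
  exact pow_le_pow_left₀ (by linarith) (by linarith [Real.add_one_le_exp (-p)]) k

/-- The probability that at most one element is retained. -/
lemma bprob_card_le_one (A : Finset ι) (p : ℝ) :
    bprob A p (fun S => S.card ≤ 1) = (1 - p) ^ A.card + A.card * p * (1 - p) ^ (A.card - 1) := by
  induction A using Finset.induction_on with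
  | empty => simp [bprob]
  | insert e A he ih =>
    have h0 : bprob A p (fun S => (insert e S).card ≤ 1) = (1 - p) ^ A.card := by
      rw [← bprob_disjoint (Finset.Subset.refl A) p]
      refine bexp_congr fun S hS => ?_
      beta_reduce
      rw [Finset.card_insert_of_notMem fun h => he (hS h)]
      by_cases hs : S = ∅
      · simp [hs]
      · have h1 := Finset.card_pos.2 (Finset.nonempty_iff_ne_empty.2 hs)
        have h2 : ¬ Disjoint A S := fun h => hs (by
          have := Finset.disjoint_of_subset_left hS h; simpa using this)
        rw [if_neg (by omega), if_neg h2]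
    have h1 : bprob (insert e A) p (fun S => S.card ≤ 1) =
        p * bprob A p (fun S => (insert e S).card ≤ 1) + (1 - p) * bprob A p fun S => S.card ≤ 1 :=
      bexp_insert he _ _
    rw [h1, h0, ih, Finset.card_insert_of_notMem he]
    rcases Nat.eq_zero_or_pos A.card with h | h
    · simp [h]
    · obtain ⟨k, hk⟩ := Nat.exists_eq_add_of_lt h
      simp only [zero_add] at hk
      rw [hk]
      push_cast
      ring

lemma bprob_union (E : Finset ι) (p q : ℝ) (Q : Finset ι → Prop) :
    bexp E p (fun S => bprob E q fun T => Q (S ∪ T)) = bprob E (p + q - p * q) Q :=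
  bexp_union E p q fun S => @ite ℝ (Q S) (Classical.propDecidable _) 1 0

end Bernoulli

/-! ### Random subgraphs -/

section RandomSubgraph

variable {V : Type*} [Fintype V] [DecidableEq V]

/-- There are finitely many edge sets, so the measure unwinds into a finite weighted sum, and
measure theory plays no further role. -/
lemma probHamiltonian_eq_bprob (Γ : SimpleGraph V) [DecidableRel Γ.Adj] (p : unitInterval) :
    probHamiltonian Γ p = bprob Γ.edgeFinset (p : ℝ)
      (fun S => (SimpleGraph.fromEdgeSet (S : Set (Sym2 V))).IsHamiltonian) := by
  classical
  have hmeas : Measurable (SimpleGraph.fromEdgeSet : Set (Sym2 V) → SimpleGraph V) := by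
    fun_prop
  have hms : MeasurableSet {G : SimpleGraph V | G.IsHamiltonian} := by
    rw [← Set.preimage_image_eq {G : SimpleGraph V | G.IsHamiltonian}
      SimpleGraph.edgeSet_injective]
    exact SimpleGraph.measurable_edgeSet (Set.toFinite _).measurableSet
  rw [probHamiltonian, randomSubgraph, Measure.real, Measure.map_apply hmeas hms,
    setBernoulli_apply_eq_apply_subsets, ← Measure.real]
  set B : Finset (Finset (Sym2 V)) := Γ.edgeFinset.powerset.filter
    (fun S => (SimpleGraph.fromEdgeSet (S : Set (Sym2 V))).IsHamiltonian) with hB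
  have hset : {s | s ∈ SimpleGraph.fromEdgeSet ⁻¹' {G : SimpleGraph V | G.IsHamiltonian} ∧
      s ⊆ Γ.edgeSet} = ⋃ S ∈ B, {(S : Set (Sym2 V))} := by
    ext s
    simp only [Set.mem_ofPred_eq, Set.mem_preimage, Set.mem_iUnion, Set.mem_singleton_iff, hB,
      Finset.mem_filter, Finset.mem_powerset]
    constructor
    · rintro ⟨h1, h2⟩
      refine ⟨s.toFinset, ⟨?_, by simpa using h1⟩, by simp⟩
      intro e he
      simpa using h2 (by simpa using he)
    · rintro ⟨S, ⟨h1, h2⟩, rfl⟩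
      exact ⟨h2, fun e he => by simpa using h1 (by simpa using he)⟩
  rw [hset, measureReal_biUnion_finset (by
    intro S _ T _ hST
    simpa [Function.onFun] using hST) (by simp), bprob, bexp]
  rw [hB, Finset.sum_filter]
  refine Finset.sum_congr rfl fun S hS => ?_
  have hsub : (S : Set (Sym2 V)) ⊆ Γ.edgeSet := fun e he => by
    simpa using Finset.mem_powerset.1 hS he
  rw [setBernoulli_real_singleton p hsub (Set.toFinite _), Set.ncard_coe_finset,
    ← SimpleGraph.coe_edgeFinset, ← Finset.coe_sdiff, Set.ncard_coe_finset]
  split_ifs <;> simp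

end RandomSubgraph

/-! ### Longest paths and rotations -/

set_option linter.unusedSectionVars false

section Rotation

variable {V : Type*} [DecidableEq V]

lemma getLast?_cons_concat (a b : V) (l : List V) : (a :: (l ++ [b])).getLast? = some b := by
  rw [← List.cons_append, List.getLast?_concat]

/-- A path of `G`, given as the list of its vertices. -/
structure IsPathList (G : SimpleGraph V) (l : List V) : Prop where
  chain : l.IsChain G.Adj
  nodup : l.Nodup

/-- A path of maximal length. -/
structure IsLongestPath (G : SimpleGraph V) (l : List V) : Prop where
  isPathList : IsPathList G l
  length_le : ∀ l', IsPathList G l' → l'.length ≤ l.length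

/-- The paths obtained from `l₀` by rotations that keep the first vertex fixed. -/
inductive Rotated (G : SimpleGraph V) (l₀ : List V) : List V → Prop
  | refl : Rotated G l₀ l₀
  | step {A B : List V} {u v : V} : Rotated G l₀ (A ++ u :: B) → v ∈ B.getLast? → G.Adj u v →
      Rotated G l₀ (A ++ u :: B.reverse)

lemma IsPathList.mono {G H : SimpleGraph V} (h : G ≤ H) {l : List V} (hl : IsPathList G l) :
    IsPathList H l :=
  ⟨hl.chain.imp fun _ _ hab => h hab, hl.nodup⟩

lemma List.IsChain.reverse_of_adj {G : SimpleGraph V} {l : List V} (h : l.IsChain G.Adj) :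
    l.reverse.IsChain G.Adj :=
  List.isChain_reverse.2 (h.imp fun _ _ hab => hab.symm)

lemma IsPathList.reverse {G : SimpleGraph V} {l : List V} (hl : IsPathList G l) :
    IsPathList G l.reverse :=
  ⟨hl.chain.reverse_of_adj, List.nodup_reverse.2 hl.nodup⟩

lemma IsPathList.rotate {G : SimpleGraph V} {A B : List V} {u v : V}
    (hl : IsPathList G (A ++ u :: B)) (hv : v ∈ B.getLast?) (huv : G.Adj u v) :
    IsPathList G (A ++ u :: B.reverse) := by
  obtain ⟨hc, hn⟩ := hl
  refine ⟨?_, ?_⟩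
  · rw [List.isChain_split] at hc ⊢
    refine ⟨hc.1, ?_⟩
    have hB := hc.2.tail.reverse_of_adj
    simp only [List.tail_cons] at hB
    rw [← List.singleton_append]
    refine List.IsChain.append (by simp) hB fun x hx y hy => ?_
    rw [List.head?_reverse] at hy
    simp only [List.getLast?_singleton, Option.mem_def, Option.some.injEq] at hx hy hv
    rw [hv] at hy
    cases hy; subst hx; exact huv
  · refine (List.Perm.nodup_iff ?_).1 hn
    exact List.Perm.append_left _ (List.Perm.cons _ (List.reverse_perm _).symm)

lemma Rotated.perm {G : SimpleGraph V} {l₀ l : List V} (h : Rotated G l₀ l) : l.Perm l₀ := by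
  induction h with
  | refl => rfl
  | step _ _ _ ih =>
    exact (List.Perm.append_left _ (List.Perm.cons _ (List.reverse_perm _))).trans ih

lemma Rotated.isPathList {G : SimpleGraph V} {l₀ l : List V} (h : Rotated G l₀ l)
    (h0 : IsPathList G l₀) : IsPathList G l := by
  induction h with
  | refl => exact h0
  | step _ hv huv ih => exact ih.rotate hv huv

lemma Rotated.head? {G : SimpleGraph V} {l₀ l : List V} (h : Rotated G l₀ l) :
    l.head? = l₀.head? := by
  induction h with
  | refl => rfl
  | @step A B u v _ _ _ ih => rw [← ih]; cases A <;> simp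

/-- `List.formPerm` serves as the successor map along a path. It also sends the last vertex to the
first, so that vertex needs separate treatment. -/
lemma formPerm_of_infix {l : List V} (hl : l.Nodup) {a b : V} (h : [a, b] <:+: l) :
    l.formPerm a = b := by
  obtain ⟨s, t, rfl⟩ := h
  have h1 := List.formPerm_apply_lt_getElem (s ++ [a, b] ++ t) hl s.length (by simp)
  simpa using h1

lemma not_infix_of_head? {l : List V} (hl : l.Nodup) {a b : V} (hb : l.head? = some b) :
    ¬ [a, b] <:+: l := by
  rintro ⟨s, t, rfl⟩
  cases s with
  | nil => simp at hb hl; simp_all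
  | cons c s => simp at hb hl; simp_all

lemma not_infix_of_getLast? {l : List V} (hl : l.Nodup) {a b : V} (hb : l.getLast? = some a) :
    ¬ [a, b] <:+: l := by
  intro h
  refine not_infix_of_head? (List.nodup_reverse.2 hl) (a := b) (b := a) (by simpa using hb) ?_
  simpa using List.reverse_infix.2 h

/-- A consecutive pair of `l₀` stays consecutive under rotations if neither of its elements ever
becomes an end. -/
lemma Rotated.infix {G : SimpleGraph V} {l₀ l : List V} (h : Rotated G l₀ l) {a b : V}
    (hab : [a, b] <:+: l₀) (ha : ∀ l', Rotated G l₀ l' → a ∉ l'.getLast?)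
    (hb : ∀ l', Rotated G l₀ l' → b ∉ l'.getLast?) : [a, b] <:+: l ∨ [b, a] <:+: l := by
  have key : ∀ (A B : List V) (u v a b : V), Rotated G l₀ (A ++ u :: B) → v ∈ B.getLast? →
      G.Adj u v → [a, b] <:+: A ++ u :: B → (∀ l', Rotated G l₀ l' → b ∉ l'.getLast?) →
      [a, b] <:+: A ++ u :: B.reverse ∨ [b, a] <:+: A ++ u :: B.reverse := by
    intro A B u v a b hr hv huv hi hb
    -- A rotation at `u` destroys only the pair of `u` and its successor, and that successor becomes
    -- the new last vertex, which `hb` forbids. Any other pair is kept, or reversed if it lies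
    -- beyond `u`.
    have hr' := hr.step hv huv
    obtain ⟨s, t, hst⟩ := hi
    rw [List.append_assoc, List.append_eq_append_iff] at hst
    rcases hst with ⟨as, h1, h2⟩ | ⟨bs, h1, h2⟩
    · rcases as with _ | ⟨c, as⟩
      · -- `u = a`
        simp only [List.nil_append, List.cons_append, List.cons.injEq] at h2
        obtain ⟨rfl, h2⟩ := h2
        exfalso
        refine hb _ hr' ?_
        simp [← h2, getLast?_cons_concat]
      · simp only [List.cons_append, List.nil_append, List.cons.injEq] at h2
        obtain ⟨rfl, h2⟩ := h2
        rcases as with _ | ⟨c, as⟩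
        · simp only [List.nil_append, List.cons.injEq] at h2
          obtain ⟨rfl, h2⟩ := h2
          left
          rw [h1]
          exact ⟨s, B.reverse, by simp⟩
        · simp only [List.cons_append, List.cons.injEq] at h2
          obtain ⟨rfl, h2⟩ := h2
          left
          rw [h1]
          exact ⟨s, as ++ u :: B.reverse, by simp⟩
    · rcases bs with _ | ⟨c, bs⟩
      · simp only [List.nil_append, List.cons_append, List.cons.injEq] at h2
        obtain ⟨rfl, h2⟩ := h2
        exfalso
        refine hb _ hr' ?_
        simp [h2, getLast?_cons_concat]
      · simp only [List.cons_append, List.cons.injEq] at h2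
        obtain ⟨rfl, h2⟩ := h2
        right
        rw [h2]
        exact ⟨A ++ u :: t.reverse, bs.reverse, by simp⟩
  induction h with
  | refl => exact Or.inl hab
  | step hr hv huv ih =>
    rcases ih with ih | ih
    · exact key _ _ _ _ _ _ hr hv huv ih hb
    · exact (key _ _ _ _ _ _ hr hv huv ih ha).symm

variable [Fintype V]

open Classical in
/-- The external neighbourhood of a set of vertices. -/
noncomputable def extNbr (G : SimpleGraph V) (S : Finset V) : Finset V :=
  Finset.univ.filter fun v => v ∉ S ∧ ∃ u ∈ S, G.Adj u v

lemma mem_extNbr {G : SimpleGraph V} {S : Finset V} {v : V} :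
    v ∈ extNbr G S ↔ v ∉ S ∧ ∃ u ∈ S, G.Adj u v := by
  simp [extNbr]

open Classical in
/-- The last vertices of longest paths that start at `x`. -/
noncomputable def longestEnds (G : SimpleGraph V) (x : V) : Finset V :=
  Finset.univ.filter fun y => ∃ l, IsLongestPath G l ∧ l.head? = some x ∧ l.getLast? = some y

/-- **Pósa's lemma**: a set of rotation ends has few external neighbours. -/
lemma exists_card_extNbr_lt {G : SimpleGraph V} {l₀ : List V} (hl₀ : IsLongestPath G l₀) {x : V}
    (hx : l₀.head? = some x) :
    ∃ S ⊆ longestEnds G x, S.Nonempty ∧ (extNbr G S).card < 2 * S.card := by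
  classical
  set S : Finset V := Finset.univ.filter fun y => ∃ l, Rotated G l₀ l ∧ y ∈ l.getLast? with hS
  have hnd := hl₀.isPathList.nodup
  have hlong : ∀ l, Rotated G l₀ l → IsLongestPath G l := fun l hl =>
    ⟨hl.isPathList hl₀.isPathList, fun l' hl' => hl.perm.length_eq ▸ hl₀.length_le l' hl'⟩
  have hmem : ∀ {y l}, Rotated G l₀ l → y ∈ l.getLast? → y ∈ S := fun hl hy =>
    Finset.mem_filter.2 ⟨Finset.mem_univ _, _, hl, hy⟩
  have hnot : ∀ {y}, y ∉ S → ∀ l, Rotated G l₀ l → y ∉ l.getLast? := fun hy l hl h =>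
    hy (hmem hl h)
  have hne : l₀ ≠ [] := by rintro rfl; simp at hx
  set y₀ := l₀.getLast hne with hy₀
  have hy₀' : l₀.getLast? = some y₀ := List.getLast?_eq_getLast_of_ne_nil hne
  have hy₀S : y₀ ∈ S := hmem Rotated.refl hy₀'
  refine ⟨S, ?_, ⟨y₀, hy₀S⟩, ?_⟩
  · intro y hy
    obtain ⟨-, l, hl, hyl⟩ := Finset.mem_filter.1 hy
    exact Finset.mem_filter.2 ⟨Finset.mem_univ _, l, hlong l hl, by rw [hl.head?, hx], hyl⟩
  -- Each external neighbour of `S` is a successor or predecessor on `l₀` of a rotation end. The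
  -- last vertex `y₀` has no successor on the path; erasing it makes the final inequality strict.
  have hsub : extNbr G S ⊆ (S.erase y₀).image l₀.formPerm ∪ S.image ((l₀.formPerm)⁻¹ : Equiv.Perm V) := by
    intro u hu
    obtain ⟨huS, v, hvS, hvu⟩ := mem_extNbr.1 hu
    obtain ⟨-, l, hl, hvl⟩ := Finset.mem_filter.1 hvS
    have hpl := hl.isPathList hl₀.isPathList
    have hul : u ∈ l := by
      by_contra hul
      have : IsPathList G (l ++ [u]) := by
        refine ⟨hpl.chain.append (by simp) ?_, ?_⟩
        · intro a ha b hb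
          simp only [List.head?_cons, Option.mem_def, Option.some.injEq] at ha hb hvl
          rw [hvl] at ha; cases ha; subst hb; exact hvu
        · rw [List.nodup_append]
          refine ⟨hpl.nodup, by simp, ?_⟩
          intro a ha b hb
          simp only [List.mem_singleton] at hb
          subst hb
          rintro rfl; exact hul ha
      have := (hlong l hl).length_le _ this
      simp at this
    obtain ⟨A, B, hAB⟩ := List.append_of_mem hul
    rcases B with _ | ⟨b, B⟩
    · exact absurd (hmem hl (by simp [hAB])) huS
    -- Rotating `l` with the edge `u v` turns the successor `b` of `u` into an end.
    have hbS : b ∈ S := by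
      have h1 : v ∈ (b :: B).getLast? := by
        rw [hAB, List.getLast?_append_of_ne_nil _ (by simp), List.getLast?_cons_cons] at hvl
        exact hvl
      rw [hAB] at hl
      exact hmem (hl.step h1 hvu.symm) (by simp [getLast?_cons_concat])
    have hub : [u, b] <:+: l := ⟨A, B, by simp [hAB]⟩
    -- it suffices to find a neighbour of `u` on `l₀` that is an end
    suffices h : ∃ a ∈ S, [a, u] <:+: l₀ ∨ [u, a] <:+: l₀ by
      obtain ⟨a, haS, h | h⟩ := h
      · refine Finset.mem_union_left _ (Finset.mem_image.2 ⟨a, Finset.mem_erase.2 ⟨?_, haS⟩,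
          formPerm_of_infix hnd h⟩)
        rintro rfl
        exact not_infix_of_getLast? hnd hy₀' h
      · refine Finset.mem_union_right _ (Finset.mem_image.2 ⟨a, haS, ?_⟩)
        rw [Equiv.Perm.inv_eq_iff_eq, formPerm_of_infix hnd h]
    -- If neither path neighbour of `u` on `l₀` is an end, no rotation separates them from `u`, so
    -- they are still its neighbours on `l`. But the successor of `u` on `l` is the end `b`.
    by_contra! hno
    obtain ⟨A', B', hAB'⟩ := List.append_of_mem (hl.perm.subset hul)
    rcases B' with _ | ⟨c, B'⟩
    · exact huS (hmem Rotated.refl (by simp [hAB']))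
    have huc : [u, c] <:+: l₀ := ⟨A', B', by simp [hAB']⟩
    have hcS : c ∉ S := fun h => (hno c h).2 huc
    have hcb : c ≠ b := by rintro rfl; exact hcS hbS
    have hc1 : [c, u] <:+: l := by
      rcases hl.infix huc (hnot huS) (hnot hcS) with h | h
      · exact absurd ((formPerm_of_infix hpl.nodup h).symm.trans
          (formPerm_of_infix hpl.nodup hub)) hcb
      · exact h
    rcases List.eq_nil_or_concat A' with rfl | ⟨A'', d, rfl⟩
    · refine not_infix_of_head? hpl.nodup ?_ hc1
      rw [hl.head?, hAB']; simp
    · have hdu : [d, u] <:+: l₀ := ⟨A'', c :: B', by simp [hAB']⟩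
      have hdS : d ∉ S := fun h => (hno d h).1 hdu
      have hdc : d ≠ c := by
        rintro rfl
        rw [hAB'] at hnd
        simp [List.nodup_append] at hnd
      rcases hl.infix hdu (hnot hdS) (hnot huS) with h | h
      · refine hdc ?_
        have := (formPerm_of_infix hpl.nodup h).trans (formPerm_of_infix hpl.nodup hc1).symm
        exact (l.formPerm).injective this
      · have := (formPerm_of_infix hpl.nodup h).symm.trans (formPerm_of_infix hpl.nodup hub)
        exact hdS (this ▸ hbS)
  have h1 := (Finset.card_le_card hsub).trans (Finset.card_union_le _ _)
  have h2 := (Finset.card_image_le (s := S.erase y₀) (f := l₀.formPerm))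
  have h3 := (Finset.card_image_le (s := S) (f := ((l₀.formPerm)⁻¹ : Equiv.Perm V)))
  rw [Finset.card_erase_of_mem hy₀S] at h2
  have h4 := Finset.card_pos.2 ⟨y₀, hy₀S⟩
  omega

/-- The set of ends supplied by Pósa's lemma fails to expand by a factor two, so it must be larger
than `m`. -/
lemma lt_card_longestEnds {G : SimpleGraph V} {m : ℕ}
    (hG : ∀ S : Finset V, S.card ≤ m → 2 * S.card ≤ (extNbr G S).card)
    {l : List V} (hl : IsLongestPath G l) {x : V} (hx : l.head? = some x) :
    m < (longestEnds G x).card := by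
  obtain ⟨S, hS, -, hlt⟩ := exists_card_extNbr_lt hl hx
  by_contra! h
  have := hG S ((Finset.card_le_card hS).trans h)
  omega

lemma exists_isLongestPath [Nonempty V] (G : SimpleGraph V) :
    ∃ l, IsLongestPath G l ∧ l ≠ [] := by
  classical
  have hb : ∀ l, IsPathList G l → l.length ≤ Fintype.card V := fun l hl =>
    hl.nodup.length_le_card
  let P : ℕ → Prop := fun k => ∃ l, IsPathList G l ∧ l.length = k
  obtain ⟨v⟩ := ‹Nonempty V›
  have h1 : P 1 := ⟨[v], ⟨by simp, by simp⟩, rfl⟩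
  have hc : 1 ≤ Fintype.card V := Fintype.card_pos_iff.2 ⟨v⟩
  obtain ⟨l, hl, hk⟩ := Nat.findGreatest_spec (P := P) hc h1
  have hmax : ∀ l', IsPathList G l' → l'.length ≤ l.length := fun l' hl' => by
    rw [hk]; exact Nat.le_findGreatest (hb l' hl') ⟨l', hl', rfl⟩
  refine ⟨l, ⟨hl, hmax⟩, ?_⟩
  rintro rfl
  have := hmax [v] ⟨by simp, by simp⟩
  simp at this

/-- A spanning path whose ends are adjacent closes to a Hamilton cycle. -/
lemma IsPathList.isHamiltonian {G : SimpleGraph V} {l : List V} (hl : IsPathList G l)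
    (hcard : l.length = Fintype.card V) (h3 : 3 ≤ Fintype.card V) {x y : V} (hx : l.head? = some x)
    (hy : l.getLast? = some y) (hyx : G.Adj y x) : G.IsHamiltonian := by
  intro _
  have hne : l ≠ [] := by rintro rfl; simp at hx
  have hx' : l.head hne = x := by rw [List.head?_eq_some_head hne] at hx; simpa using hx
  have hy' : l.getLast hne = y := by
    rw [List.getLast?_eq_getLast_of_ne_nil hne] at hy; simpa using hy
  subst hx' hy'
  set p := SimpleGraph.Walk.ofSupport l hne hl.chain with hp
  have hpath : p.IsPath := by
    rw [SimpleGraph.Walk.isPath_def, hp, SimpleGraph.Walk.support_ofSupport]; exact hl.nodup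
  have hlen : p.length = l.length - 1 := by rw [hp, SimpleGraph.Walk.length_ofSupport]
  refine ⟨_, SimpleGraph.Walk.cons hyx p, ?_⟩
  rw [SimpleGraph.Walk.isHamiltonianCycle_iff_isCycle_and_length_eq,
    SimpleGraph.Walk.cons_isCycle_iff]
  refine ⟨⟨hpath, fun h => ?_⟩, ?_⟩
  · rw [Sym2.eq_swap] at h
    have := hpath.length_eq_one_of_mem_edges h
    omega
  · rw [SimpleGraph.Walk.length_cons]; omega

/-- A cycle in a connected graph either is a Hamilton cycle or gives a path that is longer by
one vertex. -/
lemma isHamiltonian_or_exists_longer_of_cycle {G : SimpleGraph V} (hG : G.Connected)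
    (h3 : 3 ≤ Fintype.card V) {l : List V} (hl : IsPathList G l) {x y : V} (hx : l.head? = some x)
    (hy : l.getLast? = some y) (hyx : G.Adj y x) :
    G.IsHamiltonian ∨ ∃ l', IsPathList G l' ∧ l.length < l'.length := by
  by_cases hall : ∀ v, v ∈ l
  · left
    refine hl.isHamiltonian ?_ h3 hx hy hyx
    rw [← List.toFinset_card_of_nodup hl.nodup, ← Finset.card_univ]
    congr 1
    ext v; simp [hall v]
  right
  push Not at hall
  obtain ⟨v, hv⟩ := hall
  have hxl : x ∈ l := List.mem_of_mem_head? hx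
  -- Connectivity gives an edge `c d` leaving the cycle. Opening the cycle just after `c` and
  -- appending `d` gains one vertex.
  obtain ⟨w⟩ := hG.preconnected x v
  obtain ⟨⟨⟨c, d⟩, hcd⟩, -, hc, hd⟩ := w.exists_boundary_dart {u | u ∈ l} hxl hv
  simp only [Set.mem_ofPred_eq] at hc hd
  obtain ⟨A, B, rfl⟩ := List.append_of_mem hc
  refine ⟨B ++ (A ++ [c]) ++ [d], ⟨?_, ?_⟩, by simp; omega⟩
  · have hch := List.isChain_split.1 hl.chain
    refine List.IsChain.append (List.IsChain.append hch.2.tail hch.1 ?_) (by simp) ?_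
    · intro a ha b hb
      simp only [Option.mem_def] at ha hb
      have hne : B ≠ [] := by rintro rfl; simp at ha
      have h1 : (A ++ c :: B).getLast? = B.getLast? := by
        rw [List.getLast?_append_of_ne_nil _ (by simp)]
        obtain ⟨b', B', rfl⟩ := List.exists_cons_of_ne_nil hne
        simp
      have h2 : (A ++ [c]).head? = (A ++ c :: B).head? := by cases A <;> simp
      rw [h1, ha] at hy
      rw [h2, hx] at hb
      cases hy; cases hb
      exact hyx
    · intro a ha b hb
      simp only [List.head?_cons, Option.mem_def, Option.some.injEq] at hb
      rw [← List.append_assoc] at ha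
      simp only [List.getLast?_append, List.getLast?_singleton, Option.some_or, Option.mem_def,
        Option.some.injEq] at ha
      subst ha hb
      exact hcd
  · have h1 : (B ++ (A ++ [c]) ++ [d]).Perm (d :: (A ++ c :: B)) := by
      refine (List.perm_append_comm).trans ?_
      simp only [List.singleton_append]
      refine List.Perm.cons _ (List.perm_append_comm.trans ?_)
      simp
    rw [h1.nodup_iff, List.nodup_cons]
    exact ⟨hd, hl.nodup⟩

/-- Two additional edges at the ends of a longest path, matched along the path, produce a longer
path or a Hamilton cycle. -/
lemma isHamiltonian_or_exists_longer {G H : SimpleGraph V} (hGH : G ≤ H) (hG : G.Connected)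
    (h3 : 3 ≤ Fintype.card V) {l : List V} (hl : IsPathList G l) {x y w : V}
    (hx : l.head? = some x) (hy : l.getLast? = some y) (hyw : H.Adj y w)
    (hxw : H.Adj x (l.formPerm w)) :
    H.IsHamiltonian ∨ ∃ l', IsPathList H l' ∧ l.length < l'.length := by
  have hlH := hl.mono hGH
  by_cases hw : w ∈ l
  · obtain ⟨A, B, rfl⟩ := List.append_of_mem hw
    rcases B with _ | ⟨z, B⟩
    · simp at hy
      exact absurd hy.symm hyw.ne
    have hz : (A ++ w :: z :: B).formPerm w = z :=
      formPerm_of_infix hl.nodup ⟨A, B, by simp⟩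
    rw [hz] at hxw
    have hy' : y ∈ (z :: B).getLast? := by
      rw [List.getLast?_append_of_ne_nil _ (by simp), List.getLast?_cons_cons] at hy
      exact hy
    -- Rotating with the edge `y w` produces a path from `x` to the successor `z` of `w`, and `x z`
    -- closes it to a cycle.
    have h1 := hlH.rotate hy' hyw.symm
    have h2 := isHamiltonian_or_exists_longer_of_cycle (hG.mono hGH) h3 h1 (x := x) (y := z)
      (by rw [← hx]; cases A <;> simp) (by simp [getLast?_cons_concat]) hxw.symm
    simpa using h2
  · right
    refine ⟨l ++ [w], ⟨hlH.chain.append (by simp) ?_, ?_⟩, by simp⟩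
    · intro a ha b hb
      simp only [List.head?_cons, Option.mem_def, Option.some.injEq] at ha hb
      rw [hy] at ha; cases ha; subst hb; exact hyw
    · rw [List.nodup_append]
      refine ⟨hl.nodup, by simp, ?_⟩
      intro a ha b hb
      simp only [List.mem_singleton] at hb
      subst hb
      rintro rfl; exact hw ha

end Rotation

/-! ### Expansion -/

section Expansion

variable {V : Type*} [Fintype V] [DecidableEq V]

open Classical in
/-- The neighbourhood of a vertex, as a finite set. -/
noncomputable def nbr (G : SimpleGraph V) (v : V) : Finset V := Finset.univ.filter fun w => G.Adj v w

lemma mem_nbr {G : SimpleGraph V} {v w : V} : w ∈ nbr G v ↔ G.Adj v w := by simp [nbr]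

/-- Let `U` be a set of vertices that are pairwise at distance at least five. If sets that avoid
`U` expand by a factor six, then all sets expand by a factor two. -/
lemma two_mul_card_le_card_extNbr {G H R : SimpleGraph V} (hRH : R ≤ H) (hHG : H ≤ G)
    {U : Finset V} {m : ℕ} (hU : ∀ u ∈ U, ∀ v, G.Adj u v → H.Adj u v)
    (hdeg : ∀ u ∈ U, 2 ≤ (nbr G u).card)
    (h1 : ∀ u ∈ U, ∀ u' ∈ U, u ≠ u' → ¬ G.Adj u u')
    (h2 : ∀ u ∈ U, ∀ u' ∈ U, u ≠ u' → ∀ a, G.Adj u a → ¬ G.Adj a u')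
    (h3 : ∀ u ∈ U, ∀ u' ∈ U, u ≠ u' → ∀ a b, G.Adj u a → G.Adj a b → ¬ G.Adj b u')
    (h4 : ∀ u ∈ U, ∀ u' ∈ U, u ≠ u' → ∀ a b c, G.Adj u a → G.Adj a b → G.Adj b c → ¬ G.Adj c u')
    (hcod : ∀ u v, u ≠ v → (nbr G u ∩ nbr G v).card ≤ 2)
    (hR : ∀ S : Finset V, Disjoint S U → S.card ≤ m → 6 * S.card ≤ (extNbr R S).card)
    (S : Finset V) (hS : S.card ≤ m) : 2 * S.card ≤ (extNbr H S).card := by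
  set S₁ := S ∩ U with hS₁
  set S₂ := S \ U with hS₂
  have hcard : S₁.card + S₂.card = S.card := Finset.card_inter_add_card_sdiff S U
  set N := S₁.biUnion (nbr G) with hN
  have hNcard : 2 * S₁.card ≤ N.card := by
    rw [hN, Finset.card_biUnion]
    · rw [mul_comm, ← smul_eq_mul]
      exact Finset.card_nsmul_le_sum _ _ _ fun u hu => hdeg u (Finset.mem_inter.1 hu).2
    · intro u hu u' hu' hne
      change Disjoint (nbr G u) (nbr G u')
      rw [Finset.disjoint_left]
      intro a ha ha'
      exact h2 u (Finset.mem_inter.1 hu).2 u' (Finset.mem_inter.1 hu').2 hne a (mem_nbr.1 ha)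
        (mem_nbr.1 ha').symm
  have hNU : ∀ v ∈ N, v ∉ U := by
    intro v hv hvU
    obtain ⟨u, hu, hv⟩ := Finset.mem_biUnion.1 hv
    have hadj := mem_nbr.1 hv
    exact h1 u (Finset.mem_inter.1 hu).2 v hvU hadj.ne hadj
  have hsub1 : N \ S₂ ⊆ extNbr H S := by
    intro v hv
    rw [Finset.mem_sdiff] at hv
    have hvU := hNU v hv.1
    obtain ⟨u, hu, hvu⟩ := Finset.mem_biUnion.1 hv.1
    refine mem_extNbr.2 ⟨fun h => hv.2 (Finset.mem_sdiff.2 ⟨h, hvU⟩), u,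
      (Finset.mem_inter.1 hu).1, hU u (Finset.mem_inter.1 hu).2 v (mem_nbr.1 hvu)⟩
  set M := extNbr R S₂ \ (S₁ ∪ N) with hM
  have hsub2 : M ⊆ extNbr H S := by
    intro v hv
    obtain ⟨hv1, hv2⟩ := Finset.mem_sdiff.1 hv
    obtain ⟨hv3, u, hu, huv⟩ := mem_extNbr.1 hv1
    refine mem_extNbr.2 ⟨fun h => ?_, u, (Finset.mem_sdiff.1 hu).1, hRH huv⟩
    by_cases hvU : v ∈ U
    · exact hv2 (Finset.mem_union_left _ (Finset.mem_inter.2 ⟨h, hvU⟩))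
    · exact hv3 (Finset.mem_sdiff.2 ⟨h, hvU⟩)
  have hdis : Disjoint (N \ S₂) M := by
    rw [Finset.disjoint_left]
    intro v hv hv'
    exact (Finset.mem_sdiff.1 hv').2 (Finset.mem_union_right _ (Finset.mem_sdiff.1 hv).1)
  -- By the distance hypotheses, only one vertex `u₀` of `U` can be equal or adjacent to a neighbour
  -- of `v`. So `v` sees at most `u₀` and two common neighbours with `u₀`.
  have hloc : ∀ v ∈ S₂, (nbr G v ∩ (S₁ ∪ N)).card ≤ 3 := by
    intro v hv
    have hvU := (Finset.mem_sdiff.1 hv).2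
    have near : ∀ w ∈ nbr G v ∩ (S₁ ∪ N), ∃ u ∈ U, w = u ∨ (G.Adj u w) := by
      intro w hw
      rcases Finset.mem_union.1 (Finset.mem_inter.1 hw).2 with h | h
      · exact ⟨w, (Finset.mem_inter.1 h).2, Or.inl rfl⟩
      · obtain ⟨u, hu, h⟩ := Finset.mem_biUnion.1 h
        exact ⟨u, (Finset.mem_inter.1 hu).2, Or.inr (mem_nbr.1 h)⟩
    rcases Finset.eq_empty_or_nonempty (nbr G v ∩ (S₁ ∪ N)) with he | ⟨w₀, hw₀⟩
    · simp [he]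
    obtain ⟨u₀, hu₀, hw₀u⟩ := near w₀ hw₀
    have hvw₀ : G.Adj v w₀ := mem_nbr.1 (Finset.mem_inter.1 hw₀).1
    have hsub : nbr G v ∩ (S₁ ∪ N) ⊆ insert u₀ (nbr G v ∩ nbr G u₀) := by
      intro w hw
      obtain ⟨u, hu, hwu⟩ := near w hw
      have hvw : G.Adj v w := mem_nbr.1 (Finset.mem_inter.1 hw).1
      have huu : u₀ = u := by
        by_contra hne
        rcases hw₀u with rfl | hw₀u <;> rcases hwu with rfl | hwu
        · exact h2 _ hu₀ _ hu hne v hvw₀.symm hvw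
        · exact h3 _ hu₀ _ hu hne v w hvw₀.symm hvw hwu.symm
        · exact h3 _ hu₀ _ hu hne w₀ v hw₀u hvw₀.symm hvw
        · exact h4 _ hu₀ _ hu hne w₀ v w hw₀u hvw₀.symm hvw hwu.symm
      subst huu
      rcases hwu with rfl | hwu
      · exact Finset.mem_insert_self _ _
      · exact Finset.mem_insert_of_mem (Finset.mem_inter.2 ⟨mem_nbr.2 hvw, mem_nbr.2 hwu⟩)
    have hvu : v ≠ u₀ := by rintro rfl; exact hvU hu₀
    have := hcod v u₀ hvu
    exact (Finset.card_le_card hsub).trans ((Finset.card_insert_le _ _).trans (by omega))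
  have hint : (extNbr R S₂ ∩ (S₁ ∪ N)).card ≤ 3 * S₂.card := by
    calc (extNbr R S₂ ∩ (S₁ ∪ N)).card
        ≤ (S₂.biUnion fun v => nbr G v ∩ (S₁ ∪ N)).card := by
          refine Finset.card_le_card fun w hw => ?_
          obtain ⟨hw1, hw2⟩ := Finset.mem_inter.1 hw
          obtain ⟨-, v, hv, hvw⟩ := mem_extNbr.1 hw1
          exact Finset.mem_biUnion.2 ⟨v, hv, Finset.mem_inter.2 ⟨mem_nbr.2 (hHG (hRH hvw)), hw2⟩⟩
      _ ≤ S₂.card * 3 := Finset.card_biUnion_le_card_mul _ _ _ hloc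
      _ = 3 * S₂.card := mul_comm _ _
  -- The reason for the factor six: `N \ S₂` has at least `2|S₁| - |S₂|` elements and `M` at least
  -- `(6 - 3)|S₂|`, which sum to `2|S|`.
  have hR2 := hR S₂ Finset.sdiff_disjoint
    ((Finset.card_le_card Finset.sdiff_subset).trans hS)
  have hMcard := Finset.card_sdiff_add_card_inter (extNbr R S₂) (S₁ ∪ N)
  have hNS := Finset.le_card_sdiff S₂ N
  have hfin := Finset.card_le_card (Finset.union_subset hsub1 hsub2)
  rw [Finset.card_union_of_disjoint hdis] at hfin
  rw [← hM] at hMcard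
  omega

lemma card_filter_mem_sym2_le (e : Sym2 V) (S : Finset V) : (S.filter (· ∈ e)).card ≤ 2 := by
  induction e with
  | h a b =>
    calc (S.filter (· ∈ s(a, b))).card ≤ ({a, b} : Finset V).card := by
          refine Finset.card_le_card fun v hv => ?_
          simpa using (Finset.mem_filter.1 hv).2
      _ ≤ 2 := Finset.card_le_two

lemma fromEdgeSet_adj_of_mem {F : Finset (Sym2 V)} (hF : ∀ e ∈ F, ¬ e.IsDiag) {u v : V} :
    (SimpleGraph.fromEdgeSet (F : Set (Sym2 V))).Adj u v ↔ s(u, v) ∈ F := by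
  rw [SimpleGraph.fromEdgeSet_adj]
  simp only [Finset.mem_coe, and_iff_left_iff_imp]
  rintro h rfl
  exact hF _ h (by simp)

/-- A set of vertices of degree at least `28` expands by a factor six if small sets span few edges
and large sets have edges leaving every small neighbourhood. -/
lemma six_mul_card_le_card_extNbr {F : Finset (Sym2 V)} (hF : ∀ e ∈ F, ¬ e.IsDiag) {t₀ : ℝ} {m : ℕ}
    (hsparse : ∀ T : Finset V, T.Nonempty → (T.card : ℝ) ≤ t₀ →
      (F.filter fun e => ∀ v ∈ e, v ∈ T).card < 2 * T.card)
    (hmid : ∀ S T : Finset V, t₀ < 7 * S.card → S.card ≤ m → T.card ≤ 6 * S.card →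
      ∃ u ∈ S, ∃ v, v ∉ S ∧ v ∉ T ∧ s(u, v) ∈ F)
    {S : Finset V} (hS : S.card ≤ m) (hdeg : ∀ v ∈ S, 28 ≤ (F.filter (v ∈ ·)).card) :
    6 * S.card ≤ (extNbr (SimpleGraph.fromEdgeSet (F : Set (Sym2 V))) S).card := by
  classical
  by_contra! hlt
  set X := extNbr (SimpleGraph.fromEdgeSet (F : Set (Sym2 V))) S with hX
  have hXmem : ∀ u ∈ S, ∀ v, s(u, v) ∈ F → v ∈ S ∪ X := by
    intro u hu v huv
    by_cases hv : v ∈ S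
    · exact Finset.mem_union_left _ hv
    · exact Finset.mem_union_right _ (mem_extNbr.2 ⟨hv, u, hu, (fromEdgeSet_adj_of_mem hF).2 huv⟩)
  rcases lt_or_ge t₀ (7 * S.card) with h | h
  · obtain ⟨u, hu, v, hvS, hvX, huv⟩ := hmid S X h hS hlt.le
    rcases Finset.mem_union.1 (hXmem u hu v huv) with h | h
    · exact hvS h
    · exact hvX h
  · have hne : S.Nonempty := Finset.card_pos.1 (by omega)
    have hT : (S ∪ X).card ≤ 7 * S.card := (Finset.card_union_le _ _).trans (by omega)
    have h1 := hsparse (S ∪ X) (hne.mono Finset.subset_union_left) (by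
      refine le_trans ?_ h; exact_mod_cast hT)
    set I := F.filter fun e => ∀ v ∈ e, v ∈ S ∪ X with hI
    -- Counting incidences gives `28|S| ≤ 2|I|`. So `S ∪ X`, with at most `7|S|` vertices, would
    -- span at least `14|S|` edges, against sparsity; this fixes the constant 28.
    have h2 : ∑ v ∈ S, (F.filter (v ∈ ·)).card ≤ ∑ e ∈ I, (S.filter (· ∈ e)).card := by
      have := Finset.sum_card_bipartiteAbove_eq_sum_card_bipartiteBelow (s := S) (t := I)
        (fun v e => v ∈ e)
      simp only [Finset.bipartiteAbove, Finset.bipartiteBelow] at this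
      rw [← this]
      refine Finset.sum_le_sum fun v hv => Finset.card_le_card fun e he => ?_
      rw [Finset.mem_filter] at he ⊢
      refine ⟨Finset.mem_filter.2 ⟨he.1, ?_⟩, he.2⟩
      obtain ⟨w, rfl⟩ := Sym2.mem_iff_exists.1 he.2
      intro x hx
      rcases Sym2.mem_iff.1 hx with rfl | rfl
      · exact Finset.mem_union_left _ hv
      · exact hXmem v hv _ he.1
    have h3 : ∑ e ∈ I, (S.filter (· ∈ e)).card ≤ I.card * 2 := by
      rw [← smul_eq_mul]
      exact Finset.sum_le_card_nsmul _ _ _ fun e _ => card_filter_mem_sym2_le e S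
    have h4 : S.card * 28 ≤ ∑ v ∈ S, (F.filter (v ∈ ·)).card := by
      rw [← smul_eq_mul]
      exact Finset.card_nsmul_le_sum _ _ _ hdeg
    omega

/-- An expanding graph without sparse cuts is connected. -/
lemma connected_of_expansion [Nonempty V] {H : SimpleGraph V} {m : ℕ}
    (hexp : ∀ S : Finset V, S.card ≤ m → 2 * S.card ≤ (extNbr H S).card)
    (hcut : ∀ C : Finset V, m < C.card → 2 * C.card ≤ Fintype.card V →
      ∃ u ∈ C, ∃ v, v ∉ C ∧ H.Adj u v) : H.Connected := by
  classical
  have key : ∀ C : Finset V, C.Nonempty → 2 * C.card ≤ Fintype.card V →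
      ∃ u ∈ C, ∃ v, v ∉ C ∧ H.Adj u v := by
    intro C hC h2
    rcases le_or_gt C.card m with h | h
    · have h1 := hexp C h
      have h0 := Finset.card_pos.2 hC
      obtain ⟨v, hv⟩ := Finset.card_pos.1 (show 0 < (extNbr H C).card by omega)
      obtain ⟨hvC, u, hu, huv⟩ := mem_extNbr.1 hv
      exact ⟨u, hu, v, hvC, huv⟩
    · exact hcut C h h2
  refine ⟨fun x y => ?_⟩
  by_contra hxy
  set C : Finset V := Finset.univ.filter fun v => H.Reachable x v with hC
  have hxC : x ∈ C := by simp [hC]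
  have hyC : y ∈ Cᶜ := by simpa [hC] using hxy
  have hclosed : ∀ u v, u ∈ C → H.Adj u v → v ∈ C := by
    intro u v hu huv
    simp only [hC, Finset.mem_filter, Finset.mem_univ, true_and] at hu ⊢
    exact hu.trans huv.reachable
  rcases le_total (2 * C.card) (Fintype.card V) with h | h
  · obtain ⟨u, hu, v, hv, huv⟩ := key C ⟨x, hxC⟩ h
    exact hv (hclosed u v hu huv)
  · obtain ⟨u, hu, v, hv, huv⟩ := key Cᶜ ⟨y, hyC⟩ (by rw [Finset.card_compl]; omega)
    rw [Finset.mem_compl] at hu hv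
    push Not at hv
    exact hu (hclosed v u hv huv.symm)

lemma card_nbr_fromEdgeSet {F : Finset (Sym2 V)} (hF : ∀ e ∈ F, ¬ e.IsDiag) (v : V) :
    (nbr (SimpleGraph.fromEdgeSet (F : Set (Sym2 V))) v).card = (F.filter (v ∈ ·)).card := by
  refine Finset.card_bij (fun w _ => s(v, w)) ?_ ?_ ?_
  · intro w hw
    exact Finset.mem_filter.2 ⟨(fromEdgeSet_adj_of_mem hF).1 (mem_nbr.1 hw), by simp⟩
  · intro a _ b _ h
    exact Sym2.congr_right.1 h
  · intro e he
    obtain ⟨h1, h2⟩ := Finset.mem_filter.1 he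
    obtain ⟨w, rfl⟩ := Sym2.mem_iff_exists.1 h2
    exact ⟨w, mem_nbr.2 ((fromEdgeSet_adj_of_mem hF).2 h1), rfl⟩

lemma two_le_card_filter_of_isHamiltonian {F : Finset (Sym2 V)} (hF : ∀ e ∈ F, ¬ e.IsDiag)
    (h2 : 2 ≤ Fintype.card V)
    (hH : (SimpleGraph.fromEdgeSet (F : Set (Sym2 V))).IsHamiltonian) (v : V) :
    2 ≤ (F.filter (v ∈ ·)).card := by
  have : Nontrivial V := Fintype.one_lt_card_iff_nontrivial.1 h2
  obtain ⟨p, hp⟩ := hH.exists_isHamiltonianCycle v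
  rw [← card_nbr_fromEdgeSet hF]
  calc 2 = ({p.snd, p.penultimate} : Finset V).card := by
        rw [Finset.card_pair hp.isCycle.snd_ne_penultimate]
    _ ≤ _ := by
        refine Finset.card_le_card fun w hw => mem_nbr.2 ?_
        rcases Finset.mem_insert.1 hw with rfl | hw
        · exact p.adj_snd hp.isCycle.not_nil
        · rw [Finset.mem_singleton] at hw
          subst hw
          exact (p.adj_penultimate hp.isCycle.not_nil).symm

end Expansion

/-! ### Pairs of independent Bernoulli subsets -/

section BernoulliPair

variable {ι : Type*} [DecidableEq ι]

/-- The probability of `Q S T`, where `S` and `T` are independent Bernoulli subsets of `E`. -/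
noncomputable def bprob₂ (E : Finset ι) (p q : ℝ) (Q : Finset ι → Finset ι → Prop) : ℝ :=
  bexp E p fun S => bprob E q (Q S)

lemma bprob₂_mono {E : Finset ι} {p q : ℝ} (hp0 : 0 ≤ p) (hp1 : p ≤ 1) (hq0 : 0 ≤ q) (hq1 : q ≤ 1)
    {Q Q' : Finset ι → Finset ι → Prop} (h : ∀ S ⊆ E, ∀ T ⊆ E, Q S T → Q' S T) :
    bprob₂ E p q Q ≤ bprob₂ E p q Q' :=
  bexp_mono hp0 hp1 fun S hS => bprob_mono hq0 hq1 (h S hS)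

lemma bprob_eq_zero {E : Finset ι} {q : ℝ} {Q : Finset ι → Prop} (h : ∀ T ⊆ E, ¬ Q T) :
    bprob E q Q = 0 :=
  (bexp_congr fun T hT => by simp [h T hT]).trans (bexp_const E q 0)

lemma bprob₂_eq_zero {E : Finset ι} {p q : ℝ} {Q : Finset ι → Finset ι → Prop}
    (h : ∀ S ⊆ E, ∀ T ⊆ E, ¬ Q S T) : bprob₂ E p q Q = 0 :=
  (bexp_congr fun S hS => bprob_eq_zero (h S hS)).trans (bexp_const E p 0)

lemma bprob₂_or_le {E : Finset ι} {p q : ℝ} (hp0 : 0 ≤ p) (hp1 : p ≤ 1) (hq0 : 0 ≤ q)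
    (hq1 : q ≤ 1) (Q Q' : Finset ι → Finset ι → Prop) :
    bprob₂ E p q (fun S T => Q S T ∨ Q' S T) ≤ bprob₂ E p q Q + bprob₂ E p q Q' := by
  rw [bprob₂, bprob₂, bprob₂, ← bexp_add]
  exact bexp_mono hp0 hp1 fun S _ => bprob_or_le hq0 hq1 _ _

lemma bprob₂_exists_le {κ : Type*} {E : Finset ι} {p q : ℝ} (hp0 : 0 ≤ p) (hp1 : p ≤ 1)
    (hq0 : 0 ≤ q) (hq1 : q ≤ 1) (s : Finset κ) (Q : κ → Finset ι → Finset ι → Prop) :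
    bprob₂ E p q (fun S T => ∃ k ∈ s, Q k S T) ≤ ∑ k ∈ s, bprob₂ E p q (Q k) := by
  simp only [bprob₂]
  rw [← bexp_sum]
  exact bexp_mono hp0 hp1 fun S _ => bprob_exists_le hq0 hq1 s fun k => Q k S

/-- Elements are independent: each element of `F` is covered with probability `p + q - p * q`, and
each element of `W` misses `S` with probability `1 - p`, whatever `T` does there. -/
lemma bprob₂_subset_disjoint_left {E F W : Finset ι} (hF : F ⊆ E) (hW : W ⊆ E)
    (hFW : Disjoint F W) {p q : ℝ} :
    bprob₂ E p q (fun S T => F ⊆ S ∪ T ∧ Disjoint W S) =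
      (p + q - p * q) ^ F.card * (1 - p) ^ W.card := by
  classical
  have h := bexp_bexp_prod_ite (Finset.union_subset hF hW) p q (fun e => if e ∈ F then 1 else 0)
    (fun e => if e ∈ F then 1 else 0) (fun _ => 1) (fun e => if e ∈ F then 0 else 1)
  rw [Finset.prod_union hFW, Finset.prod_congr rfl (g := fun _ => p + q - p * q),
    Finset.prod_const, Finset.prod_congr rfl (s₁ := W) (g := fun _ => 1 - p), Finset.prod_const] at h
  · rw [← h]
    refine bexp_congr fun S _ => bexp_congr fun T _ => ?_
    split_ifs with hc
    · symm
      refine Finset.prod_eq_one fun e he => ?_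
      rcases Finset.mem_union.1 he with he | he
      · have := hc.1 he
        by_cases h1 : e ∈ S
        · simp [h1, he]
        · have : e ∈ T := by simpa [h1] using this
          simp [h1, this]
      · have h1 : e ∉ F := fun h' => Finset.disjoint_left.1 hFW h' he
        have h2 : e ∉ S := Finset.disjoint_left.1 hc.2 he
        simp [h1, h2]
    · symm
      rw [not_and_or] at hc
      rcases hc with hc | hc
      · obtain ⟨e, he, hne⟩ := Finset.not_subset.1 hc
        rw [Finset.mem_union, not_or] at hne
        refine Finset.prod_eq_zero (Finset.mem_union_left _ he) ?_
        simp [hne.1, hne.2, he]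
      · obtain ⟨e, he, heS⟩ := Finset.not_disjoint_iff.1 hc
        refine Finset.prod_eq_zero (Finset.mem_union_right _ he) ?_
        have h1 : e ∉ F := fun h' => Finset.disjoint_left.1 hFW h' he
        simp [heS, h1]
  · intro e he
    have h1 : e ∉ F := fun h' => Finset.disjoint_left.1 hFW h' he
    simp only [h1, if_false]; ring
  · intro e he
    simp only [he, if_true]; ring

lemma bprob_subset_disjoint {E F W : Finset ι} (hF : F ⊆ E) (hW : W ⊆ E) (hFW : Disjoint F W)
    {p : ℝ} : bprob E p (fun S => F ⊆ S ∧ Disjoint W S) = p ^ F.card * (1 - p) ^ W.card := by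
  classical
  have h := bexp_union_mul hFW p (fun S => if F ⊆ S then 1 else 0)
    (fun S => if Disjoint W S then 1 else 0)
  have h1 := bprob_subset (Finset.Subset.refl F) p
  have h2 := bprob_disjoint (Finset.Subset.refl W) p
  rw [bprob] at h1 h2
  rw [← h1, ← h2]
  refine Eq.trans ?_ (h.trans ?_)
  · rw [bprob, ← bexp_inter (Finset.union_subset hF hW)]
    refine bexp_congr fun S _ => ?_
    have e1 : F ⊆ S ∩ (F ∪ W) ∩ F ↔ F ⊆ S := by
      simp only [Finset.subset_inter_iff, Finset.Subset.refl, and_true, Finset.subset_union_left]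
    have e2 : Disjoint W (S ∩ (F ∪ W) ∩ W) ↔ Disjoint W S := by
      simp only [Finset.disjoint_left, Finset.mem_inter, Finset.mem_union]
      exact forall_congr' fun a => by tauto
    simp only [e1, e2]
    by_cases hF' : F ⊆ S <;> by_cases hW' : Disjoint W S <;> simp [hF', hW']
  · congr!

/-- The set to be avoided may depend on `S`. Given `S`, the set `T` has to contain `F \ S` and avoid
`W S \ F`, which are disjoint; averaging `q ^ |F \ S|` over `S` yields the first factor. -/
lemma bprob₂_subset_and_le {E F : Finset ι} (hF : F ⊆ E) {p q : ℝ} (hp0 : 0 ≤ p) (hp1 : p ≤ 1)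
    (hq0 : 0 ≤ q) (hq1 : q ≤ 1) (W : Finset ι → Finset ι) (hW : ∀ S ⊆ E, W S ⊆ E)
    (g : Finset ι → Prop) {k : ℕ} (hk : ∀ S ⊆ E, g S → k ≤ (W S \ F).card) :
    bprob₂ E p q (fun S T => F ⊆ S ∪ T ∧ g S ∧ Disjoint (W S) T) ≤
      (p + q - p * q) ^ F.card * (1 - q) ^ k := by
  classical
  have h1 : bexp E p (fun S => ∏ e ∈ F, if e ∈ S then 1 else q) = (p + q - p * q) ^ F.card := by
    rw [bexp_prod_ite hF, Finset.prod_const]; congr 1; ring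
  rw [← h1, ← bexp_mul_const]
  refine bexp_mono hp0 hp1 fun S hS => ?_
  have hprod : (∏ e ∈ F, if e ∈ S then 1 else q) = q ^ (F \ S).card := by
    rw [Finset.prod_ite, Finset.prod_const_one, one_mul, Finset.prod_const,
      Finset.filter_notMem_eq_sdiff]
  rw [hprod]
  by_cases hg : g S
  · calc _ ≤ bprob E q (fun T => F \ S ⊆ T ∧ Disjoint (W S \ F) T) := by
          refine bprob_mono hq0 hq1 fun T _ h => ⟨fun e he => ?_, ?_⟩
          · have := h.1 (Finset.mem_sdiff.1 he).1
            exact (Finset.mem_union.1 this).resolve_left (Finset.mem_sdiff.1 he).2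
          · exact Finset.disjoint_of_subset_left Finset.sdiff_subset h.2.2
      _ = q ^ (F \ S).card * (1 - q) ^ (W S \ F).card :=
          bprob_subset_disjoint (Finset.sdiff_subset.trans hF) (Finset.sdiff_subset.trans (hW S hS))
            (Finset.disjoint_of_subset_left Finset.sdiff_subset Finset.disjoint_sdiff)
      _ ≤ _ := mul_le_mul_of_nonneg_left
          (pow_le_pow_of_le_one (by linarith) (by linarith) (hk S hS hg)) (by positivity)
  · have : bprob E q (fun T => F ⊆ S ∪ T ∧ g S ∧ Disjoint (W S) T) = 0 :=
      bprob_eq_zero fun T _ => by simp [hg]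
    rw [this]
    have : 0 ≤ 1 - q := by linarith
    positivity

end BernoulliPair

/-! ### Boosters -/

section Booster

variable {V : Type*} [Fintype V] [DecidableEq V]

open Classical in
/-- The first vertices of longest paths. -/
noncomputable def longestStarts (G : SimpleGraph V) : Finset V :=
  Finset.univ.filter fun x => ∃ l, IsLongestPath G l ∧ l.head? = some x

open Classical in
/-- The cyclic shift along a chosen longest path from `x` to `y`. -/
noncomputable def shiftPerm (G : SimpleGraph V) (x y : V) : Equiv.Perm V :=
  if h : ∃ l, IsLongestPath G l ∧ l.head? = some x ∧ l.getLast? = some y then h.choose.formPerm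
  else 1

/-- No pair of edges from `A` and `B` extends a longest path of `G` via the chosen shift. -/
def NoBooster (G : SimpleGraph V) (A B : Finset (Sym2 V)) : Prop :=
  ∀ x ∈ longestStarts G, ∀ y ∈ longestEnds G x, ∀ w, s(y, w) ∈ A →
    s(x, shiftPerm G x y w) ∉ B

/-- Reversing a longest path turns its end into a start, so the many ends belonging to one start are
themselves starts. -/
lemma lt_card_longestStarts [Nonempty V] {G : SimpleGraph V} {m : ℕ}
    (hG : ∀ S : Finset V, S.card ≤ m → 2 * S.card ≤ (extNbr G S).card) :
    m < (longestStarts G).card := by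
  classical
  obtain ⟨l, hl, hne⟩ := exists_isLongestPath G
  refine (lt_card_longestEnds hG hl (List.head?_eq_some_head hne)).trans_le
    (Finset.card_le_card fun y hy => ?_)
  obtain ⟨-, l', hl', -, hy'⟩ := Finset.mem_filter.1 hy
  refine Finset.mem_filter.2 ⟨Finset.mem_univ _, l'.reverse, ⟨hl'.isPathList.reverse, ?_⟩, ?_⟩
  · simpa using hl'.length_le
  · simpa using hy'

/-- The number of vertices on a longest path. -/
noncomputable def pathNumber [Nonempty V] (G : SimpleGraph V) : ℕ :=
  (exists_isLongestPath G).choose.length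

lemma IsPathList.length_le_pathNumber [Nonempty V] {G : SimpleGraph V} {l : List V}
    (hl : IsPathList G l) : l.length ≤ pathNumber G :=
  (exists_isLongestPath G).choose_spec.1.length_le l hl

lemma pathNumber_le_card [Nonempty V] (G : SimpleGraph V) : pathNumber G ≤ Fintype.card V :=
  (exists_isLongestPath G).choose_spec.1.isPathList.nodup.length_le_card

lemma IsLongestPath.length_eq [Nonempty V] {G : SimpleGraph V} {l : List V}
    (hl : IsLongestPath G l) : l.length = pathNumber G :=
  le_antisymm hl.isPathList.length_le_pathNumber
    (hl.length_le _ (exists_isLongestPath G).choose_spec.1.isPathList)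

/-- If `R ∪ A ∪ B` is not Hamiltonian then some sparse extension of `R ∪ F₀` has no booster. -/
lemma exists_noBooster [Nonempty V] (h3 : 3 ≤ Fintype.card V) {R A B F₀ : Finset (Sym2 V)}
    (hF₀ : F₀ ⊆ A ∪ B)
    (hd : ∀ e ∈ A ∪ B, ¬ e.IsDiag)
    (hcon : (SimpleGraph.fromEdgeSet ((R ∪ F₀ : Finset (Sym2 V)) : Set (Sym2 V))).Connected)
    (hnot : ¬ (SimpleGraph.fromEdgeSet ((R ∪ (A ∪ B) : Finset (Sym2 V)) : Set (Sym2 V))).IsHamiltonian) :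
    ∃ F, F₀ ⊆ F ∧ F ⊆ A ∪ B ∧ F.card ≤ F₀.card + 2 * Fintype.card V ∧
      NoBooster (SimpleGraph.fromEdgeSet ((R ∪ F : Finset (Sym2 V)) : Set (Sym2 V))) A B := by
  classical
  set gr : Finset (Sym2 V) → SimpleGraph V := fun F =>
    SimpleGraph.fromEdgeSet ((R ∪ F : Finset (Sym2 V)) : Set (Sym2 V)) with hgr
  have hmono : ∀ {F F'}, F ⊆ F' → gr F ≤ gr F' := fun {F F'} h =>
    SimpleGraph.fromEdgeSet_mono (by exact_mod_cast Finset.union_subset_union_right h)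
  -- Extremal choice: a booster costs two edges and raises the path number by at least one, so the
  -- edge budget `|F₀| + 2 * pathNumber` survives it, and a maximizer in this family has no booster.
  set 𝓕 := (A ∪ B).powerset.filter fun F =>
    F₀ ⊆ F ∧ F.card ≤ F₀.card + 2 * pathNumber (gr F) with h𝓕
  obtain ⟨F, hF, hmax⟩ := Finset.exists_max_image 𝓕 (fun F => pathNumber (gr F))
    ⟨F₀, Finset.mem_filter.2 ⟨Finset.mem_powerset.2 hF₀, Finset.Subset.refl _, by omega⟩⟩
  obtain ⟨hFs, hF0, hFc⟩ := Finset.mem_filter.1 hF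
  rw [Finset.mem_powerset] at hFs
  have hpn := pathNumber_le_card (gr F)
  refine ⟨F, hF0, hFs, by omega, ?_⟩
  intro x _ y hy w hA hB
  have hex : ∃ l, IsLongestPath (gr F) l ∧ l.head? = some x ∧ l.getLast? = some y :=
    (Finset.mem_filter.1 hy).2
  obtain ⟨hl, hx, hy'⟩ := hex.choose_spec
  have hσ : shiftPerm (gr F) x y = hex.choose.formPerm := by rw [shiftPerm, dif_pos hex]
  set F' := insert s(y, w) (insert s(x, shiftPerm (gr F) x y w) F) with hF'
  have hFF' : F ⊆ F' := (Finset.subset_insert _ _).trans (Finset.subset_insert _ _)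
  have hF's : F' ⊆ A ∪ B := by
    refine Finset.insert_subset (Finset.mem_union_left _ hA)
      (Finset.insert_subset (Finset.mem_union_right _ hB) hFs)
  have hadj : ∀ {a b}, s(a, b) ∈ F' → (gr F').Adj a b := by
    intro a b hab
    rw [hgr, SimpleGraph.fromEdgeSet_adj]
    refine ⟨by exact_mod_cast Finset.mem_union_right _ hab, ?_⟩
    rintro rfl
    exact hd _ (hF's hab) (by simp)
  have hlong := isHamiltonian_or_exists_longer (hmono hFF') (hcon.mono (hmono hF0)) h3
    hl.isPathList hx hy' (w := w) (hadj (Finset.mem_insert_self _ _))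
    (hadj (by rw [← hσ]; exact Finset.mem_insert_of_mem (Finset.mem_insert_self _ _)))
  rcases hlong with hH | ⟨l', hl', hlt⟩
  · exact hnot (hH.mono (hmono hF's))
  · have h1 := hl'.length_le_pathNumber
    rw [hl.length_eq] at hlt
    have h2 : F'.card ≤ F.card + 2 := by
      refine (Finset.card_insert_le _ _).trans ?_
      have := Finset.card_insert_le s(x, shiftPerm (gr F) x y w) F
      omega
    have h3 := hmax F' (Finset.mem_filter.2 ⟨Finset.mem_powerset.2 hF's, hF0.trans hFF', by omega⟩)
    omega

lemma card_le_two_mul_card_image_mk (P : Finset (V × V)) :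
    P.card ≤ 2 * (P.image fun q => s(q.1, q.2)).card := by
  refine Finset.card_le_mul_card_image P 2 fun e _ => ?_
  induction e with
  | h a b =>
    calc _ ≤ ({(a, b), (b, a)} : Finset (V × V)).card := by
          refine Finset.card_le_card fun q hq => ?_
          obtain ⟨-, h⟩ := Finset.mem_filter.1 hq
          rcases Sym2.eq_iff.1 h with ⟨h1, h2⟩ | ⟨h1, h2⟩ <;> simp [← h1, ← h2]
      _ ≤ 2 := Finset.card_le_two

/-- The factor two is there because an unordered pair can arise from both of its orientations. -/
lemma card_sigma_bounds {X : Finset V} {Y : V → Finset V} {m θ : ℕ} (hX : m ≤ X.card)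
    (hY : ∀ x ∈ X, θ ≤ (Y x).card) :
    m * θ ≤ 2 * ((X.biUnion fun x => (Y x).image fun y => s(x, y))).card := by
  set P : Finset (V × V) := (X ×ˢ Finset.univ).filter fun q => q.2 ∈ Y q.1 with hP
  have h1 : (P.image fun q => s(q.1, q.2)) ⊆ X.biUnion fun x => (Y x).image fun y => s(x, y) := by
    intro e he
    obtain ⟨q, hq, rfl⟩ := Finset.mem_image.1 he
    obtain ⟨hq1, hq2⟩ := Finset.mem_filter.1 hq
    exact Finset.mem_biUnion.2 ⟨q.1, (Finset.mem_product.1 hq1).1, Finset.mem_image.2 ⟨_, hq2, rfl⟩⟩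
  have h2 : m * θ ≤ P.card := by
    rw [hP, Finset.card_filter, Finset.sum_product]
    calc m * θ ≤ X.card * θ := Nat.mul_le_mul_right _ hX
      _ = X.card • θ := by rw [smul_eq_mul]
      _ ≤ ∑ x ∈ X, ∑ y : V, if y ∈ Y x then 1 else 0 := by
          refine Finset.card_nsmul_le_sum _ _ _ fun x hx => ?_
          rw [Finset.sum_ite_mem, Finset.univ_inter, ← Finset.card_eq_sum_ones]
          exact hY x hx
  exact h2.trans ((card_le_two_mul_card_image_mk P).trans
    (Nat.mul_le_mul_left _ (Finset.card_le_card h1)))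

/-- For a fixed extension `F`, boosters are missing with very small probability. -/
lemma bprob₂_noBooster_le (Γ : SimpleGraph V) [DecidableRel Γ.Adj] {a b : ℝ} (ha0 : 0 ≤ a)
    (ha1 : a ≤ 1) (hb0 : 0 ≤ b) (hb1 : b ≤ 1) {m θ k : ℕ}
    (hΓ : ∀ v, Fintype.card V + 2 * θ ≤ 2 * Γ.degree v)
    (H : SimpleGraph V) (hX : m ≤ (longestStarts H).card)
    (hY : ∀ x ∈ longestStarts H, m ≤ (longestEnds H x).card)
    {F : Finset (Sym2 V)} (hF : F ⊆ Γ.edgeFinset) (hk : 2 * (k + F.card) ≤ m * θ) :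
    bprob₂ Γ.edgeFinset a b (fun A B => F ⊆ A ∪ B ∧ NoBooster H A B) ≤
      (a + b - a * b) ^ F.card *
        (Fintype.card V * 2 ^ Fintype.card V * (1 - a) ^ k + (1 - b) ^ k) := by
  classical
  set E := Γ.edgeFinset with hE
  set n := Fintype.card V with hn
  set X := longestStarts H with hXdef
  set N : V → Finset V := fun v => Γ.neighborFinset v with hN
  set σ := shiftPerm H with hσ
  -- vertices reachable from `x` after a rotation with an edge of `A`
  let Z : Finset (Sym2 V) → V → Finset V := fun A x =>
    (N x).filter fun z => ∃ y ∈ longestEnds H x, s(y, (σ x y)⁻¹ z) ∈ A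
  -- `W₁` takes an arbitrary vertex set where `N x \ Z A x` is meant. It then does not depend on
  -- `A`, at the price of a union bound over `n * 2 ^ n` pairs.
  let W₁ : V × Finset V → Finset (Sym2 V) := fun q =>
    (longestEnds H q.1).biUnion fun y =>
      ((N y).filter fun w => σ q.1 y w ∈ q.2).image fun w => s(y, w)
  let W₂ : Finset (Sym2 V) → Finset (Sym2 V) := fun A =>
    X.biUnion fun x => (Z A x).image fun z => s(x, z)
  have hW₁ : ∀ q, W₁ q ⊆ E := by
    intro q e he
    obtain ⟨y, -, he⟩ := Finset.mem_biUnion.1 he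
    obtain ⟨w, hw, rfl⟩ := Finset.mem_image.1 he
    have := (Finset.mem_filter.1 hw).1
    simpa [hE, hN] using this
  have hW₂ : ∀ A, W₂ A ⊆ E := by
    intro A e he
    obtain ⟨x, -, he⟩ := Finset.mem_biUnion.1 he
    obtain ⟨z, hz, rfl⟩ := Finset.mem_image.1 he
    have := (Finset.mem_filter.1 hz).1
    simpa [hE, hN] using this
  have hsplit : bprob₂ E a b (fun A B => F ⊆ A ∪ B ∧ NoBooster H A B) ≤
      bprob₂ E a b (fun A B => (∃ q ∈ ((Finset.univ : Finset V) ×ˢ (Finset.univ : Finset (Finset V))),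
        (F ⊆ A ∪ B ∧ (k ≤ (W₁ q \ F).card ∧ Disjoint (W₁ q \ F) A))) ∨
        (F ⊆ A ∪ B ∧ (∀ x ∈ X, θ ≤ (Z A x).card) ∧ Disjoint (W₂ A) B)) := by
    refine bprob₂_mono ha0 ha1 hb0 hb1 fun A hA B hB ⟨hFAB, hno⟩ => ?_
    -- Either every start `x` has at least `θ` closing vertices `Z A x`, and `B` misses all the
    -- edges from `x` to them; or some `x` has fewer, and `A` misses all the edges that would create
    -- further ones.
    by_cases hgood : ∀ x ∈ X, θ ≤ (Z A x).card
    · refine Or.inr ⟨hFAB, hgood, ?_⟩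
      rw [Finset.disjoint_left]
      intro e he heB
      obtain ⟨x, hx, he⟩ := Finset.mem_biUnion.1 he
      obtain ⟨z, hz, rfl⟩ := Finset.mem_image.1 he
      obtain ⟨hz1, y, hy, hyA⟩ := Finset.mem_filter.1 hz
      refine hno x hx y hy _ hyA ?_
      rw [← hσ]
      simpa using heB
    · left
      push Not at hgood
      obtain ⟨x, hx, hlt⟩ := hgood
      refine ⟨(x, N x \ Z A x), by simp, hFAB, ?_, ?_⟩
      · have h1 : m * θ ≤ 2 * (W₁ (x, N x \ Z A x)).card := by
          refine card_sigma_bounds (hY x hx) fun y hy => ?_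
          have hNy : (N y).card = Γ.degree y := Γ.card_neighborFinset_eq_degree y
          have hNx : (N x).card = Γ.degree x := Γ.card_neighborFinset_eq_degree x
          have hy1 := hΓ y
          have hx1 := hΓ x
          -- Inclusion–exclusion: `N y` and the preimage `M` together have at least `n + 2θ - |Z A
          -- x|` elements, so they share more than `θ` of the `n` vertices. This is where degrees
          -- above `n / 2` enter.
          set M := (N x \ Z A x).map ((σ x y)⁻¹ : Equiv.Perm V).toEmbedding with hM
          have hMc : M.card = (N x \ Z A x).card := Finset.card_map _
          have h2 : (N y).filter (fun w => σ x y w ∈ N x \ Z A x) = N y ∩ M := by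
            ext w
            simp only [Finset.mem_filter, Finset.mem_inter, hM, Finset.mem_map_equiv]
            rfl
          simp only [h2]
          have h3 := Finset.card_union_add_card_inter (N y) M
          have h4 : (N y ∪ M).card ≤ n := Finset.card_le_univ _
          have h5 := Finset.le_card_sdiff (Z A x) (N x)
          omega
        have h2 := Finset.le_card_sdiff F (W₁ (x, N x \ Z A x))
        omega
      · rw [Finset.disjoint_left]
        intro e he heA
        obtain ⟨y, hy, he⟩ := Finset.mem_biUnion.1 (Finset.mem_sdiff.1 he).1
        obtain ⟨w, hw, rfl⟩ := Finset.mem_image.1 he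
        obtain ⟨hw1, hw2⟩ := Finset.mem_filter.1 hw
        obtain ⟨hw3, hw4⟩ := Finset.mem_sdiff.1 hw2
        refine hw4 (Finset.mem_filter.2 ⟨hw3, y, hy, ?_⟩)
        simpa using heA
  have h2 : bprob₂ E a b (fun A B => F ⊆ A ∪ B ∧ (∀ x ∈ X, θ ≤ (Z A x).card) ∧
      Disjoint (W₂ A) B) ≤ (a + b - a * b) ^ F.card * (1 - b) ^ k := by
    refine bprob₂_subset_and_le hF ha0 ha1 hb0 hb1 W₂ (fun A _ => hW₂ A) _ fun A _ hg => ?_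
    have h1 : m * θ ≤ 2 * (W₂ A).card := card_sigma_bounds hX hg
    have h2 := Finset.le_card_sdiff F (W₂ A)
    omega
  have hab : 0 ≤ a + b - a * b := by nlinarith
  have h1 : ∀ q : V × Finset V, bprob₂ E a b (fun A B => F ⊆ A ∪ B ∧
      (k ≤ (W₁ q \ F).card ∧ Disjoint (W₁ q \ F) A)) ≤
      (a + b - a * b) ^ F.card * (1 - a) ^ k := by
    intro q
    have h1a : 0 ≤ 1 - a := by linarith
    by_cases hc : k ≤ (W₁ q \ F).card
    · calc _ ≤ bprob₂ E a b (fun A B => F ⊆ A ∪ B ∧ Disjoint (W₁ q \ F) A) :=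
            bprob₂_mono ha0 ha1 hb0 hb1 fun A _ B _ h => ⟨h.1, h.2.2⟩
        _ = _ := bprob₂_subset_disjoint_left hF (Finset.sdiff_subset.trans (hW₁ q))
            Finset.disjoint_sdiff
        _ ≤ _ := mul_le_mul_of_nonneg_left (pow_le_pow_of_le_one h1a (by linarith) hc)
            (by positivity)
    · have : bprob₂ E a b (fun A B => F ⊆ A ∪ B ∧
          (k ≤ (W₁ q \ F).card ∧ Disjoint (W₁ q \ F) A)) = 0 :=
        bprob₂_eq_zero fun A _ B _ => by simp [hc]
      rw [this]
      positivity
  calc _ ≤ _ := hsplit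
    _ ≤ _ := bprob₂_or_le ha0 ha1 hb0 hb1 _ _
    _ ≤ ∑ q ∈ ((Finset.univ : Finset V) ×ˢ (Finset.univ : Finset (Finset V))),
        (a + b - a * b) ^ F.card * (1 - a) ^ k + (a + b - a * b) ^ F.card * (1 - b) ^ k :=
        add_le_add ((bprob₂_exists_le ha0 ha1 hb0 hb1 _ _).trans
          (Finset.sum_le_sum fun q _ => h1 q)) h2
    _ = _ := by
        rw [Finset.sum_const, Finset.card_product, Finset.card_univ, Finset.card_univ,
          Fintype.card_finset, nsmul_eq_mul]
        push_cast
        ring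

/-- Sparse extensions of `R` whose longest paths have many ends admit a booster. -/
lemma bprob₂_exists_noBooster_le (Γ : SimpleGraph V) [DecidableRel Γ.Adj] {a b : ℝ} (ha0 : 0 ≤ a)
    (ha1 : a ≤ 1) (hb0 : 0 ≤ b) (hb1 : b ≤ 1) {m θ k K : ℕ}
    (hΓ : ∀ v, Fintype.card V + 2 * θ ≤ 2 * Γ.degree v) (R : Finset (Sym2 V))
    (hk : 2 * (k + K) ≤ m * θ) {lam : ℝ} (hlam0 : 0 < lam) (hlam1 : lam ≤ 1) :
    bprob₂ Γ.edgeFinset a b (fun A B => ∃ F ∈ Γ.edgeFinset.powerset, F ⊆ A ∪ B ∧ F.card ≤ K ∧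
      m ≤ (longestStarts (SimpleGraph.fromEdgeSet ((R ∪ F : Finset (Sym2 V)) : Set (Sym2 V)))).card ∧
      (∀ x ∈ longestStarts (SimpleGraph.fromEdgeSet ((R ∪ F : Finset (Sym2 V)) : Set (Sym2 V))),
        m ≤ (longestEnds (SimpleGraph.fromEdgeSet ((R ∪ F : Finset (Sym2 V)) : Set (Sym2 V))) x).card) ∧
      NoBooster (SimpleGraph.fromEdgeSet ((R ∪ F : Finset (Sym2 V)) : Set (Sym2 V))) A B) ≤
    lam⁻¹ ^ K * (1 + lam * (a + b - a * b)) ^ Γ.edgeFinset.card *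
        (Fintype.card V * 2 ^ Fintype.card V * (1 - a) ^ k + (1 - b) ^ k) := by
  classical
  have hab : 0 ≤ a + b - a * b := by nlinarith
  have h1a : 0 ≤ 1 - a := by linarith
  have h1b : 0 ≤ 1 - b := by linarith
  set ψ : ℝ := Fintype.card V * 2 ^ Fintype.card V * (1 - a) ^ k + (1 - b) ^ k with hψ
  have hψ0 : 0 ≤ ψ := by positivity
  refine (bprob₂_exists_le ha0 ha1 hb0 hb1 _ _).trans ?_
  -- The weight `lam⁻¹ ^ K * lam ^ |F| ≥ 1` enforces `|F| ≤ K` and turns the sum over extensions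
  -- into a binomial expansion.
  have hsum : ∑ F ∈ Γ.edgeFinset.powerset, (lam * (a + b - a * b)) ^ F.card =
      (1 + lam * (a + b - a * b)) ^ Γ.edgeFinset.card := by
    have := Finset.prod_add (fun _ => lam * (a + b - a * b)) (fun _ => (1 : ℝ)) Γ.edgeFinset
    simp only [Finset.prod_const, mul_one, one_pow] at this
    rw [← this, add_comm]
  rw [← hsum, Finset.mul_sum, Finset.sum_mul]
  refine Finset.sum_le_sum fun F hF => ?_
  have hrhs : 0 ≤ lam⁻¹ ^ K * (lam * (a + b - a * b)) ^ F.card * ψ := by positivity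
  set H := SimpleGraph.fromEdgeSet ((R ∪ F : Finset (Sym2 V)) : Set (Sym2 V)) with hH
  by_cases hc : F.card ≤ K ∧ m ≤ (longestStarts H).card ∧
      ∀ x ∈ longestStarts H, m ≤ (longestEnds H x).card
  · calc _ ≤ bprob₂ Γ.edgeFinset a b (fun A B => F ⊆ A ∪ B ∧ NoBooster H A B) :=
          bprob₂_mono ha0 ha1 hb0 hb1 fun A _ B _ h => ⟨h.1, h.2.2.2.2⟩
      _ ≤ (a + b - a * b) ^ F.card * ψ :=
          bprob₂_noBooster_le Γ ha0 ha1 hb0 hb1 hΓ H hc.2.1 hc.2.2 (Finset.mem_powerset.1 hF)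
            (by have := hc.1; omega)
      _ ≤ _ := by
          refine mul_le_mul_of_nonneg_right ?_ hψ0
          rw [mul_pow, ← mul_assoc]
          refine le_mul_of_one_le_left (by positivity) ?_
          have h1 : 1 ≤ lam⁻¹ := (one_le_inv₀ hlam0).2 hlam1
          calc (1 : ℝ) = lam⁻¹ ^ F.card * lam ^ F.card := by
                rw [← mul_pow, inv_mul_cancel₀ hlam0.ne', one_pow]
            _ ≤ _ := mul_le_mul_of_nonneg_right (pow_le_pow_right₀ h1 hc.1) (by positivity)
  · refine le_trans (le_of_eq (bprob₂_eq_zero fun A _ B _ => ?_)) hrhs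
    rintro ⟨-, h1, h2, h3, -⟩
    exact hc ⟨h1, h2, h3⟩

end Booster

/-! ### Exponential moment bounds -/

section Moments

variable {ι : Type*} [DecidableEq ι]

lemma bprob₂_fst {E : Finset ι} {p q : ℝ} (g : Finset ι → Prop) :
    bprob₂ E p q (fun S _ => g S) = bprob E p g := by
  refine bexp_congr fun S _ => ?_
  by_cases h : g S
  · simp only [bprob, h, if_true, bexp_const]
  · simp only [bprob, h, if_false, bexp_const]

/-- Exponential Markov inequality: the condition on `Y` is dominated by `lam⁻¹ ^ D * lam ^ |S ∩ Y|`,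
whose expectation factors over the elements and so tolerates the extra event on the disjoint set
`Q`. -/
lemma bprob₂_subset_card_le {E Q Y : Finset ι} (hQ : Q ⊆ E) (hY : Y ⊆ E) (hQY : Disjoint Q Y)
    {p q lam : ℝ} (hp0 : 0 ≤ p) (hp1 : p ≤ 1) (hq0 : 0 ≤ q) (hq1 : q ≤ 1) (hl0 : 0 < lam)
    (hl1 : lam ≤ 1) (D : ℕ) :
    bprob₂ E p q (fun S T => Q ⊆ S ∪ T ∧ (S ∩ Y).card ≤ D) ≤
      (p + q - p * q) ^ Q.card * (lam⁻¹ ^ D * (1 - p + p * lam) ^ Y.card) := by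
  classical
  have h := bexp_bexp_prod_ite (Finset.union_subset hQ hY) p q (fun e => if e ∈ Q then 1 else lam)
    (fun e => if e ∈ Q then 1 else lam) (fun _ => 1) (fun e => if e ∈ Q then 0 else 1)
  rw [Finset.prod_union hQY, Finset.prod_congr rfl (g := fun _ => p + q - p * q),
    Finset.prod_const, Finset.prod_congr rfl (s₁ := Y) (g := fun _ => 1 - p + p * lam),
    Finset.prod_const] at h
  · rw [show (p + q - p * q) ^ Q.card * (lam⁻¹ ^ D * (1 - p + p * lam) ^ Y.card) =
      lam⁻¹ ^ D * ((p + q - p * q) ^ Q.card * (1 - p + p * lam) ^ Y.card) by ring, ← h,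
      ← bexp_const_mul]
    refine bexp_mono hp0 hp1 fun S _ => ?_
    rw [← bexp_const_mul]
    refine bprob_le_bexp hq0 hq1 (fun T _ => ?_) fun T _ hST => ?_
    · refine mul_nonneg (by positivity) (Finset.prod_nonneg fun e _ => ?_)
      split_ifs <;> first | exact hl0.le | norm_num
    · rw [Finset.prod_union hQY]
      have h1 : ∏ e ∈ Q, (if e ∈ S then if e ∈ T then if e ∈ Q then 1 else lam else
          if e ∈ Q then 1 else lam else if e ∈ T then 1 else if e ∈ Q then 0 else 1) = 1 := by
        refine Finset.prod_eq_one fun e he => ?_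
        by_cases h1 : e ∈ S
        · simp [h1, he]
        · have : e ∈ T := by simpa [h1] using hST.1 he
          simp [h1, this]
      have h2 : ∏ e ∈ Y, (if e ∈ S then if e ∈ T then if e ∈ Q then 1 else lam else
          if e ∈ Q then 1 else lam else if e ∈ T then 1 else if e ∈ Q then 0 else 1) =
          lam ^ (S ∩ Y).card := by
        rw [Finset.inter_comm, ← Finset.filter_mem_eq_inter, ← Finset.prod_const,
          Finset.prod_filter]
        refine Finset.prod_congr rfl fun e he => ?_
        have h1 : e ∉ Q := fun h' => Finset.disjoint_left.1 hQY h' he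
        simp [h1]
      rw [h1, h2, one_mul]
      calc (1 : ℝ) = lam⁻¹ ^ D * lam ^ D := by
            rw [← mul_pow, inv_mul_cancel₀ hl0.ne', one_pow]
        _ ≤ _ := mul_le_mul_of_nonneg_left (pow_le_pow_of_le_one hl0.le hl1 hST.2) (by positivity)
  · intro e he
    have h1 : e ∉ Q := fun h' => Finset.disjoint_left.1 hQY h' he
    simp only [h1, if_false]; ring
  · intro e he
    simp only [he, if_true]; ring

/-- Chernoff bound: Markov's inequality for `lam ^ |S ∩ Y|` with `lam ≤ 1`. The upper tail below
uses a base at least one instead. -/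
lemma bprob_card_inter_le {E Y : Finset ι} (hY : Y ⊆ E) {p lam : ℝ} (hp0 : 0 ≤ p) (hp1 : p ≤ 1)
    (hl0 : 0 < lam) (hl1 : lam ≤ 1) (D : ℕ) :
    bprob E p (fun S => (S ∩ Y).card ≤ D) ≤ lam⁻¹ ^ D * (1 - p + p * lam) ^ Y.card := by
  rw [← bexp_pow_card_inter hY, ← bexp_const_mul]
  refine bprob_le_bexp hp0 hp1 (fun S _ => by positivity) fun S _ hS => ?_
  calc (1 : ℝ) = lam⁻¹ ^ D * lam ^ D := by rw [← mul_pow, inv_mul_cancel₀ hl0.ne', one_pow]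
    _ ≤ _ := mul_le_mul_of_nonneg_left (pow_le_pow_of_le_one hl0.le hl1 hS) (by positivity)

lemma bprob_le_card_inter {E Y : Finset ι} (hY : Y ⊆ E) {p x : ℝ} (hp0 : 0 ≤ p) (hp1 : p ≤ 1)
    (hx : 1 ≤ x) (D : ℕ) :
    bprob E p (fun S => D ≤ (S ∩ Y).card) ≤ x⁻¹ ^ D * (1 - p + p * x) ^ Y.card := by
  have hx0 : 0 < x := by linarith
  rw [← bexp_pow_card_inter hY, ← bexp_const_mul]
  refine bprob_le_bexp hp0 hp1 (fun S _ => by positivity) fun S _ hS => ?_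
  calc (1 : ℝ) = x⁻¹ ^ D * x ^ D := by rw [← mul_pow, inv_mul_cancel₀ hx0.ne', one_pow]
    _ ≤ _ := mul_le_mul_of_nonneg_left (pow_le_pow_right₀ hx hS) (by positivity)

lemma sum_pow_card_powerset (U : Finset ι) (x : ℝ) :
    ∑ S ∈ U.powerset, x ^ S.card = (1 + x) ^ U.card := by
  have := Finset.prod_add (fun _ => x) (fun _ => (1 : ℝ)) U
  simp only [Finset.prod_const, mul_one, one_pow] at this
  rw [← this, add_comm]

end Moments

/-! ### Typical properties of random subgraphs of dense graphs -/

section Typical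

variable {V : Type*} [Fintype V] [DecidableEq V]

/-- The vertex `v` meets fewer than `28` edges of `R`. -/
def IsSmall (R : Finset (Sym2 V)) (v : V) : Prop := (R.filter (v ∈ ·)).card < 28

variable (Γ : SimpleGraph V) [DecidableRel Γ.Adj]

lemma card_edgeFinset_filter_mem (v : V) : (Γ.edgeFinset.filter (v ∈ ·)).card = Γ.degree v := by
  rw [← Γ.card_incidenceFinset_eq_degree, Γ.incidenceFinset_eq_filter]

/-- Two stars share at most the edge joining their centres. -/
lemma card_filter_mem_union {δ : ℕ} (hδ : ∀ v, δ ≤ Γ.degree v) {u v : V} (huv : u ≠ v) :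
    2 * δ - 1 ≤ ((Γ.edgeFinset.filter (u ∈ ·)) ∪ (Γ.edgeFinset.filter (v ∈ ·))).card := by
  have h1 := Finset.card_union_add_card_inter (Γ.edgeFinset.filter (u ∈ ·))
    (Γ.edgeFinset.filter (v ∈ ·))
  have h2 : ((Γ.edgeFinset.filter (u ∈ ·)) ∩ (Γ.edgeFinset.filter (v ∈ ·))).card ≤ 1 := by
    refine (Finset.card_le_card (t := {s(u, v)}) fun e he => ?_).trans (by simp)
    obtain ⟨hu, hv⟩ := Finset.mem_inter.1 he
    rw [Finset.mem_singleton]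
    exact (Sym2.mem_and_mem_iff huv).1 ⟨(Finset.mem_filter.1 hu).2, (Finset.mem_filter.1 hv).2⟩
  rw [card_edgeFinset_filter_mem, card_edgeFinset_filter_mem] at h1
  have := hδ u
  have := hδ v
  omega

variable {Γ} {p q lam : ℝ} {δ : ℕ}

lemma bprob_isSmall_le (hp0 : 0 ≤ p) (hp1 : p ≤ 1) (hl0 : 0 < lam) (hl1 : lam ≤ 1)
    (hδ : ∀ v, δ ≤ Γ.degree v) (v : V) :
    bprob Γ.edgeFinset p (fun R => IsSmall R v) ≤ lam⁻¹ ^ 28 * (1 - p + p * lam) ^ δ := by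
  have hY : Γ.edgeFinset.filter (v ∈ ·) ⊆ Γ.edgeFinset := Finset.filter_subset _ _
  calc _ ≤ bprob Γ.edgeFinset p (fun R => (R ∩ Γ.edgeFinset.filter (v ∈ ·)).card ≤ 28) := by
        refine bprob_mono hp0 hp1 fun R hR h => le_trans (Finset.card_le_card ?_) (le_of_lt h)
        intro e he
        obtain ⟨h1, h2⟩ := Finset.mem_inter.1 he
        exact Finset.mem_filter.2 ⟨h1, (Finset.mem_filter.1 h2).2⟩
    _ ≤ _ := bprob_card_inter_le hY hp0 hp1 hl0 hl1 28
    _ ≤ _ := by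
        have h1 : 0 ≤ 1 - p + p * lam := by nlinarith
        refine mul_le_mul_of_nonneg_left (pow_le_pow_of_le_one h1 (by nlinarith) ?_)
          (by positivity)
        rw [card_edgeFinset_filter_mem]; exact hδ v

/-- Two small vertices are joined by a given set of edges with small probability. -/
lemma bprob₂_subset_isSmall_le (hp0 : 0 ≤ p) (hp1 : p ≤ 1) (hq0 : 0 ≤ q) (hq1 : q ≤ 1)
    (hl0 : 0 < lam) (hl1 : lam ≤ 1) (hδ : ∀ v, δ ≤ Γ.degree v) {u v : V} (huv : u ≠ v)
    (Q : Finset (Sym2 V)) :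
    bprob₂ Γ.edgeFinset p q (fun R T => Q ⊆ R ∪ T ∧ IsSmall R u ∧ IsSmall R v) ≤
      (p + q - p * q) ^ Q.card * (lam⁻¹ ^ 56 * (1 - p + p * lam) ^ (2 * δ - 1 - Q.card)) := by
  have h1 : 0 ≤ 1 - p + p * lam := by nlinarith
  have h2 : 0 ≤ p + q - p * q := by nlinarith
  by_cases hQ : Q ⊆ Γ.edgeFinset
  -- Away from `Q`, the edges at `u` and `v` are independent of the event `Q ⊆ R ∪ T`. Two small
  -- vertices meet fewer than `2 * 28 = 56` edges of `R`.
  · set Y := ((Γ.edgeFinset.filter (u ∈ ·)) ∪ (Γ.edgeFinset.filter (v ∈ ·))) \ Q with hY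
    have hYE : Y ⊆ Γ.edgeFinset := Finset.sdiff_subset.trans
      (Finset.union_subset (Finset.filter_subset _ _) (Finset.filter_subset _ _))
    calc _ ≤ bprob₂ Γ.edgeFinset p q (fun R T => Q ⊆ R ∪ T ∧ (R ∩ Y).card ≤ 56) := by
          refine bprob₂_mono hp0 hp1 hq0 hq1 fun R _ T _ h => ⟨h.1, ?_⟩
          have hsub : R ∩ Y ⊆ R.filter (u ∈ ·) ∪ R.filter (v ∈ ·) := by
            intro e he
            obtain ⟨he1, he2⟩ := Finset.mem_inter.1 he
            have := (Finset.mem_sdiff.1 he2).1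
            simp only [Finset.mem_union, Finset.mem_filter] at this ⊢
            tauto
          have h3 := (Finset.card_le_card hsub).trans (Finset.card_union_le _ _)
          have h4 := h.2.1
          have h5 := h.2.2
          unfold IsSmall at h4 h5
          omega
      _ ≤ _ := bprob₂_subset_card_le hQ hYE Finset.disjoint_sdiff hp0 hp1 hq0 hq1 hl0 hl1 56
      _ ≤ _ := by
          refine mul_le_mul_of_nonneg_left (mul_le_mul_of_nonneg_left
            (pow_le_pow_of_le_one h1 (by nlinarith) ?_) (by positivity)) (by positivity)
          have h3 := card_filter_mem_union Γ hδ huv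
          have h4 := Finset.le_card_sdiff Q
            ((Γ.edgeFinset.filter (u ∈ ·)) ∪ (Γ.edgeFinset.filter (v ∈ ·)))
          rw [← hY] at h4
          omega
  · refine le_trans (le_of_eq (bprob₂_eq_zero fun R hR T hT h => hQ ?_)) (by positivity)
    exact h.1.trans (Finset.union_subset hR hT)

/-- The index type is arbitrary so that links of length one to four between small vertices are all
instances of one union bound. -/
lemma bprob₂_exists_subset_isSmall_le {κ : Type*} [Fintype κ] (hp0 : 0 ≤ p) (hp1 : p ≤ 1)
    (hq0 : 0 ≤ q) (hq1 : q ≤ 1) (hl0 : 0 < lam) (hl1 : lam ≤ 1) (hδ : ∀ v, δ ≤ Γ.degree v)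
    (u v : κ → V) (Q : κ → Finset (Sym2 V)) (j : ℕ) :
    bprob₂ Γ.edgeFinset p q (fun R T => ∃ k, (u k ≠ v k ∧ (Q k).card = j) ∧
      Q k ⊆ R ∪ T ∧ IsSmall R (u k) ∧ IsSmall R (v k)) ≤
      Fintype.card κ * ((p + q - p * q) ^ j *
        (lam⁻¹ ^ 56 * (1 - p + p * lam) ^ (2 * δ - 1 - j))) := by
  have h1 : 0 ≤ 1 - p + p * lam := by nlinarith
  have h2 : 0 ≤ p + q - p * q := by nlinarith
  have hle := bprob₂_exists_le (E := Γ.edgeFinset) hp0 hp1 hq0 hq1 (Finset.univ : Finset κ)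
    (fun k R T => (u k ≠ v k ∧ (Q k).card = j) ∧ Q k ⊆ R ∪ T ∧ IsSmall R (u k) ∧ IsSmall R (v k))
  simp only [Finset.mem_univ, true_and] at hle
  refine hle.trans ?_
  rw [← nsmul_eq_mul, ← Finset.card_univ]
  refine Finset.sum_le_card_nsmul _ _ _ fun k _ => ?_
  by_cases hc : u k ≠ v k ∧ (Q k).card = j
  · refine (bprob₂_mono hp0 hp1 hq0 hq1 fun R _ T _ h => h.2).trans ?_
    rw [← hc.2]
    exact bprob₂_subset_isSmall_le hp0 hp1 hq0 hq1 hl0 hl1 hδ hc.1 (Q k)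
  · exact le_trans (le_of_eq (bprob₂_eq_zero fun R _ T _ h => hc h.1)) (by positivity)

/-- Codegrees are at most two. -/
lemma bprob₂_exists_codegree_le (hp0 : 0 ≤ p) (hp1 : p ≤ 1) (hq0 : 0 ≤ q) (hq1 : q ≤ 1) :
    bprob₂ Γ.edgeFinset p q (fun R T => ∃ u v, u ≠ v ∧
      2 < (nbr (SimpleGraph.fromEdgeSet ((R ∪ T : Finset (Sym2 V)) : Set (Sym2 V))) u ∩
        nbr (SimpleGraph.fromEdgeSet ((R ∪ T : Finset (Sym2 V)) : Set (Sym2 V))) v).card) ≤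
      (Fintype.card V : ℝ) ^ 5 * (p + q - p * q) ^ 6 := by
  have h2 : 0 ≤ p + q - p * q := by nlinarith
  -- Three common neighbours of two vertices form a `K_{2,3}`, with five vertices and six edges.
  let Q : V × V × V × V × V → Finset (Sym2 V) := fun k =>
    {s(k.1, k.2.2.1), s(k.1, k.2.2.2.1), s(k.1, k.2.2.2.2),
      s(k.2.1, k.2.2.1), s(k.2.1, k.2.2.2.1), s(k.2.1, k.2.2.2.2)}
  have hle := bprob₂_exists_le (E := Γ.edgeFinset) hp0 hp1 hq0 hq1
    (Finset.univ : Finset (V × V × V × V × V)) (fun k R T => (Q k).card = 6 ∧ Q k ⊆ R ∪ T)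
  simp only [Finset.mem_univ, true_and] at hle
  refine le_trans (bprob₂_mono hp0 hp1 hq0 hq1 fun R _ T _ h => ?_) (hle.trans ?_)
  · obtain ⟨u, v, huv, h⟩ := h
    obtain ⟨a, b, c, ha, hb, hc, hab, hac, hbc⟩ := Finset.two_lt_card_iff.1 h
    simp only [Finset.mem_inter, mem_nbr, SimpleGraph.fromEdgeSet_adj, Finset.mem_coe] at ha hb hc
    obtain ⟨⟨hua, hua'⟩, hva, hva'⟩ := ha
    obtain ⟨⟨hub, hub'⟩, hvb, hvb'⟩ := hb
    obtain ⟨⟨huc, huc'⟩, hvc, hvc'⟩ := hc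
    refine ⟨(u, v, a, b, c), ?_, ?_⟩
    · simp only [Q]
      rw [Finset.card_insert_of_notMem, Finset.card_insert_of_notMem,
        Finset.card_insert_of_notMem, Finset.card_insert_of_notMem,
        Finset.card_insert_of_notMem, Finset.card_singleton] <;>
      simp only [Finset.mem_insert, Finset.mem_singleton, Sym2.eq_iff] <;> grind
    · simp only [Q, Finset.insert_subset_iff, Finset.singleton_subset_iff]
      exact ⟨hua, hub, huc, hva, hvb, hvc⟩
  · have hcard : (Fintype.card (V × V × V × V × V) : ℝ) = (Fintype.card V : ℝ) ^ 5 := by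
      simp only [Fintype.card_prod]; push_cast; ring
    rw [← hcard, ← nsmul_eq_mul, ← Finset.card_univ]
    refine Finset.sum_le_card_nsmul _ _ _ fun k _ => ?_
    by_cases hc : (Q k).card = 6 ∧ Q k ⊆ Γ.edgeFinset
    · have h3 := bprob₂_subset_disjoint_left (p := p) (q := q) hc.2
        (Finset.empty_subset Γ.edgeFinset) (Finset.disjoint_empty_right _)
      simp only [Finset.card_empty, pow_zero, mul_one, hc.1] at h3
      rw [← h3]
      exact bprob₂_mono hp0 hp1 hq0 hq1 fun R _ T _ h => ⟨h.2, by simp⟩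
    · refine le_trans (le_of_eq (bprob₂_eq_zero fun R hR T hT h => hc ⟨h.1, ?_⟩)) (by positivity)
      exact h.2.trans (Finset.union_subset hR hT)

/-- Few edges of the second random set meet vertices that are small for the first one. -/
lemma bprob₂_card_filter_isSmall_le [Nonempty V] (hp0 : 0 ≤ p) (hp1 : p ≤ 1) (hq0 : 0 ≤ q)
    (hq1 : q ≤ 1) (hl0 : 0 < lam) (hl1 : lam ≤ 1) (hδ : ∀ v, δ ≤ Γ.degree v) :
    bprob₂ Γ.edgeFinset p q (fun R T => ∀ F : Finset (Sym2 V),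
      (∀ e, e ∈ F ↔ e ∈ T ∧ ∃ v ∈ e, IsSmall R v) → Fintype.card V < F.card) ≤
      Fintype.card V * q * (lam⁻¹ ^ 28 * (1 - p + p * lam) ^ δ) := by
  classical
  have h1 : 0 ≤ 1 - p + p * lam := by nlinarith
  set n := Fintype.card V with hn
  have hn0 : (0 : ℝ) < n := by exact_mod_cast Fintype.card_pos
  set E := Γ.edgeFinset with hE
  -- Markov's inequality: `n * f R T` counts, with multiplicity at most two, the edges of `T` at
  -- vertices small for `R`.
  set f : Finset (Sym2 V) → Finset (Sym2 V) → ℝ := fun R T => (n : ℝ)⁻¹ *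
    ∑ v : V, (if IsSmall R v then 1 else 0) * ∑ e ∈ E.filter (v ∈ ·), if {e} ⊆ T then 1 else 0
    with hf
  have hbound : ∀ R ⊆ E, bprob E q (fun T => ∀ F : Finset (Sym2 V),
      (∀ e, e ∈ F ↔ e ∈ T ∧ ∃ v ∈ e, IsSmall R v) → n < F.card) ≤ bexp E q (f R) := by
    intro R _
    refine bprob_le_bexp hq0 hq1 (fun T _ => ?_) fun T hT h => ?_
    · refine mul_nonneg (by positivity) (Finset.sum_nonneg fun v _ => mul_nonneg ?_
        (Finset.sum_nonneg fun e _ => ?_)) <;> split_ifs <;> norm_num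
    · have hlt := h (T.filter fun e => ∃ v ∈ e, IsSmall R v) (by simp)
      rw [hf, le_inv_mul_iff₀ hn0, mul_one]
      have hcard : ((T.filter fun e => ∃ v ∈ e, IsSmall R v).card : ℝ) ≤
          ∑ v : V, (if IsSmall R v then 1 else 0) *
            ∑ e ∈ E.filter (v ∈ ·), if {e} ⊆ T then (1 : ℝ) else 0 := by
        have hsub : (T.filter fun e => ∃ v ∈ e, IsSmall R v) ⊆
            ((Finset.univ : Finset V).filter fun v => IsSmall R v).biUnion
              fun v => T.filter (v ∈ ·) := by
          intro e he
          obtain ⟨heT, v, hv, hs⟩ := Finset.mem_filter.1 he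
          exact Finset.mem_biUnion.2 ⟨v, Finset.mem_filter.2 ⟨Finset.mem_univ _, hs⟩,
            Finset.mem_filter.2 ⟨heT, hv⟩⟩
        have h2 := (Finset.card_le_card hsub).trans Finset.card_biUnion_le
        calc _ ≤ ((∑ v ∈ (Finset.univ : Finset V).filter (fun v => IsSmall R v),
              (T.filter (v ∈ ·)).card : ℕ) : ℝ) := by exact_mod_cast h2
          _ = ∑ v : V, (if IsSmall R v then 1 else 0) * ((T.filter (v ∈ ·)).card : ℝ) := by
              push_cast
              rw [Finset.sum_filter]
              exact Finset.sum_congr rfl fun v _ => by split_ifs <;> simp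
          _ = _ := by
              refine Finset.sum_congr rfl fun v _ => ?_
              congr 1
              rw [← Finset.sum_filter, Finset.sum_const, nsmul_eq_mul, mul_one]
              congr 2
              ext e
              simp only [Finset.mem_filter, Finset.singleton_subset_iff]
              exact ⟨fun h => ⟨⟨hT h.1, h.2⟩, h.1⟩, fun h => ⟨h.2, h.1.2⟩⟩
      refine le_trans ?_ hcard
      exact_mod_cast hlt.le
  have hinner : ∀ R, bexp E q (f R) =
      (n : ℝ)⁻¹ * ∑ v : V, (if IsSmall R v then 1 else 0) * (Γ.degree v * q) := by
    intro R
    rw [hf, bexp_const_mul, bexp_sum]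
    congr 1
    refine Finset.sum_congr rfl fun v _ => ?_
    rw [bexp_const_mul, bexp_sum, ← card_edgeFinset_filter_mem, ← nsmul_eq_mul,
      ← Finset.sum_const]
    congr 1
    refine Finset.sum_congr rfl fun e he => ?_
    have := bprob_subset (E := E) (A := {e}) (Finset.singleton_subset_iff.2 (Finset.mem_filter.1 he).1) q
    rw [Finset.card_singleton, pow_one] at this
    rw [← this, bprob]
    congr!
  calc _ ≤ bexp E p (fun R => bexp E q (f R)) := bexp_mono hp0 hp1 hbound
    _ = (n : ℝ)⁻¹ * ∑ v : V, bprob E p (fun R => IsSmall R v) * (Γ.degree v * q) := by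
        simp only [hinner]
        rw [bexp_const_mul, bexp_sum]
        congr 1
        refine Finset.sum_congr rfl fun v _ => ?_
        rw [bexp_mul_const, bprob]
    _ ≤ (n : ℝ)⁻¹ * ∑ v : V, (lam⁻¹ ^ 28 * (1 - p + p * lam) ^ δ) * (n * q) := by
        refine mul_le_mul_of_nonneg_left (Finset.sum_le_sum fun v _ => ?_) (by positivity)
        refine mul_le_mul (bprob_isSmall_le hp0 hp1 hl0 hl1 hδ v)
          (mul_le_mul_of_nonneg_right ?_ hq0) (by positivity) (by positivity)
        exact_mod_cast (Γ.degree_lt_card_verts v).le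
    _ = _ := by
        rw [Finset.sum_const, Finset.card_univ, nsmul_eq_mul, ← hn]
        field_simp

end Typical

section Typical

variable {V : Type*} [Fintype V] [DecidableEq V] {Γ : SimpleGraph V} [DecidableRel Γ.Adj]
  {p q lam : ℝ} {δ : ℕ}

/-- The quotient `t ^ t / t!` is a single term of the series of `exp t`. -/
lemma choose_le_exp_mul_pow {n t : ℕ} (ht : 0 < t) :
    (n.choose t : ℝ) ≤ (Real.exp 1 * n / t) ^ t := by
  have h1 : (n.choose t : ℝ) ≤ (n : ℝ) ^ t / (t.factorial : ℝ) := Nat.choose_le_pow_div t n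
  have h2 := Real.pow_div_factorial_le_exp (t : ℝ) (by positivity) t
  have h3 : (0 : ℝ) < t := by exact_mod_cast ht
  have h4 : (0 : ℝ) < t.factorial := by exact_mod_cast t.factorial_pos
  calc (n.choose t : ℝ) ≤ (n : ℝ) ^ t / (t.factorial : ℝ) := h1
    _ = (n : ℝ) ^ t / (t : ℝ) ^ t * ((t : ℝ) ^ t / (t.factorial : ℝ)) := by field_simp
    _ ≤ (n : ℝ) ^ t / (t : ℝ) ^ t * Real.exp t := mul_le_mul_of_nonneg_left h2 (by positivity)
    _ = _ := by
        rw [div_pow, mul_pow, ← Real.exp_nat_mul, mul_one]; ring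

/-- Small sets of vertices span few edges. -/
lemma bprob_exists_dense_le (hp0 : 0 ≤ p) (hp1 : p ≤ 1) {P r : ℝ} (hpP : p ≤ P) (hP0 : 0 < P)
    {t₀ : ℕ} (hPt : P * t₀ ≤ 1) (hr : Real.exp 2 * Fintype.card V * t₀ * P ^ 2 ≤ r)
    (hr1 : r ≤ 1 / 2) :
    bprob Γ.edgeFinset p (fun R => ∃ T : Finset V, T.Nonempty ∧ T.card ≤ t₀ ∧
      2 * T.card ≤ (R.filter fun e => ∀ v ∈ e, v ∈ T).card) ≤ 2 * r := by
  classical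
  have hr0 : 0 ≤ r := le_trans (by positivity) hr
  set n := Fintype.card V with hn
  set g : ℕ → ℝ := fun t => if 1 ≤ t ∧ t ≤ t₀ then (P * t) ^ (2 * t) * Real.exp t else 0 with hg
  have hone : ∀ T : Finset V, bprob Γ.edgeFinset p (fun R => (T.Nonempty ∧ T.card ≤ t₀) ∧
      2 * T.card ≤ (R.filter fun e => ∀ v ∈ e, v ∈ T).card) ≤ g T.card := by
    intro T
    by_cases hT : T.Nonempty ∧ T.card ≤ t₀
    · have ht1 : 1 ≤ T.card := Finset.card_pos.2 hT.1
      have ht : (0 : ℝ) < T.card := by exact_mod_cast ht1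
      -- Chernoff base `1 / (P t)` for `t = |T|`: at most `t²` pairs contribute a factor `exp t`, so
      -- the tail is `(P t) ^ (2t) * exp t`. Multiplied by the number of sets of size `t`, this is
      -- at most `(e² n t P²) ^ t ≤ r ^ t`.
      have hx : 1 ≤ (P * T.card)⁻¹ := by
        refine (one_le_inv₀ (by positivity)).2 (le_trans ?_ hPt)
        exact mul_le_mul_of_nonneg_left (by exact_mod_cast hT.2) hP0.le
      set Y := Γ.edgeFinset.filter fun e => ∀ v ∈ e, v ∈ T with hY
      have hYc : (Y.card : ℝ) ≤ (T.card : ℝ) ^ 2 := by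
        have h1 : Y ⊆ (T ×ˢ T).image fun q => s(q.1, q.2) := by
          intro e he
          have h2 := (Finset.mem_filter.1 he).2
          induction e with
          | h a b => exact Finset.mem_image.2 ⟨(a, b), by simp [h2], rfl⟩
        have h2 := (Finset.card_le_card h1).trans Finset.card_image_le
        rw [Finset.card_product, ← sq] at h2
        exact_mod_cast h2
      have h1 := bprob_le_card_inter (E := Γ.edgeFinset) (Y := Y) (Finset.filter_subset _ _) hp0
        hp1 hx (2 * T.card)
      have hgT : g T.card = (P * T.card) ^ (2 * T.card) * Real.exp T.card := if_pos ⟨ht1, hT.2⟩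
      rw [hgT]
      calc _ ≤ bprob Γ.edgeFinset p (fun S => 2 * T.card ≤ (S ∩ Y).card) := by
            refine bprob_mono hp0 hp1 fun R hR h => h.2.trans (Finset.card_le_card fun e he => ?_)
            obtain ⟨h3, h4⟩ := Finset.mem_filter.1 he
            exact Finset.mem_inter.2 ⟨h3, Finset.mem_filter.2 ⟨hR h3, h4⟩⟩
        _ ≤ _ := h1
        _ ≤ _ := by
            rw [inv_inv]
            refine mul_le_mul_of_nonneg_left ?_ (by positivity)
            have h2 : 1 - p + p * (P * T.card)⁻¹ ≤ Real.exp (p * (P * T.card)⁻¹) := by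
              have := Real.add_one_le_exp (p * (P * T.card)⁻¹)
              linarith
            calc (1 - p + p * (P * T.card)⁻¹) ^ Y.card
                ≤ Real.exp (p * (P * T.card)⁻¹) ^ Y.card :=
                  pow_le_pow_left₀ (add_nonneg (by linarith) (by positivity)) h2 _
              _ = Real.exp (Y.card * (p * (P * T.card)⁻¹)) := by rw [Real.exp_nat_mul]
              _ ≤ Real.exp T.card := by
                  refine Real.exp_le_exp.2 ?_
                  calc (Y.card : ℝ) * (p * (P * T.card)⁻¹)
                      ≤ (T.card : ℝ) ^ 2 * (P * (P * T.card)⁻¹) := by gcongr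
                    _ = T.card := by field_simp
    · have hz : 0 ≤ g T.card := by rw [hg]; dsimp only; split_ifs <;> positivity
      exact le_trans (le_of_eq (bprob_eq_zero fun R _ h => hT h.1)) hz
  have hle := bprob_exists_le (E := Γ.edgeFinset) hp0 hp1 (Finset.univ : Finset V).powerset
    (fun T R => (T.Nonempty ∧ T.card ≤ t₀) ∧
      2 * T.card ≤ (R.filter fun e => ∀ v ∈ e, v ∈ T).card)
  calc _ ≤ _ := bprob_mono hp0 hp1 fun R _ ⟨T, h1, h2, h3⟩ =>
          ⟨T, Finset.mem_powerset.2 (Finset.subset_univ _), ⟨h1, h2⟩, h3⟩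
    _ ≤ _ := hle
    _ ≤ ∑ T ∈ (Finset.univ : Finset V).powerset, g T.card := Finset.sum_le_sum fun T _ => hone T
    _ = ∑ t ∈ Finset.range (n + 1), n.choose t • g t := by
        rw [Finset.sum_powerset_apply_card, Finset.card_univ]
    _ ≤ ∑ t ∈ Finset.range n, r ^ (t + 1) := by
        rw [Finset.sum_range_succ']
        have h0 : g 0 = 0 := by simp [hg]
        rw [h0, smul_zero, add_zero]
        refine Finset.sum_le_sum fun t _ => ?_
        rw [nsmul_eq_mul]
        by_cases ht : t + 1 ≤ t₀
        · have hgt : g (t + 1) = (P * (t + 1 : ℕ)) ^ (2 * (t + 1)) * Real.exp (t + 1 : ℕ) :=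
            if_pos ⟨by omega, ht⟩
          rw [hgt]
          have h5 : (0 : ℝ) < (t + 1 : ℕ) := by positivity
          calc _ ≤ (Real.exp 1 * n / (t + 1 : ℕ)) ^ (t + 1) *
                ((P * (t + 1 : ℕ)) ^ (2 * (t + 1)) * Real.exp (t + 1 : ℕ)) :=
                mul_le_mul_of_nonneg_right (choose_le_exp_mul_pow (by omega)) (by positivity)
            _ = (Real.exp 2 * n * (t + 1 : ℕ) * P ^ 2) ^ (t + 1) := by
                rw [pow_mul, show Real.exp ((t + 1 : ℕ) : ℝ) = Real.exp 1 ^ (t + 1) by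
                  rw [← Real.exp_nat_mul, mul_one], ← mul_pow, ← mul_pow]
                congr 1
                rw [show Real.exp 2 = Real.exp 1 * Real.exp 1 by rw [← Real.exp_add]; norm_num]
                field_simp
            _ ≤ r ^ (t + 1) := by
                refine pow_le_pow_left₀ (by positivity) (le_trans ?_ hr) _
                have : ((t + 1 : ℕ) : ℝ) ≤ t₀ := by exact_mod_cast ht
                gcongr
        · have hgt : g (t + 1) = 0 := if_neg (by omega)
          rw [hgt, mul_zero]; positivity
    _ = r * ∑ t ∈ Finset.range n, r ^ t := by
        rw [Finset.mul_sum]; exact Finset.sum_congr rfl fun t _ => by rw [pow_succ']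
    _ ≤ r * 2 := by
        refine mul_le_mul_of_nonneg_left ?_ hr0
        calc ∑ t ∈ Finset.range n, r ^ t ≤ ∑ t ∈ Finset.range n, (1 / 2 : ℝ) ^ t :=
              Finset.sum_le_sum fun t _ => pow_le_pow_left₀ hr0 hr1 t
          _ ≤ 2 := sum_geometric_two_le n
    _ = 2 * r := mul_comm _ _

lemma one_sub_pow_le_exp_of_le {x : ℝ} (hp1 : p ≤ 1) (hp0 : 0 ≤ p) {k : ℕ} (h : x ≤ k) :
    (1 - p) ^ k ≤ Real.exp (-(p * x)) := by
  refine (one_sub_pow_le_exp hp1 k).trans (Real.exp_le_exp.2 ?_)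
  have := mul_le_mul_of_nonneg_left h hp0
  linarith

/-- Sets of medium size have edges that leave every prescribed small neighbourhood. -/
lemma bprob_exists_trapped_le (hp0 : 0 ≤ p) (hp1 : p ≤ 1) (hδ : ∀ v, δ ≤ Γ.degree v) {s₀ m : ℕ}
    (hm : 14 * m ≤ δ) {μ : ℝ} (hμ0 : 0 < μ) (hμ1 : μ ≤ 1) :
    bprob Γ.edgeFinset p (fun R => ∃ S T : Finset V, s₀ < S.card ∧ S.card ≤ m ∧
      T.card ≤ 6 * S.card ∧ ∀ u ∈ S, ∀ v, v ∉ S → v ∉ T → s(u, v) ∉ R) ≤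
      Real.exp (Fintype.card V * μ +
        Fintype.card V * (Real.exp (-(p * (δ / 4))) * μ⁻¹ ^ 6 * Real.exp 3) - 3 * s₀) := by
  classical
  set n := Fintype.card V with hn
  set x := Real.exp (-(p * (δ / 4))) with hx
  have hx0 : 0 < x := Real.exp_pos _
  set 𝓢 := (Finset.univ : Finset V).powerset with h𝓢
  -- The size constraints become weights: `exp (3 (|S| - s₀)) ≥ 1` encodes `|S| > s₀`, and `μ ^ (|T|
  -- - 6|S|) ≥ 1` encodes `|T| ≤ 6|S|`. The sum over all pairs then factors into two binomial
  -- expansions.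
  have hone : ∀ S T : Finset V, bprob Γ.edgeFinset p (fun R => (s₀ < S.card ∧ S.card ≤ m ∧
      T.card ≤ 6 * S.card) ∧ ∀ u ∈ S, ∀ v, v ∉ S → v ∉ T → s(u, v) ∉ R) ≤
      Real.exp (-(3 * s₀)) * ((x * μ⁻¹ ^ 6 * Real.exp 3) ^ S.card * μ ^ T.card) := by
    intro S T
    by_cases hST : s₀ < S.card ∧ S.card ≤ m ∧ T.card ≤ 6 * S.card
    · obtain ⟨h1, h2, h3⟩ := hST
      set W := S.biUnion fun u => (Γ.neighborFinset u \ (S ∪ T)).image fun v => s(u, v) with hW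
      have hWE : W ⊆ Γ.edgeFinset := by
        intro e he
        obtain ⟨u, -, he⟩ := Finset.mem_biUnion.1 he
        obtain ⟨v, hv, rfl⟩ := Finset.mem_image.1 he
        simpa using (Finset.mem_sdiff.1 hv).1
      have hWc : S.card * (δ - 7 * S.card) ≤ 2 * W.card := by
        refine card_sigma_bounds le_rfl fun u _ => ?_
        have h4 := Finset.le_card_sdiff (S ∪ T) (Γ.neighborFinset u)
        rw [Γ.card_neighborFinset_eq_degree] at h4
        have h5 := Finset.card_union_le S T
        have h6 := hδ u
        omega
      -- At least `δ - 7|S| ≥ δ / 2` edges leave `S ∪ T` from each vertex of `S`; the other half is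
      -- lost to double counting.
      have hWr : (S.card : ℝ) * (δ / 4) ≤ W.card := by
        have h4 : 7 * S.card ≤ δ := by omega
        have h5 : ((S.card * (δ - 7 * S.card) : ℕ) : ℝ) ≤ ((2 * W.card : ℕ) : ℝ) := by
          exact_mod_cast hWc
        rw [Nat.cast_mul, Nat.cast_sub h4] at h5
        push_cast at h5
        have h6 : (14 : ℝ) * S.card ≤ δ := by exact_mod_cast (by omega : 14 * S.card ≤ δ)
        have h7 : (S.card : ℝ) * (δ / 2) ≤ S.card * (δ - 7 * S.card) :=
          mul_le_mul_of_nonneg_left (by linarith) (by positivity)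
        linarith
      calc _ ≤ bprob Γ.edgeFinset p (fun R => Disjoint W R) := by
            refine bprob_mono hp0 hp1 fun R _ h => Finset.disjoint_left.2 fun e he heR => ?_
            obtain ⟨u, hu, he⟩ := Finset.mem_biUnion.1 he
            obtain ⟨v, hv, rfl⟩ := Finset.mem_image.1 he
            have hv2 := (Finset.mem_sdiff.1 hv).2
            rw [Finset.mem_union, not_or] at hv2
            exact h.2 u hu v hv2.1 hv2.2 heR
        _ = (1 - p) ^ W.card := bprob_disjoint hWE p
        _ ≤ Real.exp (-(p * (S.card * (δ / 4)))) := one_sub_pow_le_exp_of_le hp1 hp0 hWr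
        _ = x ^ S.card := by rw [hx, ← Real.exp_nat_mul]; congr 1; ring
        _ ≤ x ^ S.card * ((Real.exp (-(3 * s₀)) * Real.exp 3 ^ S.card) *
              ((μ⁻¹ ^ 6) ^ S.card * μ ^ T.card)) := by
            refine le_mul_of_one_le_right (by positivity) (one_le_mul_of_one_le_of_one_le ?_ ?_)
            · rw [← Real.exp_nat_mul, ← Real.exp_add, Real.one_le_exp_iff]
              have : (s₀ : ℝ) ≤ S.card := by exact_mod_cast h1.le
              linarith
            · rw [← pow_mul]
              calc (1 : ℝ) = μ⁻¹ ^ (6 * S.card) * μ ^ (6 * S.card) := by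
                    rw [← mul_pow, inv_mul_cancel₀ hμ0.ne', one_pow]
                _ ≤ _ := mul_le_mul_of_nonneg_left (pow_le_pow_of_le_one hμ0.le hμ1 h3)
                    (by positivity)
        _ = _ := by rw [mul_pow, mul_pow]; ring
    · exact le_trans (le_of_eq (bprob_eq_zero fun R _ h => hST h.1)) (by positivity)
  have hle := bprob_exists_le (E := Γ.edgeFinset) hp0 hp1 (𝓢 ×ˢ 𝓢)
    (fun k R => (s₀ < k.1.card ∧ k.1.card ≤ m ∧ k.2.card ≤ 6 * k.1.card) ∧
      ∀ u ∈ k.1, ∀ v, v ∉ k.1 → v ∉ k.2 → s(u, v) ∉ R)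
  calc _ ≤ _ := bprob_mono hp0 hp1 fun R _ ⟨S, T, h1, h2, h3, h4⟩ =>
          ⟨(S, T), by simp [h𝓢], ⟨h1, h2, h3⟩, h4⟩
    _ ≤ _ := hle
    _ ≤ ∑ k ∈ 𝓢 ×ˢ 𝓢, Real.exp (-(3 * s₀)) *
          ((x * μ⁻¹ ^ 6 * Real.exp 3) ^ k.1.card * μ ^ k.2.card) :=
        Finset.sum_le_sum fun k _ => hone k.1 k.2
    _ = Real.exp (-(3 * s₀)) * ((1 + x * μ⁻¹ ^ 6 * Real.exp 3) ^ n * (1 + μ) ^ n) := by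
        rw [← Finset.mul_sum, Finset.sum_product]
        dsimp only
        rw [← Finset.sum_mul_sum, h𝓢, sum_pow_card_powerset, sum_pow_card_powerset,
          Finset.card_univ]
    _ ≤ Real.exp (-(3 * s₀)) * (Real.exp (x * μ⁻¹ ^ 6 * Real.exp 3) ^ n * Real.exp μ ^ n) := by
        have h1 := Real.add_one_le_exp (x * μ⁻¹ ^ 6 * Real.exp 3)
        have h2 := Real.add_one_le_exp μ
        gcongr <;> linarith
    _ = _ := by
        rw [← Real.exp_nat_mul, ← Real.exp_nat_mul, ← Real.exp_add, ← Real.exp_add]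
        congr 1; ring

/-- Large sets of vertices have leaving edges. -/
lemma bprob_exists_cut_le (hp0 : 0 ≤ p) (hp1 : p ≤ 1) {θ m : ℕ}
    (hΓ : ∀ v, Fintype.card V + 2 * θ ≤ 2 * Γ.degree v) :
    bprob Γ.edgeFinset p (fun R => ∃ C : Finset V, m < C.card ∧ 2 * C.card ≤ Fintype.card V ∧
      ∀ u ∈ C, ∀ v, v ∉ C → s(u, v) ∉ R) ≤
      2 ^ Fintype.card V * Real.exp (-(p * (m * θ / 2))) := by
  classical
  set 𝓢 := (Finset.univ : Finset V).powerset with h𝓢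
  have hone : ∀ C ∈ 𝓢, bprob Γ.edgeFinset p (fun R => (m < C.card ∧ 2 * C.card ≤ Fintype.card V) ∧
      ∀ u ∈ C, ∀ v, v ∉ C → s(u, v) ∉ R) ≤ Real.exp (-(p * (m * θ / 2))) := by
    intro C _
    by_cases hC : m < C.card ∧ 2 * C.card ≤ Fintype.card V
    · set W := C.biUnion fun u => (Γ.neighborFinset u \ C).image fun v => s(u, v) with hW
      have hWE : W ⊆ Γ.edgeFinset := by
        intro e he
        obtain ⟨u, -, he⟩ := Finset.mem_biUnion.1 he
        obtain ⟨v, hv, rfl⟩ := Finset.mem_image.1 he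
        simpa using (Finset.mem_sdiff.1 hv).1
      -- A vertex of `C` has degree at least `n / 2 + θ` and `|C| ≤ n / 2`, so at least `θ` of its
      -- neighbours lie outside `C`.
      have hWc : m * θ ≤ 2 * W.card := by
        refine card_sigma_bounds hC.1.le fun u _ => ?_
        have h4 := Finset.le_card_sdiff C (Γ.neighborFinset u)
        rw [Γ.card_neighborFinset_eq_degree] at h4
        have h6 := hΓ u
        omega
      have hWr : (m * θ / 2 : ℝ) ≤ W.card := by
        have : ((m * θ : ℕ) : ℝ) ≤ ((2 * W.card : ℕ) : ℝ) := by exact_mod_cast hWc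
        push_cast at this
        linarith
      calc _ ≤ bprob Γ.edgeFinset p (fun R => Disjoint W R) := by
            refine bprob_mono hp0 hp1 fun R _ h => Finset.disjoint_left.2 fun e he heR => ?_
            obtain ⟨u, hu, he⟩ := Finset.mem_biUnion.1 he
            obtain ⟨v, hv, rfl⟩ := Finset.mem_image.1 he
            exact h.2 u hu v (Finset.mem_sdiff.1 hv).2 heR
        _ = (1 - p) ^ W.card := bprob_disjoint hWE p
        _ ≤ _ := one_sub_pow_le_exp_of_le hp1 hp0 hWr
    · exact le_trans (le_of_eq (bprob_eq_zero fun R _ h => hC h.1)) (by positivity)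
  have hle := bprob_exists_le (E := Γ.edgeFinset) hp0 hp1 𝓢
    (fun C R => (m < C.card ∧ 2 * C.card ≤ Fintype.card V) ∧ ∀ u ∈ C, ∀ v, v ∉ C → s(u, v) ∉ R)
  calc _ ≤ _ := bprob_mono hp0 hp1 fun R _ ⟨C, h1, h2, h3⟩ =>
          ⟨C, by simp [h𝓢], ⟨h1, h2⟩, h3⟩
    _ ≤ _ := hle
    _ ≤ 𝓢.card • Real.exp (-(p * (m * θ / 2))) := Finset.sum_le_card_nsmul _ _ _ hone
    _ = _ := by
        rw [h𝓢, Finset.card_powerset, Finset.card_univ, nsmul_eq_mul]; push_cast; rfl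

end Typical

/-! ### ### The non-asymptotic Hamiltonicity bound -/

section Assembly

variable {V : Type*} [Fintype V] [DecidableEq V]

/-- Two distinct small vertices are joined by one of the edge sets `Q k` of size `j`. -/
def LinkedSmall {κ : Type*} (u v : κ → V) (Q : κ → Finset (Sym2 V)) (j : ℕ)
    (R T : Finset (Sym2 V)) : Prop :=
  ∃ k, (u k ≠ v k ∧ (Q k).card = j) ∧ Q k ⊆ R ∪ T ∧ IsSmall R (u k) ∧ IsSmall R (v k)

/-- Two small vertices are joined by a path of length at most four. -/
def CloseSmall (R T : Finset (Sym2 V)) : Prop :=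
  LinkedSmall (fun k : V × V => k.1) (fun k => k.2) (fun k => {s(k.1, k.2)}) 1 R T ∨
  LinkedSmall (fun k : V × V × V => k.1) (fun k => k.2.1)
    (fun k => {s(k.1, k.2.2), s(k.2.2, k.2.1)}) 2 R T ∨
  LinkedSmall (fun k : V × V × V × V => k.1) (fun k => k.2.1)
    (fun k => {s(k.1, k.2.2.1), s(k.2.2.1, k.2.2.2), s(k.2.2.2, k.2.1)}) 3 R T ∨
  LinkedSmall (fun k : V × V × V × V × V => k.1) (fun k => k.2.1)
    (fun k => {s(k.1, k.2.2.1), s(k.2.2.1, k.2.2.2.1), s(k.2.2.2.1, k.2.2.2.2),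
      s(k.2.2.2.2, k.2.1)}) 4 R T

/-- The graph with edge set `F`. -/
abbrev edgeGraph (F : Finset (Sym2 V)) : SimpleGraph V :=
  SimpleGraph.fromEdgeSet (F : Set (Sym2 V))

lemma extNbr_mono {G H : SimpleGraph V} (h : G ≤ H) (S : Finset V) : extNbr G S ⊆ extNbr H S := by
  intro v hv
  obtain ⟨h1, u, hu, huv⟩ := mem_extNbr.1 hv
  exact mem_extNbr.2 ⟨h1, u, hu, h huv⟩

lemma edgeGraph_mono {F F' : Finset (Sym2 V)} (h : F ⊆ F') : edgeGraph F ≤ edgeGraph F' :=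
  SimpleGraph.fromEdgeSet_mono (by exact_mod_cast h)

/-- Outside the exceptional events, `R` together with the edges at small vertices expands. -/
lemma expansion_of_typical {R T F₀ : Finset (Sym2 V)} (hd : ∀ e ∈ R ∪ T, ¬ e.IsDiag) {m s₀ : ℕ}
    (hF₀ : ∀ e, e ∈ F₀ ↔ e ∈ T ∧ ∃ v ∈ e, IsSmall R v)
    (hdeg : ∀ v, 2 ≤ ((R ∪ T).filter (v ∈ ·)).card)
    (hclose : ¬ CloseSmall R T)
    (hcod : ¬ ∃ u v, u ≠ v ∧ 2 < (nbr (edgeGraph (R ∪ T)) u ∩ nbr (edgeGraph (R ∪ T)) v).card)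
    (hsparse : ¬ ∃ S : Finset V, S.Nonempty ∧ S.card ≤ 7 * s₀ ∧
      2 * S.card ≤ (R.filter fun e => ∀ v ∈ e, v ∈ S).card)
    (hmid : ¬ ∃ S S' : Finset V, s₀ < S.card ∧ S.card ≤ m ∧
      S'.card ≤ 6 * S.card ∧ ∀ u ∈ S, ∀ v, v ∉ S → v ∉ S' → s(u, v) ∉ R)
    (S : Finset V) (hS : S.card ≤ m) : 2 * S.card ≤ (extNbr (edgeGraph (R ∪ F₀)) S).card := by
  classical
  have hRd : ∀ e ∈ R, ¬ e.IsDiag := fun e he => hd e (Finset.mem_union_left _ he)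
  have hF₀T : F₀ ⊆ T := fun e he => ((hF₀ e).1 he).1
  set U : Finset V := Finset.univ.filter fun v => IsSmall R v with hU
  have hUm : ∀ {v}, v ∈ U → IsSmall R v := fun h => (Finset.mem_filter.1 h).2
  have hG : ∀ {u v}, (edgeGraph (R ∪ T)).Adj u v ↔ s(u, v) ∈ R ∪ T := fromEdgeSet_adj_of_mem hd
  simp only [CloseSmall, not_or] at hclose
  obtain ⟨c1, c2, c3, c4⟩ := hclose
  have h1 : ∀ u ∈ U, ∀ u' ∈ U, u ≠ u' → ¬ (edgeGraph (R ∪ T)).Adj u u' := by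
    intro u hu u' hu' hne ha
    exact c1 ⟨(u, u'), ⟨hne, by simp⟩, by simpa using hG.1 ha, hUm hu, hUm hu'⟩
  have h2 : ∀ u ∈ U, ∀ u' ∈ U, u ≠ u' → ∀ a, (edgeGraph (R ∪ T)).Adj u a →
      ¬ (edgeGraph (R ∪ T)).Adj a u' := by
    intro u hu u' hu' hne a ha ha'
    refine c2 ⟨(u, u', a), ⟨hne, ?_⟩, ?_, hUm hu, hUm hu'⟩
    · refine Finset.card_pair fun h => ?_
      have := ha.ne
      rcases Sym2.eq_iff.1 h with ⟨h, h'⟩ | ⟨h, h'⟩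
      · exact this h
      · exact hne h
    · simp only [Finset.insert_subset_iff, Finset.singleton_subset_iff]
      exact ⟨hG.1 ha, hG.1 ha'⟩
  have h3 : ∀ u ∈ U, ∀ u' ∈ U, u ≠ u' → ∀ a b, (edgeGraph (R ∪ T)).Adj u a →
      (edgeGraph (R ∪ T)).Adj a b → ¬ (edgeGraph (R ∪ T)).Adj b u' := by
    intro u hu u' hu' hne a b ha hab hb
    refine c3 ⟨(u, u', a, b), ⟨hne, ?_⟩, ?_, hUm hu, hUm hu'⟩
    -- The bound for links of length three needs three distinct edges. Coincidences would make a
    -- small vertex adjacent to the other one, which `h1` excludes; length four uses `h2` as well.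
    · have e1 := ha.ne
      have e2 := hab.ne
      have e3 := hb.ne
      have e4 : b ≠ u := by rintro rfl; exact h1 b hu u' hu' hne hb
      have e5 : a ≠ u' := by rintro rfl; exact h1 u hu a hu' hne ha
      dsimp only
      rw [Finset.card_insert_of_notMem, Finset.card_insert_of_notMem, Finset.card_singleton] <;>
      simp only [Finset.mem_insert, Finset.mem_singleton, Sym2.eq_iff] <;> grind
    · simp only [Finset.insert_subset_iff, Finset.singleton_subset_iff]
      exact ⟨hG.1 ha, hG.1 hab, hG.1 hb⟩
  have h4 : ∀ u ∈ U, ∀ u' ∈ U, u ≠ u' → ∀ a b c, (edgeGraph (R ∪ T)).Adj u a →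
      (edgeGraph (R ∪ T)).Adj a b → (edgeGraph (R ∪ T)).Adj b c →
      ¬ (edgeGraph (R ∪ T)).Adj c u' := by
    intro u hu u' hu' hne a b c ha hab hbc hc
    refine c4 ⟨(u, u', a, b, c), ⟨hne, ?_⟩, ?_, hUm hu, hUm hu'⟩
    · have e1 := ha.ne
      have e2 := hab.ne
      have e3 := hbc.ne
      have e4 := hc.ne
      have e5 : c ≠ u := by rintro rfl; exact h1 c hu u' hu' hne hc
      have e6 : a ≠ u' := by rintro rfl; exact h1 u hu a hu' hne ha
      have e7 : b ≠ u := by rintro rfl; exact h2 b hu u' hu' hne c hbc hc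
      have e8 : b ≠ u' := by rintro rfl; exact h2 u hu b hu' hne a ha hab
      have e9 : a ≠ c := by rintro rfl; exact h2 u hu u' hu' hne a ha hc
      dsimp only
      rw [Finset.card_insert_of_notMem, Finset.card_insert_of_notMem,
        Finset.card_insert_of_notMem, Finset.card_singleton] <;>
      simp only [Finset.mem_insert, Finset.mem_singleton, Sym2.eq_iff] <;> grind
    · simp only [Finset.insert_subset_iff, Finset.singleton_subset_iff]
      exact ⟨hG.1 ha, hG.1 hab, hG.1 hbc, hG.1 hc⟩
  refine two_mul_card_le_card_extNbr (G := edgeGraph (R ∪ T)) (R := edgeGraph R) (U := U)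
    (edgeGraph_mono Finset.subset_union_left)
    (edgeGraph_mono (Finset.union_subset_union_right hF₀T)) ?_ ?_ h1 h2 h3 h4 ?_ ?_ S hS
  · intro u hu v huv
    rw [SimpleGraph.fromEdgeSet_adj]
    refine ⟨?_, huv.ne⟩
    rcases Finset.mem_union.1 (hG.1 huv) with h | h
    · exact_mod_cast Finset.mem_union_left _ h
    · exact_mod_cast Finset.mem_union_right _ ((hF₀ _).2 ⟨h, u, by simp, hUm hu⟩)
  · intro u _
    rw [card_nbr_fromEdgeSet hd]
    exact hdeg u
  · intro u v huv
    by_contra! h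
    exact hcod ⟨u, v, huv, h⟩
  · intro S' hS' hS'm
    refine six_mul_card_le_card_extNbr hRd (t₀ := 7 * s₀) (m := m) ?_ ?_ hS'm ?_
    · intro S'' hne hc
      by_contra! h
      exact hsparse ⟨S'', hne, by exact_mod_cast hc, h⟩
    · intro A B hA hAm hB
      by_contra! h
      refine hmid ⟨A, B, ?_, hAm, hB, fun u hu v hv hv' => h u hu v hv hv'⟩
      have : (7 : ℝ) * s₀ < 7 * A.card := hA
      have : (s₀ : ℝ) < A.card := by linarith
      exact_mod_cast this
    · intro v hv
      by_contra! h
      exact Finset.disjoint_left.1 hS' hv (Finset.mem_filter.2 ⟨Finset.mem_univ _, h⟩)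

variable {Γ : SimpleGraph V} [DecidableRel Γ.Adj]

/-- A link with `j` edges is described by `j + 1` vertices, whence the power of `n`. -/
lemma bprob₂_closeSmall_le {p q lam : ℝ} {δ : ℕ} (hp0 : 0 ≤ p) (hp1 : p ≤ 1) (hq0 : 0 ≤ q)
    (hq1 : q ≤ 1) (hl0 : 0 < lam) (hl1 : lam ≤ 1) (hδ : ∀ v, δ ≤ Γ.degree v) :
    bprob₂ Γ.edgeFinset p q CloseSmall ≤
      ∑ j ∈ Finset.Icc 1 4, (Fintype.card V : ℝ) ^ (j + 1) * ((p + q - p * q) ^ j *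
        (lam⁻¹ ^ 56 * (1 - p + p * lam) ^ (2 * δ - 1 - j))) := by
  have b1 := bprob₂_exists_subset_isSmall_le hp0 hp1 hq0 hq1 hl0 hl1 hδ
    (fun k : V × V => k.1) (fun k => k.2) (fun k => {s(k.1, k.2)}) 1
  have b2 := bprob₂_exists_subset_isSmall_le hp0 hp1 hq0 hq1 hl0 hl1 hδ
    (fun k : V × V × V => k.1) (fun k => k.2.1) (fun k => {s(k.1, k.2.2), s(k.2.2, k.2.1)}) 2
  have b3 := bprob₂_exists_subset_isSmall_le hp0 hp1 hq0 hq1 hl0 hl1 hδ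
    (fun k : V × V × V × V => k.1) (fun k => k.2.1)
    (fun k => {s(k.1, k.2.2.1), s(k.2.2.1, k.2.2.2), s(k.2.2.2, k.2.1)}) 3
  have b4 := bprob₂_exists_subset_isSmall_le hp0 hp1 hq0 hq1 hl0 hl1 hδ
    (fun k : V × V × V × V × V => k.1) (fun k => k.2.1)
    (fun k => {s(k.1, k.2.2.1), s(k.2.2.1, k.2.2.2.1), s(k.2.2.2.1, k.2.2.2.2),
      s(k.2.2.2.2, k.2.1)}) 4
  simp only [Fintype.card_prod, Nat.cast_mul] at b1 b2 b3 b4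
  have hsum : ∀ f : ℕ → ℝ, ∑ j ∈ Finset.Icc 1 4, f j = f 1 + (f 2 + (f 3 + f 4)) := by
    intro f
    rw [show Finset.Icc 1 4 = {1, 2, 3, 4} from rfl]
    simp
  rw [hsum]
  refine (bprob₂_or_le hp0 hp1 hq0 hq1 _ _).trans (add_le_add (b1.trans_eq (by ring)) ?_)
  refine (bprob₂_or_le hp0 hp1 hq0 hq1 _ _).trans (add_le_add (b2.trans_eq (by ring)) ?_)
  exact (bprob₂_or_le hp0 hp1 hq0 hq1 _ _).trans
    (add_le_add (b3.trans_eq (by ring)) (b4.trans_eq (by ring)))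

/-- A non-asymptotic bound for the probability that the random subgraph has minimum degree at
least two without being Hamiltonian. -/
theorem bprob_not_isHamiltonian_le [Nonempty V] (h3 : 3 ≤ Fintype.card V)
    {p₁ a b q P lam μ r : ℝ} {δ θ m s₀ k : ℕ}
    (hp0 : 0 ≤ p₁) (hp1 : p₁ ≤ 1) (ha0 : 0 ≤ a) (ha1 : a ≤ 1) (hb0 : 0 ≤ b) (hb1 : b ≤ 1)
    (hq : q = a + b - a * b) (hP : P = p₁ + q - p₁ * q) (hP0 : 0 < P)
    (hδ : ∀ v, δ ≤ Γ.degree v) (hΓ : ∀ v, Fintype.card V + 2 * θ ≤ 2 * Γ.degree v)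
    (hm : 14 * m ≤ δ) (hk : 2 * (k + 3 * Fintype.card V) ≤ m * θ)
    (hl0 : 0 < lam) (hl1 : lam ≤ 1) (hμ0 : 0 < μ) (hμ1 : μ ≤ 1)
    (hPt : P * (7 * s₀ : ℕ) ≤ 1)
    (hr : Real.exp 2 * Fintype.card V * (7 * s₀ : ℕ) * P ^ 2 ≤ r) (hr1 : r ≤ 1 / 2) :
    bprob Γ.edgeFinset P (fun S => (∀ v, 2 ≤ (S.filter (v ∈ ·)).card) ∧
      ¬ (edgeGraph S).IsHamiltonian) ≤
      ((∑ j ∈ Finset.Icc 1 4, (Fintype.card V : ℝ) ^ (j + 1) * (P ^ j *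
        (lam⁻¹ ^ 56 * (1 - p₁ + p₁ * lam) ^ (2 * δ - 1 - j)))) +
      ((Fintype.card V : ℝ) ^ 5 * P ^ 6 +
      (2 * r +
      (Real.exp (Fintype.card V * μ +
        Fintype.card V * (Real.exp (-(p₁ * (δ / 4))) * μ⁻¹ ^ 6 * Real.exp 3) - 3 * s₀) +
      (2 ^ Fintype.card V * Real.exp (-(p₁ * (m * θ / 2))) +
      Fintype.card V * q * (lam⁻¹ ^ 28 * (1 - p₁ + p₁ * lam) ^ δ)))))) +
      lam⁻¹ ^ (3 * Fintype.card V) * (1 + lam * q) ^ Γ.edgeFinset.card *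
        (Fintype.card V * 2 ^ Fintype.card V * (1 - a) ^ k + (1 - b) ^ k) := by
  classical
  set E := Γ.edgeFinset with hE
  set n := Fintype.card V with hn
  have hq0 : 0 ≤ q := by rw [hq]; nlinarith
  have hq1 : q ≤ 1 := by rw [hq]; nlinarith
  have hpP : p₁ ≤ P := by rw [hP]; nlinarith
  have hEd : ∀ e ∈ E, ¬ e.IsDiag := fun e he =>
    Γ.not_isDiag_of_mem_edgeSet (by simpa [hE] using he)
  -- the exceptional events for the pair `(R, A ∪ B)`
  set Cod : Finset (Sym2 V) → Finset (Sym2 V) → Prop := fun R T => ∃ u v, u ≠ v ∧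
    2 < (nbr (edgeGraph (R ∪ T)) u ∩ nbr (edgeGraph (R ∪ T)) v).card with hCod
  set Den : Finset (Sym2 V) → Prop := fun R => ∃ S : Finset V, S.Nonempty ∧ S.card ≤ 7 * s₀ ∧
      2 * S.card ≤ (R.filter fun e => ∀ v ∈ e, v ∈ S).card with hDen
  set Mid : Finset (Sym2 V) → Prop := fun R => ∃ S S' : Finset V, s₀ < S.card ∧ S.card ≤ m ∧
      S'.card ≤ 6 * S.card ∧ ∀ u ∈ S, ∀ v, v ∉ S → v ∉ S' → s(u, v) ∉ R with hMid
  set Cut : Finset (Sym2 V) → Prop := fun R => ∃ C : Finset V, m < C.card ∧ 2 * C.card ≤ n ∧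
      ∀ u ∈ C, ∀ v, v ∉ C → s(u, v) ∉ R with hCut
  set Big : Finset (Sym2 V) → Finset (Sym2 V) → Prop := fun R T => ∀ F : Finset (Sym2 V),
      (∀ e, e ∈ F ↔ e ∈ T ∧ ∃ v ∈ e, IsSmall R v) → n < F.card with hBig
  set Bad : Finset (Sym2 V) → Finset (Sym2 V) → Prop := fun R T =>
    CloseSmall R T ∨ Cod R T ∨ Den R ∨ Mid R ∨ Cut R ∨ Big R T with hBad
  set Boost : Finset (Sym2 V) → Finset (Sym2 V) → Finset (Sym2 V) → Prop := fun R A B =>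
    ∃ F ∈ E.powerset, F ⊆ A ∪ B ∧ F.card ≤ 3 * n ∧
      m ≤ (longestStarts (edgeGraph (R ∪ F))).card ∧
      (∀ x ∈ longestStarts (edgeGraph (R ∪ F)), m ≤ (longestEnds (edgeGraph (R ∪ F)) x).card) ∧
      NoBooster (edgeGraph (R ∪ F)) A B with hBoost
  have hdet : ∀ R ⊆ E, ∀ A ⊆ E, ∀ B ⊆ E, ((∀ v, 2 ≤ ((R ∪ (A ∪ B)).filter (v ∈ ·)).card) ∧
      ¬ (edgeGraph (R ∪ (A ∪ B))).IsHamiltonian) → Bad R (A ∪ B) ∨ Boost R A B := by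
    rintro R hR A hA B hB ⟨hdeg, hnot⟩
    by_contra hcon
    rw [not_or] at hcon
    obtain ⟨hbad, hboost⟩ := hcon
    simp only [hBad, not_or] at hbad
    obtain ⟨n1, n2, n3, n4, n5, n6⟩ := hbad
    have hABE : A ∪ B ⊆ E := Finset.union_subset hA hB
    have hd : ∀ e ∈ R ∪ (A ∪ B), ¬ e.IsDiag := fun e he =>
      hEd e (Finset.union_subset hR hABE he)
    simp only [hBig] at n6
    push Not at n6
    -- `F₀` is the set of later edges at small vertices, at most `n` of them. Boosting adds at most
    -- `2n` more, which gives the budget `3n`.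
    obtain ⟨F₀, hF₀, hF₀c⟩ := n6
    have hexp := expansion_of_typical hd hF₀ hdeg n1 n2 n3 n4
    have hconn : (edgeGraph (R ∪ F₀)).Connected := by
      refine connected_of_expansion hexp fun C hC1 hC2 => ?_
      by_contra! h
      refine n5 ⟨C, hC1, hC2, fun u hu v hv huv => h u hu v hv ?_⟩
      exact edgeGraph_mono Finset.subset_union_left
        ((fromEdgeSet_adj_of_mem fun e he => hEd e (hR he)).2 huv)
    obtain ⟨F, hF1, hF2, hF3, hF4⟩ := exists_noBooster h3 (R := R) (A := A) (B := B) (F₀ := F₀)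
      (fun e he => ((hF₀ e).1 he).1) (fun e he => hEd e (hABE he)) hconn hnot
    have hexpF : ∀ S : Finset V, S.card ≤ m →
        2 * S.card ≤ (extNbr (edgeGraph (R ∪ F)) S).card := fun S hS =>
      (hexp S hS).trans (Finset.card_le_card (extNbr_mono
        (edgeGraph_mono (Finset.union_subset_union_right hF1)) S))
    refine hboost ⟨F, Finset.mem_powerset.2 (hF2.trans hABE), hF2, by omega,
      (lt_card_longestStarts hexpF).le, fun x hx => ?_, hF4⟩
    obtain ⟨-, l, hl, hx⟩ := Finset.mem_filter.1 hx
    exact (lt_card_longestEnds hexpF hl hx).le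
  have hBadle : bprob₂ E p₁ q Bad ≤ _ := calc
    _ ≤ _ := (bprob₂_or_le hp0 hp1 hq0 hq1 _ _).trans (add_le_add le_rfl
      ((bprob₂_or_le hp0 hp1 hq0 hq1 _ _).trans (add_le_add le_rfl
      ((bprob₂_or_le hp0 hp1 hq0 hq1 _ _).trans (add_le_add le_rfl
      ((bprob₂_or_le hp0 hp1 hq0 hq1 _ _).trans (add_le_add le_rfl
      (bprob₂_or_le hp0 hp1 hq0 hq1 _ _))))))))
    _ ≤ _ := add_le_add (bprob₂_closeSmall_le hp0 hp1 hq0 hq1 hl0 hl1 hδ)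
      (add_le_add (bprob₂_exists_codegree_le hp0 hp1 hq0 hq1)
      (add_le_add ((bprob₂_fst Den).le.trans (bprob_exists_dense_le hp0 hp1 hpP hP0 hPt hr hr1))
      (add_le_add ((bprob₂_fst Mid).le.trans
        (bprob_exists_trapped_le hp0 hp1 hδ hm hμ0 hμ1 (s₀ := s₀)))
      (add_le_add ((bprob₂_fst Cut).le.trans (bprob_exists_cut_le hp0 hp1 hΓ (m := m)))
        (bprob₂_card_filter_isSmall_le hp0 hp1 hq0 hq1 hl0 hl1 hδ)))))
  rw [← hP] at hBadle
  -- Expose the edges in three rounds. The exceptional events see only `A ∪ B`, a single round of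
  -- density `q`; the booster argument needs `A` and `B` separately.
  calc bprob E P (fun S => (∀ v, 2 ≤ (S.filter (v ∈ ·)).card) ∧ ¬ (edgeGraph S).IsHamiltonian)
      = bexp E p₁ (fun R => bprob₂ E a b fun A B =>
          (∀ v, 2 ≤ ((R ∪ (A ∪ B)).filter (v ∈ ·)).card) ∧
          ¬ (edgeGraph (R ∪ (A ∪ B))).IsHamiltonian) := by
        rw [hP, ← bprob_union]
        refine bexp_congr fun R _ => ?_
        rw [hq, ← bprob_union E a b (fun T => (∀ v, 2 ≤ ((R ∪ T).filter (v ∈ ·)).card) ∧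
          ¬ (edgeGraph (R ∪ T)).IsHamiltonian), bprob₂]
    _ ≤ bexp E p₁ (fun R => bprob₂ E a b (fun A B => Bad R (A ∪ B)) + bprob₂ E a b (Boost R)) :=
        bexp_mono hp0 hp1 fun R hR => (bprob₂_mono ha0 ha1 hb0 hb1 (hdet R hR)).trans
          (bprob₂_or_le ha0 ha1 hb0 hb1 _ _)
    _ = bprob₂ E p₁ q Bad + bexp E p₁ (fun R => bprob₂ E a b (Boost R)) := by
        rw [bexp_add]
        congr 1
        refine bexp_congr fun R _ => ?_
        rw [hq, ← bprob_union, bprob₂]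
    _ ≤ _ := by
        refine add_le_add hBadle ?_
        calc bexp E p₁ (fun R => bprob₂ E a b (Boost R)) ≤ bexp E p₁ (fun _ => _) :=
              bexp_mono hp0 hp1 fun R _ =>
                bprob₂_exists_noBooster_le Γ ha0 ha1 hb0 hb1 hΓ R hk hl0 hl1
          _ = _ := by rw [bexp_const, hq]

end Assembly

/-! ### ### Choice of parameters and error estimates -/

section Asymptotics

/-- The sum of the error terms, as a function of `L = log n`. -/
noncomputable def errorTerm (L : ℝ) : ℝ :=
  4 * (256 * Real.exp 6) * (L ^ 60 * Real.exp (-(1 / 2) * L)) + 4096 * (L ^ 6 * Real.exp (-1 * L)) +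
    448 * Real.exp 2 * L⁻¹ + L ^ 3 * Real.exp (-1 * L) + L ^ 0 * Real.exp (-1 * L) +
    4 * Real.exp 1 * (L ^ 29 * Real.exp (-(3 / 4) * L)) + L ^ 0 * Real.exp (-1 * L)

lemma tendsto_pow_mul_exp_neg_mul (k : ℕ) {b : ℝ} (hb : 0 < b) :
    Tendsto (fun L : ℝ => L ^ k * Real.exp (-b * L)) atTop (𝓝 0) := by
  have := tendsto_rpow_mul_exp_neg_mul_atTop_nhds_zero (k : ℝ) b hb
  simpa [Real.rpow_natCast] using this

lemma tendsto_errorTerm : Tendsto errorTerm atTop (𝓝 0) := by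
  have h : Tendsto errorTerm atTop (𝓝 (4 * (256 * Real.exp 6) * 0 + 4096 * 0 +
      448 * Real.exp 2 * 0 + 0 + 0 + 4 * Real.exp 1 * 0 + 0)) := by
    unfold errorTerm
    refine ((((((Tendsto.const_mul _ ?_).add (Tendsto.const_mul _ ?_)).add
      (Tendsto.const_mul _ tendsto_inv_atTop_zero)).add ?_).add ?_).add
      (Tendsto.const_mul _ ?_)).add ?_ <;>
    exact tendsto_pow_mul_exp_neg_mul _ (by norm_num)
  simpa using h

variable {V : Type*} [Fintype V] [DecidableEq V] {Γ : SimpleGraph V} [DecidableRel Γ.Adj]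

lemma exp_neg_le_inv {x : ℝ} (hx : 0 < x) : Real.exp (-x) ≤ x⁻¹ := by
  rw [Real.exp_neg]
  exact inv_anti₀ hx (by linarith [Real.add_one_le_exp x])

/-- The first round has density `3P/4` and the Chernoff base is `1/L`, so the quantity raised to the
power is `1 - 3P/4 * (1 - 1/L)`. -/
lemma pow_le_exp_neg {P L x : ℝ} {N : ℕ} (hP0 : 0 ≤ P) (hP1 : P ≤ 1) (hL : 0 < L)
    (hx : x ≤ 3 * P / 4 * (1 - L⁻¹) * N) :
    (1 - 3 * P / 4 + 3 * P / 4 * L⁻¹) ^ N ≤ Real.exp (-x) := by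
  have h0 : 0 ≤ 1 - 3 * P / 4 + 3 * P / 4 * L⁻¹ := by
    have : 0 ≤ 3 * P / 4 * L⁻¹ := by positivity
    linarith
  have h1 : 1 - 3 * P / 4 + 3 * P / 4 * L⁻¹ ≤ Real.exp (-(3 * P / 4 * (1 - L⁻¹))) := by
    have := Real.add_one_le_exp (-(3 * P / 4 * (1 - L⁻¹)))
    linarith
  calc _ ≤ Real.exp (-(3 * P / 4 * (1 - L⁻¹))) ^ N := pow_le_pow_left₀ h0 h1 N
    _ = Real.exp (-(3 * P / 4 * (1 - L⁻¹) * N)) := by rw [← Real.exp_nat_mul]; congr 1; ring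
    _ ≤ _ := Real.exp_le_exp.2 (by linarith)

/-- Two small vertices cost `n ^ (-3/2)` up to powers of `L`, because the first round carries three
quarters of the density. A link contributes `n * (P n) ^ j`, so `n ^ (-1/2)` remains up to powers of
`L`. -/
lemma sum_smallPair_le {P L : ℝ} {n δ : ℕ} (hnL : (n : ℝ) = Real.exp L)
    (hL : 16 ≤ L) (hP0 : 0 < P) (hP1 : P ≤ 1) (hPn : P * n ≤ 4 * L) (hPδ : L ≤ P * δ) :
    ∑ j ∈ Finset.Icc 1 4, (n : ℝ) ^ (j + 1) * (P ^ j *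
      (L⁻¹⁻¹ ^ 56 * (1 - 3 * P / 4 + 3 * P / 4 * L⁻¹) ^ (2 * δ - 1 - j))) ≤
      4 * (256 * Real.exp 6) * (L ^ 60 * Real.exp (-(1 / 2) * L)) := by
  have hL0 : 0 < L := by linarith
  have hnR : (0 : ℝ) < n := hnL ▸ Real.exp_pos L
  have hLinv : L * L⁻¹ = 1 := mul_inv_cancel₀ hL0.ne'
  have hlam0 : 0 < L⁻¹ := by positivity
  have hlam1 : L⁻¹ ≤ 1 := inv_le_one_of_one_le₀ (by linarith)
  have hb0 : 0 ≤ 1 - 3 * P / 4 + 3 * P / 4 * L⁻¹ := by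
    have : 0 ≤ 3 * P / 4 * L⁻¹ := by positivity
    linarith
  have hn_exp := hnL
  have hj : ∀ j ∈ Finset.Icc 1 4, (n : ℝ) ^ (j + 1) * (P ^ j *
    (L⁻¹⁻¹ ^ 56 * (1 - 3 * P / 4 + 3 * P / 4 * L⁻¹) ^ (2 * δ - 1 - j))) ≤
      256 * Real.exp 6 * (L ^ 60 * Real.exp (-(1 / 2) * L)) := by
    intro j hj
    rw [Finset.mem_Icc] at hj
    have hN : (2 * δ - 5 : ℝ) ≤ ((2 * δ - 1 - j : ℕ) : ℝ) := by
      have : 2 * δ ≤ (2 * δ - 1 - j) + 5 := by omega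
      have : (2 * δ : ℝ) ≤ ((2 * δ - 1 - j : ℕ) : ℝ) + 5 := by exact_mod_cast this
      linarith
    have h1 : (1 - 3 * P / 4 + 3 * P / 4 * L⁻¹) ^ (2 * δ - 1 - j) ≤ Real.exp (-(3 / 2 * L - 6)) := by
      refine pow_le_exp_neg hP0.le hP1 hL0 ?_
      have h2 : (3 * P / 4) * (1 - L⁻¹) * (2 * δ - 5) ≤ (3 * P / 4) * (1 - L⁻¹) * ((2 * δ - 1 - j : ℕ) : ℝ) :=
        mul_le_mul_of_nonneg_left hN (mul_nonneg (by positivity) (by linarith))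
      refine le_trans ?_ h2
      have h3 : 2 * L - 5 ≤ P * (2 * δ - 5) := by nlinarith
      have h4 : (3 / 4 * (1 - L⁻¹)) * (2 * L - 5) ≤ (3 / 4 * (1 - L⁻¹)) * (P * (2 * δ - 5)) :=
        mul_le_mul_of_nonneg_left h3 (by linarith)
      have h5 : (3 * P / 4) * (1 - L⁻¹) * (2 * δ - 5) = (3 / 4 * (1 - L⁻¹)) * (P * (2 * δ - 5)) := by
        ring
      rw [h5]
      refine le_trans ?_ h4
      have h6 : (3 / 4 * (1 - L⁻¹)) * (2 * L - 5) =
          3 / 2 * L - 15 / 4 - 3 / 2 * (L * L⁻¹) + 15 / 4 * L⁻¹ := by ring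
      rw [h6, hLinv]
      linarith
    calc (n : ℝ) ^ (j + 1) * (P ^ j * (L⁻¹⁻¹ ^ 56 * (1 - 3 * P / 4 + 3 * P / 4 * L⁻¹) ^ (2 * δ - 1 - j)))
        = n * (P * n) ^ j * L ^ 56 * (1 - 3 * P / 4 + 3 * P / 4 * L⁻¹) ^ (2 * δ - 1 - j) := by
          rw [inv_inv, mul_pow, pow_succ]; ring
      _ ≤ n * (4 * L) ^ j * L ^ 56 * Real.exp (-(3 / 2 * L - 6)) := by gcongr
      _ ≤ n * (4 * L) ^ 4 * L ^ 56 * Real.exp (-(3 / 2 * L - 6)) := by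
          have : (4 * L) ^ j ≤ (4 * L) ^ 4 := pow_le_pow_right₀ (by linarith) hj.2
          gcongr
      _ = 256 * Real.exp 6 * (L ^ 60 * Real.exp (-(1 / 2) * L)) := by
          rw [hn_exp, show -(3 / 2 * L - 6) = -L + (6 + -(1 / 2) * L) by ring, Real.exp_add,
            Real.exp_add, Real.exp_neg]
          field_simp
          ring
  have := Finset.sum_le_card_nsmul _ _ _ hj
  rw [Nat.card_Icc, nsmul_eq_mul] at this
  refine this.trans_eq ?_
  norm_num
  ring

lemma pow_mul_pow_le {P L : ℝ} {n : ℕ} (hnL : (n : ℝ) = Real.exp L) (hP0 : 0 < P)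
    (hPn : P * n ≤ 4 * L) :
    (n : ℝ) ^ 5 * P ^ 6 ≤ 4096 * (L ^ 6 * Real.exp (-1 * L)) := by
  have hnR : (0 : ℝ) < n := hnL ▸ Real.exp_pos L
  have hn_exp := hnL
  have hn_inv : (n : ℝ)⁻¹ = Real.exp (-1 * L) := by
    rw [hn_exp, ← Real.exp_neg]; congr 1; ring
  calc (n : ℝ) ^ 5 * P ^ 6 = (P * n) ^ 6 * (n : ℝ)⁻¹ := by field_simp
    _ ≤ (4 * L) ^ 6 * (n : ℝ)⁻¹ := by gcongr
    _ = _ := by rw [hn_inv]; ring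

/-- With `μ = L⁻³`, each positive term in the exponent is at most `s₀`, so the exponent is at most
`-s₀ ≤ -n / L³`. -/
lemma exp_mid_le {P L : ℝ} {n δ s₀ : ℕ} (hnL : (n : ℝ) = Real.exp L) (hL : 16 ≤ L)
    (hPδ : L ≤ P * δ) (hL21 : L ^ 21 * Real.exp 3 ≤ Real.exp (3 / 16 * L))
    (hs1 : (n : ℝ) / L ^ 3 ≤ s₀) :
    Real.exp (n * (L ^ 3)⁻¹ + n * (Real.exp (-((3 * P / 4) * (δ / 4))) * (L ^ 3)⁻¹⁻¹ ^ 6 *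
      Real.exp 3) - 3 * s₀) ≤ L ^ 3 * Real.exp (-1 * L) := by
  have hL0 : 0 < L := by linarith
  have hnR : (0 : ℝ) < n := hnL ▸ Real.exp_pos L
  have hn_exp := hnL
  have hn_inv : (n : ℝ)⁻¹ = Real.exp (-1 * L) := by
    rw [hn_exp, ← Real.exp_neg]; congr 1; ring
  have h1 : Real.exp (-((3 * P / 4) * (δ / 4))) ≤ Real.exp (-(3 / 16 * L)) := by
    refine Real.exp_le_exp.2 ?_
    nlinarith
  have h2 : Real.exp (-((3 * P / 4) * (δ / 4))) * (L ^ 3)⁻¹⁻¹ ^ 6 * Real.exp 3 ≤ (L ^ 3)⁻¹ := by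
    rw [inv_inv, ← one_div, le_div_iff₀ (by positivity)]
    calc Real.exp (-((3 * P / 4) * (δ / 4))) * (L ^ 3) ^ 6 * Real.exp 3 * L ^ 3
        ≤ Real.exp (-(3 / 16 * L)) * (L ^ 3) ^ 6 * Real.exp 3 * L ^ 3 := by gcongr
      _ = Real.exp (-(3 / 16 * L)) * (L ^ 21 * Real.exp 3) := by ring
      _ ≤ Real.exp (-(3 / 16 * L)) * Real.exp (3 / 16 * L) := by gcongr
      _ = 1 := by rw [← Real.exp_add]; simp
  have h3 : (n : ℝ) * (Real.exp (-((3 * P / 4) * (δ / 4))) * (L ^ 3)⁻¹⁻¹ ^ 6 * Real.exp 3) ≤ s₀ :=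
    (mul_le_mul_of_nonneg_left h2 hnR.le).trans (by rw [← div_eq_mul_inv]; exact hs1)
  have h4 : (n : ℝ) * (L ^ 3)⁻¹ ≤ s₀ := by rw [← div_eq_mul_inv]; exact hs1
  calc _ ≤ Real.exp (-(n / L ^ 3)) := Real.exp_le_exp.2 (by linarith)
    _ ≤ ((n : ℝ) / L ^ 3)⁻¹ := exp_neg_le_inv (by positivity)
    _ = L ^ 3 * (n : ℝ)⁻¹ := by rw [inv_div, div_eq_mul_inv]
    _ = _ := by rw [hn_inv]

lemma exp_neg_natCast_le {L : ℝ} {n : ℕ} (hnL : (n : ℝ) = Real.exp L) :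
    Real.exp (-(n : ℝ)) ≤ L ^ 0 * Real.exp (-1 * L) := by
  have hnR : (0 : ℝ) < n := hnL ▸ Real.exp_pos L
  have hn_inv : (n : ℝ)⁻¹ = Real.exp (-1 * L) := by
    rw [hnL, ← Real.exp_neg]; congr 1; ring
  rw [pow_zero, one_mul, ← hn_inv]
  exact exp_neg_le_inv hnR

lemma two_pow_le_exp (n : ℕ) : (2 : ℝ) ^ n ≤ Real.exp n := by
  rw [← mul_one (n : ℝ), Real.exp_nat_mul]
  exact pow_le_pow_left₀ (by norm_num) (by linarith [Real.add_one_le_exp (1 : ℝ)]) n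

/-- The exponent is at least `(3/8) * (η L / 60) * n ≥ 2n`, which is the origin of the constant 320;
this beats `2 ^ n ≤ exp n`. -/
lemma two_pow_mul_exp_le {η P L : ℝ} {n m θ : ℕ} (hnL : (n : ℝ) = Real.exp L)
    (hη : 0 < η) (hP0 : 0 < P) (hPn' : L ≤ P * n) (hηL : 320 ≤ η * L)
    (hmθ : η * n ^ 2 / 60 ≤ m * θ) :
    2 ^ n * Real.exp (-((3 * P / 4) * (m * θ / 2))) ≤ L ^ 0 * Real.exp (-1 * L) := by
  have hnR : (0 : ℝ) < n := hnL ▸ Real.exp_pos L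
  have htwo := two_pow_le_exp n
  have hexpn := exp_neg_natCast_le hnL
  have hPnn : η * n * L ≤ P * (η * n ^ 2) := by
    have := mul_le_mul_of_nonneg_left hPn' (by positivity : 0 ≤ η * n)
    nlinarith
  have hηLn : 320 * (n : ℝ) ≤ η * n * L := by nlinarith
  refine le_trans ?_ hexpn
  calc _ ≤ Real.exp n * Real.exp (-(2 * n)) := by
        refine mul_le_mul htwo (Real.exp_le_exp.2 ?_) (by positivity) (by positivity)
        have h1 : P * (η * n ^ 2 / 60) ≤ P * (m * θ) := mul_le_mul_of_nonneg_left hmθ hP0.le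
        have h2 : (3 * P / 4) * (m * θ / 2) = 3 / 8 * (P * (m * θ)) := by ring
        rw [h2]
        linarith
    _ = _ := by rw [← Real.exp_add]; congr 1; ring

lemma natCast_mul_pow_le {P q L : ℝ} {n δ : ℕ} (hnL : (n : ℝ) = Real.exp L)
    (hL : 16 ≤ L) (hP0 : 0 < P) (hP1 : P ≤ 1) (hPn : P * n ≤ 4 * L) (hPδ : L ≤ P * δ) (hqP : q ≤ P) :
    n * q * (L⁻¹⁻¹ ^ 28 * (1 - 3 * P / 4 + 3 * P / 4 * L⁻¹) ^ δ) ≤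
      4 * Real.exp 1 * (L ^ 29 * Real.exp (-(3 / 4) * L)) := by
  have hL0 : 0 < L := by linarith
  have hnR : (0 : ℝ) < n := hnL ▸ Real.exp_pos L
  have hLinv : L * L⁻¹ = 1 := mul_inv_cancel₀ hL0.ne'
  have hlam0 : 0 < L⁻¹ := by positivity
  have hlam1 : L⁻¹ ≤ 1 := inv_le_one_of_one_le₀ (by linarith)
  have hb0 : 0 ≤ 1 - 3 * P / 4 + 3 * P / 4 * L⁻¹ := by
    have : 0 ≤ 3 * P / 4 * L⁻¹ := by positivity
    linarith
  have h1 : (1 - 3 * P / 4 + 3 * P / 4 * L⁻¹) ^ δ ≤ Real.exp (-(3 / 4 * L - 1)) := by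
    refine pow_le_exp_neg hP0.le hP1 hL0 ?_
    have h2 : (3 * P / 4) * (1 - L⁻¹) * δ = 3 / 4 * (1 - L⁻¹) * (P * δ) := by ring
    rw [h2]
    have h3 : 3 / 4 * (1 - L⁻¹) * L ≤ 3 / 4 * (1 - L⁻¹) * (P * δ) :=
      mul_le_mul_of_nonneg_left hPδ (by linarith)
    have h4 : 3 / 4 * (1 - L⁻¹) * L = 3 / 4 * L - 3 / 4 * (L * L⁻¹) := by ring
    rw [h4, hLinv] at h3
    linarith
  have h2 : n * q ≤ 4 * L := by nlinarith
  calc n * q * (L⁻¹⁻¹ ^ 28 * (1 - 3 * P / 4 + 3 * P / 4 * L⁻¹) ^ δ) ≤ 4 * L * (L ^ 28 * Real.exp (-(3 / 4 * L - 1))) := by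
        rw [inv_inv]; gcongr
    _ = _ := by
        rw [show -(3 / 4 * L - 1) = 1 + -(3 / 4) * L by ring, Real.exp_add]; ring

/-- The gain is `exp (-P η n² / 1200)` with `1200 = 8 * 150`, of order `exp (-Ω(n L))`. The losses
are `exp (3 n log L)`, `exp (4n)` and `exp (2n)`; with the target `exp (-n)` they add up to `n (3
log L + 7)`, as in `hlogL`. -/
lemma booster_term_le {η P a b q L : ℝ} {n k : ℕ} (hcard : Fintype.card V = n)
    (hnL : (n : ℝ) = Real.exp L) (hη : 0 < η) (hL : 16 ≤ L) (hP0 : 0 < P) (hP1 : P ≤ 1)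
    (hPn : P * n ≤ 4 * L) (hPn' : L ≤ P * n)
    (hlogL : 1200 * (3 * Real.log L + 7) ≤ η * L) (hq0 : 0 ≤ q) (hqP : q ≤ P)
    (ha8 : P / 8 ≤ a) (ha1 : a ≤ 1) (hb8 : P / 8 ≤ b) (hb1 : b ≤ 1) (hkn : η * n ^ 2 / 150 ≤ k) :
    L⁻¹⁻¹ ^ (3 * n) * (1 + L⁻¹ * q) ^ Γ.edgeFinset.card *
      (n * 2 ^ n * (1 - a) ^ k + (1 - b) ^ k) ≤ L ^ 0 * Real.exp (-1 * L) := by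
  have hL0 : 0 < L := by linarith
  have hnR : (0 : ℝ) < n := hnL ▸ Real.exp_pos L
  have htwo := two_pow_le_exp n
  have hexpn := exp_neg_natCast_le hnL
  have hPnn : η * n * L ≤ P * (η * n ^ 2) := by
    have := mul_le_mul_of_nonneg_left hPn' (by positivity : 0 ≤ η * n)
    nlinarith
  refine le_trans ?_ hexpn
  have h1 : L⁻¹⁻¹ ^ (3 * n) = Real.exp (3 * n * Real.log L) := by
    rw [inv_inv, show (3 : ℝ) * n * Real.log L = ((3 * n : ℕ) : ℝ) * Real.log L by push_cast; ring,
      Real.exp_nat_mul, Real.exp_log hL0]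
  have hE : (Γ.edgeFinset.card : ℝ) ≤ (n : ℝ) ^ 2 := by
    have h2 := Γ.card_edgeFinset_le_card_choose_two
    rw [hcard] at h2
    have h3 := h2.trans (Nat.choose_le_pow n 2)
    exact_mod_cast h3
  have h2 : (1 + L⁻¹ * q) ^ Γ.edgeFinset.card ≤ Real.exp (4 * n) := by
    calc (1 + L⁻¹ * q) ^ Γ.edgeFinset.card ≤ Real.exp (L⁻¹ * q) ^ Γ.edgeFinset.card := by
          have := Real.add_one_le_exp (L⁻¹ * q)
          exact pow_le_pow_left₀ (by positivity) (by linarith) _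
      _ = Real.exp (Γ.edgeFinset.card * (L⁻¹ * q)) := by rw [Real.exp_nat_mul]
      _ ≤ _ := by
          refine Real.exp_le_exp.2 ?_
          calc (Γ.edgeFinset.card : ℝ) * (L⁻¹ * q) ≤ (n : ℝ) ^ 2 * (L⁻¹ * P) := by gcongr
            _ = n * L⁻¹ * (P * n) := by ring
            _ ≤ n * L⁻¹ * (4 * L) := by gcongr
            _ = 4 * n := by field_simp
  have hak : ∀ y : ℝ, P / 8 ≤ y → y ≤ 1 → (1 - y) ^ k ≤ Real.exp (-(P / 8 * (η * n ^ 2 / 150))) := by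
    intro y hy hy1
    calc (1 - y) ^ k ≤ (1 - P / 8) ^ k := pow_le_pow_left₀ (by linarith) (by linarith) k
      _ ≤ _ := one_sub_pow_le_exp_of_le (by linarith) (by linarith) hkn
  have h3 : n * 2 ^ n * (1 - a) ^ k + (1 - b) ^ k ≤
      Real.exp (2 * n) * Real.exp (-(P / 8 * (η * n ^ 2 / 150))) := by
    have ea := hak a ha8 ha1
    have eb := hak b hb8 hb1
    have e1 : (1 : ℝ) ≤ 2 ^ n := one_le_pow₀ (by norm_num)
    have e2 : (n : ℝ) + 1 ≤ Real.exp n := Real.add_one_le_exp _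
    set X := Real.exp (-(P / 8 * (η * n ^ 2 / 150))) with hX
    have hX0 : 0 < X := Real.exp_pos _
    calc n * 2 ^ n * (1 - a) ^ k + (1 - b) ^ k ≤ n * 2 ^ n * X + 2 ^ n * X := by
          refine add_le_add (mul_le_mul_of_nonneg_left ea (by positivity)) (eb.trans ?_)
          exact le_mul_of_one_le_left hX0.le e1
      _ = (n + 1) * 2 ^ n * X := by ring
      _ ≤ Real.exp n * Real.exp n * X := by gcongr
      _ = _ := by rw [← Real.exp_add]; congr 2; ring
  calc _ ≤ Real.exp (3 * n * Real.log L) * Real.exp (4 * n) *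
        (Real.exp (2 * n) * Real.exp (-(P / 8 * (η * n ^ 2 / 150)))) := by
        rw [h1]
        refine mul_le_mul (mul_le_mul_of_nonneg_left h2 (by positivity)) h3 ?_ (by positivity)
        have : 0 ≤ 1 - b := by linarith
        positivity
    _ ≤ Real.exp (-n) := by
        rw [← Real.exp_add, ← Real.exp_add, ← Real.exp_add]
        refine Real.exp_le_exp.2 ?_
        have h5 := mul_le_mul_of_nonneg_left hlogL hnR.le
        nlinarith

lemma exists_sprinkling_params {P : ℝ} (hP0 : 0 < P) (hP1 : P < 1) :
    ∃ b q : ℝ, P / 8 ≤ b ∧ b ≤ 1 ∧ q = P / 8 + b - P / 8 * b ∧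
      P = 3 * P / 4 + q - 3 * P / 4 * q ∧ 0 ≤ q ∧ q ≤ P := by
  have h0 : 0 < (1 - 3 * P / 4) * (1 - P / 8) := mul_pos (by linarith) (by linarith)
  -- `x` is `1 - b`, determined by requiring the three rounds to miss an edge with total probability
  -- `1 - P`. Then `b ≥ P / 8` because `(1 - 3P/4)(1 - P/8)² ≥ 1 - P`.
  obtain ⟨x, hx⟩ : ∃ x, x = (1 - P) / ((1 - 3 * P / 4) * (1 - P / 8)) := ⟨_, rfl⟩
  have hx1 : x * ((1 - 3 * P / 4) * (1 - P / 8)) = 1 - P := by rw [hx, div_mul_cancel₀ _ h0.ne']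
  have hx0 : 0 ≤ x := by rw [hx]; exact div_nonneg (by linarith) h0.le
  have hx8 : x ≤ 1 - P / 8 := by
    rw [hx, div_le_iff₀ h0]
    have h1 : (1 - P / 8) * (1 - P / 8) ≥ 1 - P / 4 := by nlinarith
    have h2 : 0 ≤ 1 - 3 * P / 4 := by linarith
    nlinarith [mul_le_mul_of_nonneg_left h1 h2]
  have hq : P = 3 * P / 4 + (P / 8 + (1 - x) - P / 8 * (1 - x)) -
      3 * P / 4 * (P / 8 + (1 - x) - P / 8 * (1 - x)) := by linear_combination hx1
  refine ⟨1 - x, P / 8 + (1 - x) - P / 8 * (1 - x), by linarith, by linarith, rfl, hq, ?_, ?_⟩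
  · nlinarith
  · obtain ⟨q, hq'⟩ : ∃ q, q = P / 8 + (1 - x) - P / 8 * (1 - x) := ⟨_, rfl⟩
    rw [← hq'] at hq ⊢
    have h3 : 0 ≤ q := by
      by_contra! h; nlinarith
    nlinarith

/-- `m = ⌊n / 28⌋` is the range of expansion, `θ = ⌊η n⌋` the excess of degrees over `n / 2`, `s₀ =
⌈n / L³⌉` the start of the medium range, and `k` what remains of `m θ / 2` once the `3n` extension
edges are removed. -/
lemma exists_size_params {η L : ℝ} {n : ℕ} (hη : 0 < η) (hL0 : 0 < L) (hnR : (0 : ℝ) < n)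
    (hn420 : (420 : ℝ) ≤ n) (hηn : 2400 ≤ η * n) (hL3 : L ^ 3 ≤ n) :
    ∃ m θ k s₀ : ℕ, 28 * m ≤ n ∧ (θ : ℝ) ≤ η * n ∧ η * n ^ 2 / 60 ≤ m * θ ∧
      2 * (k + 3 * n) ≤ m * θ ∧ η * n ^ 2 / 150 ≤ k ∧ (n : ℝ) / L ^ 3 ≤ s₀ ∧
      (s₀ : ℝ) ≤ 2 * n / L ^ 3 := by
  obtain ⟨m, hm⟩ : ∃ x, x = n / 28 := ⟨_, rfl⟩
  obtain ⟨θ, hθ⟩ : ∃ x, x = ⌊η * n⌋₊ := ⟨_, rfl⟩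
  obtain ⟨k, hk⟩ : ∃ x, x = m * θ / 2 - 3 * n := ⟨_, rfl⟩
  obtain ⟨s₀, hs₀⟩ : ∃ x, x = ⌈(n : ℝ) / L ^ 3⌉₊ := ⟨_, rfl⟩
  have hmn : (n : ℝ) / 30 ≤ m := by
    have h1 : n < 28 * (m + 1) := by omega
    have h2 : (n : ℝ) < 28 * (m + 1) := by exact_mod_cast h1
    linarith
  have hθn : η * n / 2 ≤ θ := by
    have := Nat.lt_floor_add_one (η * n)
    rw [← hθ] at this
    linarith
  have hmθ : η * n ^ 2 / 60 ≤ m * θ := by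
    have := mul_le_mul hmn hθn (by positivity) (by positivity)
    calc η * n ^ 2 / 60 = n / 30 * (η * n / 2) := by ring
      _ ≤ _ := this
  have hbig : 2400 * (n : ℝ) ≤ η * n ^ 2 := by nlinarith
  have hk2 : 3 * n ≤ m * θ / 2 := by
    rw [Nat.le_div_iff_mul_le (by norm_num)]
    have : ((3 * n * 2 : ℕ) : ℝ) ≤ ((m * θ : ℕ) : ℝ) := by
      push_cast; linarith
    exact_mod_cast this
  have hkn : η * n ^ 2 / 150 ≤ k := by
    have h1 : m * θ < 2 * (k + 3 * n + 1) := by omega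
    have h2 : (m : ℝ) * θ < 2 * (k + 3 * n + 1) := by exact_mod_cast h1
    linarith
  have hs1 : (n : ℝ) / L ^ 3 ≤ s₀ := hs₀ ▸ Nat.le_ceil _
  have hs2 : (s₀ : ℝ) ≤ 2 * n / L ^ 3 := by
    have h1 := Nat.ceil_lt_add_one (a := (n : ℝ) / L ^ 3) (by positivity)
    rw [← hs₀] at h1
    have h2 : 1 ≤ (n : ℝ) / L ^ 3 := by rw [le_div_iff₀ (by positivity)]; linarith
    have h3 : 2 * n / L ^ 3 = n / L ^ 3 + n / L ^ 3 := by ring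
    linarith
  exact ⟨m, θ, k, s₀, by omega, hθ ▸ Nat.floor_le (by positivity), hmθ, by omega, hkn, hs1, hs2⟩

lemma bprob_not_isHamiltonian_le_errorTerm {η P L : ℝ} {n δ : ℕ} (hcard : Fintype.card V = n)
    (hη : 0 < η) (hδ : ∀ v, δ ≤ Γ.degree v) (hδη : (1 / 2 + η) * n ≤ δ)
    (hLn : Real.exp L = n) (hP : P ≤ 4 * L / n) (hPδ : L ≤ P * δ)
    (hL : 16 ≤ L) (hL21 : L ^ 21 * Real.exp 3 ≤ Real.exp (3 / 16 * L)) (hηL : 320 ≤ η * L)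
    (hlogL : 1200 * (3 * Real.log L + 7) ≤ η * L) (hηn : 2400 ≤ η * n) (hn : 420 ≤ n)
    (hL3 : L ^ 3 ≤ n) (h4L : 4 * L < n) (hrL : 224 * Real.exp 2 ≤ L / 2) :
    bprob Γ.edgeFinset P (fun S => (∀ v, 2 ≤ (S.filter (v ∈ ·)).card) ∧
      ¬ (edgeGraph S).IsHamiltonian) ≤ errorTerm L := by
  have hL0 : 0 < L := by linarith
  have hnR : (0 : ℝ) < n := by exact_mod_cast (by omega : 0 < n)
  have hn420 : (420 : ℝ) ≤ n := by exact_mod_cast hn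
  have : Nonempty V := Fintype.card_pos_iff.1 (by omega)
  have hδn : (δ : ℝ) ≤ n := by
    obtain ⟨v⟩ := ‹Nonempty V›
    rw [← hcard]
    exact_mod_cast (hδ v).trans (Γ.degree_lt_card_verts v).le
  have hδ0 : (0 : ℝ) < δ := lt_of_lt_of_le (by positivity) hδη
  have hP0 : 0 < P := by
    by_contra! h
    nlinarith
  have hP1 : P < 1 := lt_of_le_of_lt hP (by rw [div_lt_one hnR]; exact h4L)
  have hPn : P * n ≤ 4 * L := by rwa [le_div_iff₀ hnR] at hP
  have hPn' : L ≤ P * n := hPδ.trans (mul_le_mul_of_nonneg_left hδn hP0.le)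
  obtain ⟨b, q, hb8, hb1, hq, hPq, hq0, hqP⟩ := exists_sprinkling_params hP0 hP1
  have hb0 : 0 ≤ b := by linarith
  obtain ⟨m, θ, k, s₀, hm28, hθη, hmθ, hk2, hkn, hs1, hs2⟩ :=
    exists_size_params hη hL0 hnR hn420 hηn hL3
  have hlam0 : 0 < L⁻¹ := by positivity
  have hlam1 : L⁻¹ ≤ 1 := inv_le_one_of_one_le₀ (by linarith)
  have hexp2 : 0 < Real.exp 2 := Real.exp_pos _
  -- The value of `r` comes from `s₀ ≤ 2n / L³` and `P ≤ 4L / n`: `7 * 2 * 4² = 224`.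
  have key := bprob_not_isHamiltonian_le (Γ := Γ) (V := V) (by omega) (p₁ := 3 * P / 4)
    (a := P / 8) (b := b) (q := q) (P := P) (lam := L⁻¹) (μ := (L ^ 3)⁻¹) (r := 224 * Real.exp 2 * L⁻¹) (δ := δ) (θ := θ)
    (m := m) (s₀ := s₀) (k := k) (by positivity) (by linarith) (by positivity) (by linarith) hb0 hb1
    hq hPq hP0 hδ (fun v => by
      rw [hcard]
      have h1 := hθη
      have h2 : (n : ℝ) + 2 * θ ≤ 2 * δ := by linarith
      have h3 : n + 2 * θ ≤ 2 * δ := by exact_mod_cast h2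
      have := hδ v
      omega)
    (by
      have h1 : (n : ℝ) ≤ 2 * δ := by nlinarith
      have h2 : n ≤ 2 * δ := by exact_mod_cast h1
      omega)
    (by rw [hcard]; exact hk2) hlam0 hlam1 (by positivity)
    (inv_le_one_of_one_le₀ (one_le_pow₀ (by linarith)))
    (by
      push_cast
      calc P * (7 * (s₀ : ℝ)) ≤ 4 * L / n * (7 * (2 * n / L ^ 3)) := by gcongr
        _ = 56 / L ^ 2 := by field_simp; norm_num
        _ ≤ 1 := by rw [div_le_one (by positivity)]; nlinarith)
    (by
      rw [hcard]
      push_cast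
      calc Real.exp 2 * n * (7 * (s₀ : ℝ)) * P ^ 2
          ≤ Real.exp 2 * n * (7 * (2 * n / L ^ 3)) * (4 * L / n) ^ 2 := by gcongr
        _ = _ := by field_simp; norm_num)
    (by
      rw [← div_eq_mul_inv, div_le_iff₀ hL0]; linarith)
  rw [hcard] at key
  refine key.trans ?_
  have hnL := hLn.symm
  have t1 := sum_smallPair_le hnL hL hP0 hP1.le hPn hPδ
  have t2 := pow_mul_pow_le hnL hP0 hPn
  have t4 := exp_mid_le hnL hL hPδ hL21 hs1
  have t5 := two_pow_mul_exp_le hnL hη hP0 hPn' hηL hmθ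
  have t6 := natCast_mul_pow_le hnL hL hP0 hP1.le hPn hPδ hqP
  have t7 := booster_term_le (Γ := Γ) hcard hnL hη hL hP0 hP1.le hPn hPn' hlogL hq0 hqP le_rfl
    (by linarith) hb8 hb1 hkn
  unfold errorTerm
  linarith

/-- With high probability, a random subgraph of a dense graph whose minimum degree is at least two
is Hamiltonian. -/
theorem eventually_bprob_not_isHamiltonian_le {η : ℝ} (hη : 0 < η) {κ : ℝ} (hκ : 0 < κ) :
    ∀ᶠ n : ℕ in atTop, ∀ (V : Type*) [Fintype V] [DecidableEq V] (Γ : SimpleGraph V)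
      [DecidableRel Γ.Adj] (δ : ℕ) (P : ℝ), Fintype.card V = n → (∀ v, δ ≤ Γ.degree v) →
      (1 / 2 + η) * n ≤ δ → P ≤ 4 * Real.log n / n → Real.log n ≤ P * δ →
      bprob Γ.edgeFinset P (fun S => (∀ v, 2 ≤ (S.filter (v ∈ ·)).card) ∧
        ¬ (edgeGraph S).IsHamiltonian) ≤ κ := by
  have hlog : Tendsto (fun n : ℕ => Real.log n) atTop atTop :=
    Real.tendsto_log_atTop.comp tendsto_natCast_atTop_atTop
  have hnat : Tendsto (fun n : ℕ => (n : ℝ)) atTop atTop := tendsto_natCast_atTop_atTop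
  have e21 : ∀ᶠ L : ℝ in atTop, L ^ 21 * Real.exp 3 ≤ Real.exp (3 / 16 * L) := by
    have h := (tendsto_pow_mul_exp_neg_mul 21 (b := 3 / 16) (by norm_num)).eventually
      (gt_mem_nhds (Real.exp_pos (-3)))
    filter_upwards [h] with L hL
    have h1 : L ^ 21 * Real.exp 3 =
        (L ^ 21 * Real.exp (-(3 / 16) * L)) * (Real.exp 3 * Real.exp (3 / 16 * L)) := by
      rw [show L ^ 21 * Real.exp (-(3 / 16) * L) * (Real.exp 3 * Real.exp (3 / 16 * L)) =
        L ^ 21 * Real.exp 3 * (Real.exp (-(3 / 16) * L) * Real.exp (3 / 16 * L)) by ring,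
        ← Real.exp_add]
      simp
    rw [h1]
    calc _ ≤ Real.exp (-3) * (Real.exp 3 * Real.exp (3 / 16 * L)) :=
          mul_le_mul_of_nonneg_right hL.le (by positivity)
      _ = _ := by rw [← mul_assoc, ← Real.exp_add]; simp
  have elog : ∀ᶠ L : ℝ in atTop, 1200 * (3 * Real.log L + 7) ≤ η * L := by
    have h := Real.isLittleO_log_id_atTop.def (c := η / 7200) (by positivity)
    filter_upwards [h, eventually_ge_atTop 1, eventually_ge_atTop (16800 / η)] with L h1 h2 h3
    have h4 : 0 ≤ Real.log L := Real.log_nonneg h2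
    rw [Real.norm_of_nonneg h4, id, Real.norm_of_nonneg (by linarith)] at h1
    rw [div_le_iff₀ hη] at h3
    linarith
  have e3 : ∀ᶠ L : ℝ in atTop, L ^ 3 ≤ Real.exp L := by
    have h := (tendsto_pow_mul_exp_neg_mul 3 (b := 1) (by norm_num)).eventually
      (gt_mem_nhds one_pos)
    filter_upwards [h] with L hL
    rw [neg_one_mul, Real.exp_neg, ← div_eq_mul_inv, div_lt_one (Real.exp_pos _)] at hL
    exact hL.le
  have e4 : ∀ᶠ L : ℝ in atTop, 320 ≤ η * L := (tendsto_id.const_mul_atTop hη).eventually_ge_atTop 320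
  filter_upwards [hlog.eventually e21, hlog.eventually elog, hlog.eventually e3, hlog.eventually e4,
    hlog.eventually (eventually_ge_atTop 16), hlog.eventually (eventually_ge_atTop
      (448 * Real.exp 2)), (hnat.const_mul_atTop hη).eventually_ge_atTop 2400,
    eventually_ge_atTop 420,
    hlog.eventually (tendsto_errorTerm.eventually (gt_mem_nhds hκ))] with n f1 f2 f3 f4 f5 f6 f7 f8 f9
  intro V _ _ Γ _ δ P hcard hδ hδη hP hPδ
  have hexp : Real.exp (Real.log n) = n := Real.exp_log (by exact_mod_cast (by omega : 0 < n))
  rw [hexp] at f3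
  refine (bprob_not_isHamiltonian_le_errorTerm hcard hη hδ hδη hexp hP hPδ f5 f1 f4 f2 f7 f8 f3 ?_
    (by linarith)).trans f9.le
  nlinarith [sq_nonneg (Real.log n)]

end Asymptotics

/-! ### Vertices of degree at most one: Poisson approximation -/

section Bonferroni

/-- For `X > 0`, the alternating sum of the first `N ≥ 1` binomial coefficients telescopes to `(-1)
^ (N - 1) * (X - 1).choose (N - 1)`, so its sign alternates with `N`. -/
lemma sum_range_neg_one_pow_mul_choose_le (X m : ℕ) :
    ∑ k ∈ Finset.range (2 * m), (-1 : ℝ) ^ k * (X.choose k) ≤ if X = 0 then 1 else 0 := by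
  rcases m with _ | m
  · simp only [mul_zero, Finset.range_zero, Finset.sum_empty]
    split_ifs <;> norm_num
  rcases X with _ | X
  · rw [Finset.sum_eq_single 0 (fun k _ hk => by simp [Nat.choose_eq_zero_of_lt
      (Nat.pos_of_ne_zero hk)]) (by simp)]
    simp
  · have h := Int.alternating_sum_range_choose_eq_choose (n := X) (m := 2 * m + 1)
    have h' : ∑ k ∈ Finset.range (2 * (m + 1)), (-1 : ℝ) ^ k * ((X + 1).choose k) =
        (-1) ^ (2 * m + 1) * X.choose (2 * m + 1) := by exact_mod_cast h
    rw [h', pow_succ, pow_mul]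
    simp

lemma le_sum_range_neg_one_pow_mul_choose (X m : ℕ) :
    (if X = 0 then 1 else 0) ≤ ∑ k ∈ Finset.range (2 * m + 1), (-1 : ℝ) ^ k * (X.choose k) := by
  rcases X with _ | X
  · rw [Finset.sum_eq_single 0 (fun k _ hk => by simp [Nat.choose_eq_zero_of_lt
      (Nat.pos_of_ne_zero hk)]) (by simp)]
    simp
  · have h := Int.alternating_sum_range_choose_eq_choose (n := X) (m := 2 * m)
    have h' : ∑ k ∈ Finset.range (2 * m + 1), (-1 : ℝ) ^ k * ((X + 1).choose k) =
        (-1) ^ (2 * m) * X.choose (2 * m) := by exact_mod_cast h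
    rw [h', pow_mul]
    simp

/-- Convergence of the factorial moments to those of a Poisson variable, together with the
Bonferroni inequalities, yields convergence of the probability of the value zero. -/
lemma tendsto_exp_neg_of_bonferroni {P : ℕ → ℝ} {e : ℕ → ℕ → ℝ} {lam : ℝ}
    (hlow : ∀ i m, ∑ k ∈ Finset.range (2 * m), (-1 : ℝ) ^ k * e k i ≤ P i)
    (hup : ∀ i m, P i ≤ ∑ k ∈ Finset.range (2 * m + 1), (-1 : ℝ) ^ k * e k i)
    (he : ∀ k, Tendsto (e k) atTop (𝓝 (lam ^ k / k.factorial))) :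
    Tendsto P atTop (𝓝 (Real.exp (-lam))) := by
  have hsum : Tendsto (fun N => ∑ k ∈ Finset.range N, (-1 : ℝ) ^ k * (lam ^ k / k.factorial)) atTop
      (𝓝 (Real.exp (-lam))) := by
    have h := (NormedSpace.expSeries_div_hasSum_exp (-lam)).tendsto_sum_nat
    rw [← Real.exp_eq_exp_ℝ] at h
    refine h.congr fun N => Finset.sum_congr rfl fun k _ => ?_
    rw [neg_pow, mul_div_assoc]
  have hlim : ∀ N, Tendsto (fun i => ∑ k ∈ Finset.range N, (-1 : ℝ) ^ k * e k i) atTop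
      (𝓝 (∑ k ∈ Finset.range N, (-1 : ℝ) ^ k * (lam ^ k / k.factorial))) :=
    fun N => tendsto_finsetSum _ fun k _ => (he k).const_mul _
  have h2 : Tendsto (fun m : ℕ => 2 * m) atTop atTop :=
    tendsto_atTop_mono (fun m => by simp only [id]; omega) tendsto_id
  have h21 : Tendsto (fun m : ℕ => 2 * m + 1) atTop atTop := tendsto_atTop_mono (fun m => by omega) h2
  -- The order of limits matters: first fix a truncation of the exponential series on the right side
  -- of `x`, then let `i` grow with that truncation fixed.
  refine tendsto_order.2 ⟨fun x hx => ?_, fun x hx => ?_⟩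
  · obtain ⟨m, hm⟩ := ((hsum.comp h2).eventually (lt_mem_nhds hx)).exists
    filter_upwards [(hlim (2 * m)).eventually (lt_mem_nhds hm)] with i hi
    exact hi.trans_le (hlow i m)
  · obtain ⟨m, hm⟩ := ((hsum.comp h21).eventually (gt_mem_nhds hx)).exists
    filter_upwards [(hlim (2 * m + 1)).eventually (gt_mem_nhds hm)] with i hi
    exact (hup i m).trans_lt hi

end Bonferroni

/-! ### ### Binomial moments of the number of low-degree vertices -/

section LowDegree

variable {V : Type*} [Fintype V] [DecidableEq V] (Γ : SimpleGraph V) [DecidableRel Γ.Adj]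

lemma bprob_card_le_one_le {ι : Type*} [DecidableEq ι] {A : Finset ι} {p : ℝ} {a b : ℕ}
    (hp0 : 0 ≤ p) (hp1 : p ≤ 1) (ha : a ≤ A.card) (hb : A.card ≤ b) :
    bprob A p (fun S => S.card ≤ 1) ≤ (1 - p) ^ (a - 1) * (1 + b * p) := by
  rw [bprob_card_le_one]
  have h1 : 0 ≤ 1 - p := by linarith
  have h2 : 1 - p ≤ 1 := by linarith
  have hb' : (A.card : ℝ) ≤ b := by exact_mod_cast hb
  calc (1 - p) ^ A.card + A.card * p * (1 - p) ^ (A.card - 1)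
      ≤ (1 - p) ^ (a - 1) + b * p * (1 - p) ^ (a - 1) := by
        refine add_le_add (pow_le_pow_of_le_one h1 h2 (by omega)) ?_
        exact mul_le_mul (by gcongr) (pow_le_pow_of_le_one h1 h2 (by omega)) (by positivity)
          (by positivity)
    _ = _ := by ring

lemma le_bprob_card_le_one {ι : Type*} [DecidableEq ι] {A : Finset ι} {p : ℝ} {a b : ℕ}
    (hp0 : 0 ≤ p) (hp1 : p ≤ 1) (ha : a ≤ A.card) (hb : A.card ≤ b) :
    (1 - p) ^ b * (1 + a * p) ≤ bprob A p (fun S => S.card ≤ 1) := by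
  rw [bprob_card_le_one]
  have h1 : 0 ≤ 1 - p := by linarith
  have h2 : 1 - p ≤ 1 := by linarith
  have ha' : (a : ℝ) ≤ A.card := by exact_mod_cast ha
  calc (1 - p) ^ b * (1 + a * p) = (1 - p) ^ b + a * p * (1 - p) ^ b := by ring
    _ ≤ _ := by
        refine add_le_add (pow_le_pow_of_le_one h1 h2 hb) ?_
        exact mul_le_mul (by gcongr) (pow_le_pow_of_le_one h1 h2 (by omega)) (by positivity)
          (by positivity)

/-- The edges of `Γ` inside the vertex set `K`. -/
def innerEdges (K : Finset V) : Finset (Sym2 V) := Γ.edgeFinset.filter (· ∈ K.sym2)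

/-- The edges of `Γ` at the vertex `v` that are not inside `K`. -/
def outerEdges (K : Finset V) (v : V) : Finset (Sym2 V) :=
  Γ.edgeFinset.filter (v ∈ ·) \ innerEdges Γ K

lemma card_innerEdges_le (K : Finset V) : (innerEdges Γ K).card ≤ K.card ^ 2 := by
  have h : (innerEdges Γ K).card ≤ ((K ×ˢ K).image fun x => s(x.1, x.2)).card := by
    refine Finset.card_le_card fun e he => ?_
    have he := (Finset.mem_filter.1 he).2
    induction e with | _ a b =>
    rw [Finset.mk_mem_sym2_iff] at he
    exact Finset.mem_image.2 ⟨(a, b), Finset.mem_product.2 he, rfl⟩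
  refine h.trans (Finset.card_image_le.trans ?_)
  rw [Finset.card_product, sq]

lemma card_outerEdges_le (K : Finset V) (v : V) : (outerEdges Γ K v).card ≤ Γ.degree v := by
  rw [← card_edgeFinset_filter_mem]
  exact Finset.card_le_card Finset.sdiff_subset

lemma degree_le_card_outerEdges (K : Finset V) (v : V) :
    Γ.degree v ≤ (outerEdges Γ K v).card + K.card := by
  have h1 : Γ.edgeFinset.filter (v ∈ ·) ⊆ outerEdges Γ K v ∪ K.image fun w => s(v, w) := by
    intro e he
    by_cases h : e ∈ innerEdges Γ K
    · refine Finset.mem_union_right _ ?_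
      have h2 := (Finset.mem_filter.1 h).2
      obtain ⟨w, rfl⟩ := (Finset.mem_filter.1 he).2
      rw [Finset.mk_mem_sym2_iff] at h2
      exact Finset.mem_image.2 ⟨w, h2.2, rfl⟩
    · exact Finset.mem_union_left _ (Finset.mem_sdiff.2 ⟨he, h⟩)
  rw [← card_edgeFinset_filter_mem]
  exact (Finset.card_le_card h1).trans
    ((Finset.card_union_le _ _).trans (Nat.add_le_add_left Finset.card_image_le _))

/-- An edge shared by two stars centred in `K` lies inside `K`. Removing the inner edges therefore
makes the stars independent. -/
lemma pairwiseDisjoint_outerEdges (K : Finset V) :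
    (K : Set V).PairwiseDisjoint (outerEdges Γ K) := by
  intro v hv w hw hvw
  refine Finset.disjoint_left.2 fun e he he' => ?_
  obtain ⟨h1, h2⟩ := Finset.mem_sdiff.1 he
  have h3 := (Finset.mem_filter.1 (Finset.mem_sdiff.1 he').1).2
  obtain ⟨h4, h5⟩ := Finset.mem_filter.1 h1
  obtain rfl := (Sym2.mem_and_mem_iff hvw).1 ⟨h5, h3⟩
  exact h2 (Finset.mem_filter.2 ⟨h4, Finset.mk_mem_sym2_iff.2 ⟨hv, hw⟩⟩)

lemma bprob_forall_inter {ι κ : Type*} [DecidableEq ι] {E : Finset ι} (K : Finset κ)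
    (A : κ → Finset ι) (hA : ∀ k ∈ K, A k ⊆ E) (hdis : (K : Set κ).PairwiseDisjoint A) (p : ℝ)
    (Q : Finset ι → Prop) :
    bprob E p (fun S => ∀ k ∈ K, Q (S ∩ A k)) = ∏ k ∈ K, bprob (A k) p Q := by
  classical
  unfold bprob
  rw [← bexp_prod_inter K A hA hdis p]
  refine bexp_congr fun S _ => ?_
  rw [Finset.prod_ite_zero]
  simp

lemma bprob_inter_and {ι : Type*} [DecidableEq ι] {A B : Finset ι} (h : Disjoint A B) (p : ℝ)
    (Q Q' : Finset ι → Prop) : bprob (A ∪ B) p (fun S => Q (S ∩ A) ∧ Q' (S ∩ B)) =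
      bprob A p Q * bprob B p Q' := by
  classical
  unfold bprob
  rw [← bexp_union_mul h]
  refine bexp_congr fun S _ => ?_
  by_cases h1 : Q (S ∩ A) <;> by_cases h2 : Q' (S ∩ B) <;> simp [h1, h2]

variable {Γ}

/-- Ignoring the inner edges only weakens the event and leaves independent blocks of size between `d
- k` and `d`. -/
lemma bprob_forall_low_le {K : Finset V} {p : ℝ} {d k : ℕ} (hp0 : 0 ≤ p) (hp1 : p ≤ 1)
    (hK : K.card = k) (hd : ∀ v ∈ K, Γ.degree v = d) :
    bprob Γ.edgeFinset p (fun S => ∀ v ∈ K, (S.filter (v ∈ ·)).card ≤ 1) ≤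
      ((1 - p) ^ (d - k - 1) * (1 + d * p)) ^ k := by
  calc _ ≤ bprob Γ.edgeFinset p (fun S => ∀ v ∈ K, (S ∩ outerEdges Γ K v).card ≤ 1) := by
        refine bprob_mono hp0 hp1 fun S _ h v hv => (Finset.card_le_card fun e he => ?_).trans (h v hv)
        rw [Finset.mem_inter, outerEdges, Finset.mem_sdiff, Finset.mem_filter] at he
        exact Finset.mem_filter.2 ⟨he.1, he.2.1.2⟩
    _ = ∏ v ∈ K, bprob (outerEdges Γ K v) p (fun S => S.card ≤ 1) :=
        bprob_forall_inter K (outerEdges Γ K)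
          (fun v _ => Finset.sdiff_subset.trans (Finset.filter_subset _ _))
          (pairwiseDisjoint_outerEdges Γ K) p (fun S => S.card ≤ 1)
    _ ≤ ∏ v ∈ K, ((1 - p) ^ (d - k - 1) * (1 + d * p)) := by
        refine Finset.prod_le_prod (fun v _ => bprob_nonneg hp0 hp1 _) fun v hv => ?_
        have h1 := degree_le_card_outerEdges Γ K v
        have h2 := card_outerEdges_le Γ K v
        rw [hd v hv] at h1 h2
        exact bprob_card_le_one_le hp0 hp1 (by omega) h2
    _ = _ := by rw [Finset.prod_const, hK]

/-- Demand in addition that no inner edge is retained. This costs a factor at least `(1 - p) ^ (k ^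
2)`, negligible for fixed `k`, and the outer blocks are independent of it. -/
lemma le_bprob_forall_low {K : Finset V} {p : ℝ} {d k : ℕ} (hp0 : 0 ≤ p) (hp1 : p ≤ 1)
    (hK : K.card = k) (hd : ∀ v ∈ K, Γ.degree v = d) :
    (1 - p) ^ (k ^ 2) * ((1 - p) ^ d * (1 + (d - k : ℕ) * p)) ^ k ≤
      bprob Γ.edgeFinset p (fun S => ∀ v ∈ K, (S.filter (v ∈ ·)).card ≤ 1) := by
  classical
  have h1p : 0 ≤ 1 - p := by linarith
  have hI : innerEdges Γ K ⊆ Γ.edgeFinset := Finset.filter_subset _ _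
  have hO : ∀ v, outerEdges Γ K v ⊆ Γ.edgeFinset \ innerEdges Γ K := fun v =>
    Finset.sdiff_subset_sdiff (Finset.filter_subset _ _) subset_rfl
  calc (1 - p) ^ (k ^ 2) * ((1 - p) ^ d * (1 + (d - k : ℕ) * p)) ^ k
      ≤ (1 - p) ^ (innerEdges Γ K).card *
        ∏ v ∈ K, bprob (outerEdges Γ K v) p (fun S => S.card ≤ 1) := by
        refine mul_le_mul (pow_le_pow_of_le_one h1p (by linarith) (hK ▸ card_innerEdges_le Γ K)) ?_
          (by positivity) (by positivity)
        rw [← hK, ← Finset.prod_const, hK]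
        refine Finset.prod_le_prod (fun v _ => by positivity) fun v hv => ?_
        have h1 := degree_le_card_outerEdges Γ K v
        have h2 := card_outerEdges_le Γ K v
        rw [hd v hv] at h1 h2
        exact le_bprob_card_le_one hp0 hp1 (by omega) h2
    _ = bprob (innerEdges Γ K) p (fun S => Disjoint (innerEdges Γ K) S) *
        bprob (Γ.edgeFinset \ innerEdges Γ K) p
          (fun S => ∀ v ∈ K, (S ∩ outerEdges Γ K v).card ≤ 1) := by
        rw [bprob_disjoint subset_rfl, bprob_forall_inter K (outerEdges Γ K)
          (fun v _ => hO v) (pairwiseDisjoint_outerEdges Γ K) p (fun S => S.card ≤ 1)]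
    _ = bprob Γ.edgeFinset p (fun S => Disjoint (innerEdges Γ K) (S ∩ innerEdges Γ K) ∧
          ∀ v ∈ K, (S ∩ (Γ.edgeFinset \ innerEdges Γ K) ∩ outerEdges Γ K v).card ≤ 1) := by
        have h := bprob_inter_and (Finset.disjoint_sdiff (s := innerEdges Γ K) (t := Γ.edgeFinset)) p
          (fun S => Disjoint (innerEdges Γ K) S)
          (fun S => ∀ v ∈ K, (S ∩ outerEdges Γ K v).card ≤ 1)
        rw [Finset.union_sdiff_of_subset hI] at h
        exact h.symm
    _ ≤ _ := by
        refine bprob_mono hp0 hp1 fun S hS h v hv => (Finset.card_le_card fun e he => ?_).trans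
          (h.2 v hv)
        obtain ⟨he1, he2⟩ := Finset.mem_filter.1 he
        have h3 : e ∉ innerEdges Γ K := fun h4 =>
          Finset.disjoint_left.1 h.1 h4 (Finset.mem_inter.2 ⟨he1, h4⟩)
        have h5 := hS he1
        exact Finset.mem_inter.2 ⟨Finset.mem_inter.2 ⟨he1, Finset.mem_sdiff.2 ⟨h5, h3⟩⟩,
          Finset.mem_sdiff.2 ⟨Finset.mem_filter.2 ⟨h5, he2⟩, h3⟩⟩

variable (Γ) in
/-- The `k`-th binomial moment of the number of vertices in `M` of degree at most one. -/
noncomputable def lowMoment (M : Finset V) (p : ℝ) (k : ℕ) : ℝ :=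
  bexp Γ.edgeFinset p
    (fun S => ((M.filter fun v => (S.filter (v ∈ ·)).card ≤ 1).card.choose k : ℝ))

/-- `X.choose k` counts the `k`-subsets all of whose vertices are low. -/
lemma lowMoment_eq_sum (M : Finset V) (p : ℝ) (k : ℕ) :
    lowMoment Γ M p k = ∑ K ∈ M.powersetCard k,
      bprob Γ.edgeFinset p (fun S => ∀ v ∈ K, (S.filter (v ∈ ·)).card ≤ 1) := by
  classical
  unfold lowMoment bprob
  rw [← bexp_sum]
  refine bexp_congr fun S _ => ?_
  calc ((M.filter fun v => (S.filter (v ∈ ·)).card ≤ 1).card.choose k : ℝ)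
      = ((M.powersetCard k).filter fun K => ∀ v ∈ K, (S.filter (v ∈ ·)).card ≤ 1).card := by
        rw [← Finset.card_powersetCard]
        congr 2
        ext K
        simp only [Finset.mem_powersetCard, Finset.mem_filter, Finset.subset_iff]
        constructor
        · exact fun ⟨h1, h2⟩ => ⟨⟨fun v hv => (h1 hv).1, h2⟩, fun v hv => (h1 hv).2⟩
        · exact fun ⟨⟨h1, h2⟩, h3⟩ => ⟨fun v hv => ⟨h1 hv, h3 v hv⟩, h2⟩
    _ = ∑ K ∈ M.powersetCard k, if ∀ v ∈ K, (S.filter (v ∈ ·)).card ≤ 1 then 1 else 0 := by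
        rw [Finset.sum_boole]
    _ = _ := Finset.sum_congr rfl fun K _ => by congr

lemma lowMoment_le {M : Finset V} {p : ℝ} {d : ℕ} (hp0 : 0 ≤ p) (hp1 : p ≤ 1)
    (hd : ∀ v ∈ M, Γ.degree v = d) (k : ℕ) :
    lowMoment Γ M p k ≤ M.card.choose k * ((1 - p) ^ (d - k - 1) * (1 + d * p)) ^ k := by
  rw [lowMoment_eq_sum, ← Finset.card_powersetCard, ← nsmul_eq_mul]
  refine Finset.sum_le_card_nsmul _ _ _ fun K hK => ?_
  obtain ⟨h1, h2⟩ := Finset.mem_powersetCard.1 hK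
  exact bprob_forall_low_le hp0 hp1 h2 fun v hv => hd v (h1 hv)

lemma le_lowMoment {M : Finset V} {p : ℝ} {d : ℕ} (hp0 : 0 ≤ p) (hp1 : p ≤ 1)
    (hd : ∀ v ∈ M, Γ.degree v = d) (k : ℕ) :
    M.card.choose k * ((1 - p) ^ (k ^ 2) * ((1 - p) ^ d * (1 + (d - k : ℕ) * p)) ^ k) ≤
      lowMoment Γ M p k := by
  rw [lowMoment_eq_sum, ← Finset.card_powersetCard, ← nsmul_eq_mul]
  refine Finset.card_nsmul_le_sum _ _ _ fun K hK => ?_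
  obtain ⟨h1, h2⟩ := Finset.mem_powersetCard.1 hK
  exact le_bprob_forall_low hp0 hp1 h2 fun v hv => hd v (h1 hv)

lemma sum_lowMoment_eq (M : Finset V) (p : ℝ) (N : ℕ) :
    ∑ k ∈ Finset.range N, (-1 : ℝ) ^ k * lowMoment Γ M p k = bexp Γ.edgeFinset p (fun S =>
      ∑ k ∈ Finset.range N, (-1 : ℝ) ^ k *
        ((M.filter fun v => (S.filter (v ∈ ·)).card ≤ 1).card.choose k : ℝ)) := by
  rw [bexp_sum]
  exact Finset.sum_congr rfl fun k _ => (bexp_const_mul _ _ _ _).symm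

lemma bprob_forall_two_le_eq (M : Finset V) (p : ℝ) :
    bprob Γ.edgeFinset p (fun S => ∀ v ∈ M, 2 ≤ (S.filter (v ∈ ·)).card) = bexp Γ.edgeFinset p
      (fun S => if (M.filter fun v => (S.filter (v ∈ ·)).card ≤ 1).card = 0 then 1 else 0) := by
  classical
  refine bexp_congr fun S _ => ?_
  have h : (M.filter fun v => (S.filter (v ∈ ·)).card ≤ 1).card = 0 ↔
      ∀ v ∈ M, 2 ≤ (S.filter (v ∈ ·)).card := by
    rw [Finset.card_eq_zero, Finset.filter_eq_empty_iff]
    simp only [not_le, Nat.lt_iff_add_one_le]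
  simp only [h]
  congr

lemma sum_lowMoment_le {p : ℝ} (hp0 : 0 ≤ p) (hp1 : p ≤ 1) (M : Finset V) (m : ℕ) :
    ∑ k ∈ Finset.range (2 * m), (-1 : ℝ) ^ k * lowMoment Γ M p k ≤
      bprob Γ.edgeFinset p (fun S => ∀ v ∈ M, 2 ≤ (S.filter (v ∈ ·)).card) := by
  rw [sum_lowMoment_eq, bprob_forall_two_le_eq]
  exact bexp_mono hp0 hp1 fun S _ => sum_range_neg_one_pow_mul_choose_le _ _

lemma le_sum_lowMoment {p : ℝ} (hp0 : 0 ≤ p) (hp1 : p ≤ 1) (M : Finset V) (m : ℕ) :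
    bprob Γ.edgeFinset p (fun S => ∀ v ∈ M, 2 ≤ (S.filter (v ∈ ·)).card) ≤
      ∑ k ∈ Finset.range (2 * m + 1), (-1 : ℝ) ^ k * lowMoment Γ M p k := by
  rw [sum_lowMoment_eq, bprob_forall_two_le_eq]
  exact bexp_mono hp0 hp1 fun S _ => le_sum_range_neg_one_pow_mul_choose _ _

/-- First moment bound for the probability that some vertex has degree at most one. -/
lemma bprob_not_forall_two_le_le {p : ℝ} {d : ℕ} (hp0 : 0 ≤ p) (hp1 : p ≤ 1)
    (hd : ∀ v, d ≤ Γ.degree v) :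
    bprob Γ.edgeFinset p (fun S => ¬ ∀ v, 2 ≤ (S.filter (v ∈ ·)).card) ≤
      Fintype.card V * ((1 - p) ^ (d - 1) * (1 + d * p)) := by
  calc _ = bprob Γ.edgeFinset p
        (fun S => ∃ v ∈ Finset.univ, (S.filter (v ∈ ·)).card ≤ 1) := by
        refine bprob_congr fun S _ => ?_
        simp
    _ ≤ ∑ v, bprob Γ.edgeFinset p (fun S => (S.filter (v ∈ ·)).card ≤ 1) :=
        bprob_exists_le hp0 hp1 _ _
    _ ≤ ∑ _v : V, ((1 - p) ^ (d - 1) * (1 + d * p)) := by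
        refine Finset.sum_le_sum fun v _ => ?_
        -- The degree of `v` may exceed `d`; restricting to exactly `d` of its edges gives an upper
        -- bound.
        obtain ⟨A, hA, hAd⟩ := Finset.exists_subset_card_eq
          (s := Γ.edgeFinset.filter (v ∈ ·)) (n := d) (by rw [card_edgeFinset_filter_mem]; exact hd v)
        calc _ ≤ bprob Γ.edgeFinset p (fun S => (S ∩ A).card ≤ 1) := by
              refine bprob_mono hp0 hp1 fun S _ h => (Finset.card_le_card fun e he => ?_).trans h
              rw [Finset.mem_inter] at he
              exact Finset.mem_filter.2 ⟨he.1, (Finset.mem_filter.1 (hA he.2)).2⟩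
          _ = bprob A p (fun S => S.card ≤ 1) := by
              classical
              exact bexp_inter (hA.trans (Finset.filter_subset _ _)) p
                (fun S => @ite ℝ (S.card ≤ 1) (Classical.propDecidable _) 1 0)
          _ ≤ _ := bprob_card_le_one_le hp0 hp1 hAd.ge hAd.le
    _ = _ := by rw [Finset.sum_const, nsmul_eq_mul, Finset.card_univ]

end LowDegree

/-! ### Asymptotics at the Hamiltonicity threshold -/

section Threshold

/-- The data of a sequence of edge probabilities in the Hamiltonicity threshold window. -/
structure ThresholdWindow (β : ℝ) (n d : ℕ → ℕ) (p : ℕ → ℝ) (c₀ : ℝ) : Prop where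
  pos : 0 < β
  tendsto_n : Tendsto n atTop atTop
  degree : ∀ i, |(d i : ℝ) - β * n i| ≤ 1
  nonneg : ∀ i, 0 ≤ p i
  le_one : ∀ i, p i ≤ 1
  exists_eq : ∃ c : ℕ → ℝ, Tendsto c atTop (𝓝 c₀) ∧ ∀ᶠ i in atTop,
    p i = (Real.log (n i) + Real.log (Real.log (n i)) + c i) / (β * n i)

lemma tendsto_log_comp {n : ℕ → ℕ} (hn : Tendsto n atTop atTop) :
    Tendsto (fun i => Real.log (n i)) atTop atTop :=
  Real.tendsto_log_atTop.comp (tendsto_natCast_atTop_atTop.comp hn)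

lemma tendsto_log_log_comp {n : ℕ → ℕ} (hn : Tendsto n atTop atTop) :
    Tendsto (fun i => Real.log (Real.log (n i))) atTop atTop :=
  Real.tendsto_log_atTop.comp (tendsto_log_comp hn)

lemma tendsto_log_log_div_log {n : ℕ → ℕ} (hn : Tendsto n atTop atTop) :
    Tendsto (fun i => Real.log (Real.log (n i)) / Real.log (n i)) atTop (𝓝 0) :=
  Real.isLittleO_log_id_atTop.tendsto_div_nhds_zero.comp (tendsto_log_comp hn)

lemma tendsto_log_pow_div {n : ℕ → ℕ} (hn : Tendsto n atTop atTop) (k : ℕ) :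
    Tendsto (fun i => Real.log (n i) ^ k / n i) atTop (𝓝 0) := by
  refine ((tendsto_pow_mul_exp_neg_mul k one_pos).comp (tendsto_log_comp hn)).congr' ?_
  filter_upwards [hn.eventually_gt_atTop 0] with i hi
  have : (0 : ℝ) < n i := by exact_mod_cast hi
  simp only [Function.comp]
  rw [neg_one_mul, Real.exp_neg, Real.exp_log this, div_eq_mul_inv]

/-- The ratio of the threshold numerator to `log n` tends to one. -/
lemma tendsto_numerator_div_log {n : ℕ → ℕ} (hn : Tendsto n atTop atTop) {c : ℕ → ℝ} {c₀ : ℝ}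
    (hc : Tendsto c atTop (𝓝 c₀)) :
    Tendsto (fun i => (Real.log (n i) + Real.log (Real.log (n i)) + c i) / Real.log (n i)) atTop
      (𝓝 1) := by
  have h := ((tendsto_log_log_div_log hn).const_add 1).add (hc.div_atTop (tendsto_log_comp hn))
  rw [add_zero, add_zero] at h
  refine h.congr' ?_
  filter_upwards [(tendsto_log_comp hn).eventually_gt_atTop 0] with i hi
  field_simp

lemma tendsto_numerator_div {n : ℕ → ℕ} (hn : Tendsto n atTop atTop) {c : ℕ → ℝ} {c₀ : ℝ}
    (hc : Tendsto c atTop (𝓝 c₀)) (β : ℝ) :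
    Tendsto (fun i => (Real.log (n i) + Real.log (Real.log (n i)) + c i) / (β * n i)) atTop
      (𝓝 0) := by
  have h := ((tendsto_numerator_div_log hn hc).mul (tendsto_log_pow_div hn 1)).const_mul β⁻¹
  rw [mul_zero, mul_zero] at h
  refine h.congr' ?_
  filter_upwards [(tendsto_log_comp hn).eventually_gt_atTop 0] with i hi
  rw [pow_one, div_mul_div_cancel₀ hi.ne', mul_comm β, ← div_div, inv_mul_eq_div]

/-- Reference sequences with constant `c₀`, compared later with `p` by monotonicity. Clamping to
`[0, 1]` affects only finitely many indices. -/
lemma exists_thresholdWindow {β : ℝ} (hβ : 0 < β) {n d : ℕ → ℕ} (hn : Tendsto n atTop atTop)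
    (hd : ∀ i, |(d i : ℝ) - β * n i| ≤ 1) (c₀ : ℝ) :
    ∃ p, ThresholdWindow β n d p c₀ ∧ ∀ᶠ i in atTop,
      p i = (Real.log (n i) + Real.log (Real.log (n i)) + c₀) / (β * n i) := by
  have h : ∀ᶠ i in atTop,
      max 0 (min 1 ((Real.log (n i) + Real.log (Real.log (n i)) + c₀) / (β * n i))) =
      (Real.log (n i) + Real.log (Real.log (n i)) + c₀) / (β * n i) := by
    filter_upwards [(tendsto_numerator_div hn (tendsto_const_nhds (x := c₀)) β).eventually
      (gt_mem_nhds one_pos), (tendsto_log_comp hn).eventually_ge_atTop 0,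
      (tendsto_log_log_comp hn).eventually_ge_atTop (-c₀)] with i h1 h2 h3
    rw [min_eq_right h1.le, max_eq_right]
    exact div_nonneg (by linarith) (by positivity)
  exact ⟨fun i => max 0 (min 1 ((Real.log (n i) + Real.log (Real.log (n i)) + c₀) / (β * n i))),
    ⟨hβ, hn, hd, fun i => le_max_left _ _, fun i => max_le zero_le_one (min_le_left _ _),
      fun _ => c₀, tendsto_const_nhds, h⟩, h⟩

namespace ThresholdWindow

variable {β : ℝ} {n d : ℕ → ℕ} {p : ℕ → ℝ} {c₀ : ℝ}

lemma tendsto_natCast (h : ThresholdWindow β n d p c₀) :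
    Tendsto (fun i => (n i : ℝ)) atTop atTop :=
  tendsto_natCast_atTop_atTop.comp h.tendsto_n

lemma tendsto_degree (h : ThresholdWindow β n d p c₀) : Tendsto d atTop atTop := by
  have h1 : Tendsto (fun i => (d i : ℝ)) atTop atTop := by
    refine tendsto_atTop_mono (fun i => ?_)
      (tendsto_atTop_add_const_right _ (-1) (h.tendsto_natCast.const_mul_atTop h.pos))
    have := (abs_le.1 (h.degree i)).1
    linarith
  exact tendsto_natCast_atTop_iff.1 h1

lemma tendsto_p (h : ThresholdWindow β n d p c₀) : Tendsto p atTop (𝓝 0) := by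
  obtain ⟨c, hc, he⟩ := h.exists_eq
  exact (tendsto_numerator_div h.tendsto_n hc β).congr' (he.mono fun i hi => hi.symm)

lemma tendsto_mul_div_log (h : ThresholdWindow β n d p c₀) :
    Tendsto (fun i => p i * n i / Real.log (n i)) atTop (𝓝 β⁻¹) := by
  obtain ⟨c, hc, he⟩ := h.exists_eq
  have h1 := (tendsto_numerator_div_log h.tendsto_n hc).const_mul β⁻¹
  rw [mul_one] at h1
  refine h1.congr' ?_
  filter_upwards [he, h.tendsto_n.eventually_gt_atTop 0] with i hi hni
  have : (0 : ℝ) < n i := by exact_mod_cast hni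
  have := h.pos
  rw [hi]
  field_simp

lemma tendsto_sq_mul_natCast (h : ThresholdWindow β n d p c₀) :
    Tendsto (fun i => p i ^ 2 * n i) atTop (𝓝 0) := by
  have h1 := (h.tendsto_mul_div_log.pow 2).mul (tendsto_log_pow_div h.tendsto_n 2)
  rw [mul_zero] at h1
  refine h1.congr' ?_
  filter_upwards [h.tendsto_n.eventually_gt_atTop 0,
    (tendsto_log_comp h.tendsto_n).eventually_gt_atTop 0] with i hni hL
  have : (0 : ℝ) < n i := by exact_mod_cast hni
  field_simp

lemma tendsto_mul_degree_sub (h : ThresholdWindow β n d p c₀) :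
    Tendsto (fun i => p i * d i - Real.log (n i) - Real.log (Real.log (n i))) atTop (𝓝 c₀) := by
  obtain ⟨c, hc, he⟩ := h.exists_eq
  have h0 : Tendsto (fun i => p i * (d i - β * n i)) atTop (𝓝 0) := by
    refine squeeze_zero_norm (fun i => ?_) h.tendsto_p
    rw [norm_mul, Real.norm_of_nonneg (h.nonneg i), Real.norm_eq_abs]
    exact mul_le_of_le_one_right (h.nonneg i) (h.degree i)
  have h1 := hc.add h0
  rw [add_zero] at h1
  refine h1.congr' ?_
  filter_upwards [he, h.tendsto_n.eventually_gt_atTop 0] with i hi hni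
  have : (0 : ℝ) < n i := by exact_mod_cast hni
  have := h.pos
  have h2 : p i * (β * n i) = Real.log (n i) + Real.log (Real.log (n i)) + c i := by
    rw [hi]; field_simp
  linear_combination -h2

/-- `log (1 - p) = -p + O(p²)`, and `d p² → 0` because `d` is of order `n` and `p` of order `log n /
n`. -/
lemma tendsto_degree_mul_log_add (h : ThresholdWindow β n d p c₀) :
    Tendsto (fun i => d i * (Real.log (1 - p i) + p i)) atTop (𝓝 0) := by
  have h0 : Tendsto (fun i => 2 * (β * (p i ^ 2 * n i) + p i ^ 2)) atTop (𝓝 0) := by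
    have := ((h.tendsto_sq_mul_natCast.const_mul β).add (h.tendsto_p.pow 2)).const_mul 2
    simpa using this
  refine squeeze_zero_norm' ?_ h0
  filter_upwards [h.tendsto_p.eventually (gt_mem_nhds (show (0 : ℝ) < 1 / 2 by norm_num))] with i hi
  have hp0 := h.nonneg i
  have h1 : Real.log (1 - p i) + p i ≤ 0 := by
    have := Real.log_le_sub_one_of_pos (show 0 < 1 - p i by linarith)
    linarith
  have h2 : -(2 * p i ^ 2) ≤ Real.log (1 - p i) + p i := by
    have h3 := Real.one_sub_inv_le_log_of_pos (show 0 < 1 - p i by linarith)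
    have h4 : (1 - p i)⁻¹ ≤ 1 + p i + 2 * p i ^ 2 := by
      rw [inv_le_iff_one_le_mul₀ (by linarith)]
      nlinarith [mul_nonneg (sq_nonneg (p i)) (show 0 ≤ 1 - 2 * p i by linarith)]
    linarith
  rw [norm_mul, Real.norm_eq_abs, Real.norm_eq_abs, Nat.abs_cast]
  have h5 : |Real.log (1 - p i) + p i| ≤ 2 * p i ^ 2 := abs_le.2 ⟨h2, h1.trans (by positivity)⟩
  have h6 : (d i : ℝ) ≤ β * n i + 1 := by linarith [(abs_le.1 (h.degree i)).2]
  have hβ := h.pos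
  calc (d i : ℝ) * |Real.log (1 - p i) + p i| ≤ (β * n i + 1) * (2 * p i ^ 2) := by gcongr
    _ = _ := by ring

/-- Taking logarithms, `d log (1 - p)` may be replaced by `-p d`, and `p d = log n + log log n + c₀
+ o(1)`. -/
lemma tendsto_mul_pow_mul_log (h : ThresholdWindow β n d p c₀) :
    Tendsto (fun i => n i * (1 - p i) ^ d i * Real.log (n i)) atTop (𝓝 (Real.exp (-c₀))) := by
  have h1 := (h.tendsto_mul_degree_sub.neg.add h.tendsto_degree_mul_log_add)
  rw [add_zero] at h1
  refine ((Real.continuous_exp.tendsto _).comp h1).congr' ?_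
  filter_upwards [h.tendsto_p.eventually (gt_mem_nhds one_pos),
    h.tendsto_n.eventually_gt_atTop 0,
    (tendsto_log_comp h.tendsto_n).eventually_gt_atTop 0] with i h2 hni hL
  have hnR : (0 : ℝ) < n i := by exact_mod_cast hni
  have e : -(p i * d i - Real.log (n i) - Real.log (Real.log (n i))) +
      d i * (Real.log (1 - p i) + p i) =
      Real.log (n i) + d i * Real.log (1 - p i) + Real.log (Real.log (n i)) := by ring
  simp only [Function.comp]
  rw [e, Real.exp_add, Real.exp_add, Real.exp_log hnR, Real.exp_log hL, Real.exp_nat_mul,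
    Real.exp_log (by linarith)]

/-- The expected number of vertices of degree at most one among `n` vertices of degree `d`. -/
lemma tendsto_mul_pow_mul (h : ThresholdWindow β n d p c₀) :
    Tendsto (fun i => n i * ((1 - p i) ^ d i * (1 + d i * p i))) atTop (𝓝 (Real.exp (-c₀))) := by
  have hL := tendsto_log_comp h.tendsto_n
  have h1 : Tendsto (fun i => (1 + d i * p i) / Real.log (n i)) atTop (𝓝 1) := by
    have h2 := ((((tendsto_const_nhds (x := (1 : ℝ))).add h.tendsto_mul_degree_sub).div_atTop hL).add
      (tendsto_log_log_div_log h.tendsto_n)).add_const 1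
    rw [add_zero, zero_add] at h2
    refine h2.congr' ?_
    filter_upwards [hL.eventually_gt_atTop 0] with i hi
    field_simp
    ring
  have h3 := h.tendsto_mul_pow_mul_log.mul h1
  rw [mul_one] at h3
  refine h3.congr' ?_
  filter_upwards [hL.eventually_gt_atTop 0] with i hi
  field_simp

lemma tendsto_one_sub_pow (h : ThresholdWindow β n d p c₀) (k : ℕ) :
    Tendsto (fun i => (1 - p i) ^ k) atTop (𝓝 1) := by
  simpa using (h.tendsto_p.const_sub 1).pow k

lemma tendsto_mul_pow_sub_mul (h : ThresholdWindow β n d p c₀) (k : ℕ) :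
    Tendsto (fun i => n i * ((1 - p i) ^ (d i - k) * (1 + d i * p i))) atTop
      (𝓝 (Real.exp (-c₀))) := by
  have h1 := h.tendsto_mul_pow_mul.div (h.tendsto_one_sub_pow k) one_ne_zero
  rw [div_one] at h1
  refine h1.congr' ?_
  filter_upwards [h.tendsto_p.eventually (gt_mem_nhds one_pos),
    h.tendsto_degree.eventually_ge_atTop k] with i h2 h3
  have h4 : (0 : ℝ) < 1 - p i := by linarith
  have h5 : (1 - p i) ^ d i = (1 - p i) ^ (d i - k) * (1 - p i) ^ k := by
    rw [← pow_add, Nat.sub_add_cancel h3]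
  rw [Pi.div_apply, h5]
  field_simp

/-- Replacing `d` by `d - k` changes the value by `k p * n (1 - p) ^ d`, and both `p` and `n (1 - p)
^ d` tend to zero. -/
lemma tendsto_mul_pow_mul_sub (h : ThresholdWindow β n d p c₀) (k : ℕ) :
    Tendsto (fun i => n i * ((1 - p i) ^ d i * (1 + (d i - k : ℕ) * p i))) atTop
      (𝓝 (Real.exp (-c₀))) := by
  have h0 := h.tendsto_mul_pow_mul_log.div_atTop (tendsto_log_comp h.tendsto_n)
  have h1 := h.tendsto_mul_pow_mul.sub (h0.mul (h.tendsto_p.const_mul (k : ℝ)))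
  rw [zero_mul, sub_zero] at h1
  refine h1.congr' ?_
  filter_upwards [(tendsto_log_comp h.tendsto_n).eventually_gt_atTop 0,
    h.tendsto_degree.eventually_ge_atTop k] with i hL h3
  rw [mul_div_cancel_right₀ _ hL.ne', Nat.cast_sub h3]
  ring

end ThresholdWindow

/-- Squeeze using `(N + 1 - k) ^ k ≤ k! * N.choose k ≤ N ^ k`. The `max 0` guards against `N < k`.
-/
lemma tendsto_choose_div_pow {n N : ℕ → ℕ} (hn : Tendsto n atTop atTop) {μ : ℝ}
    (hN : Tendsto (fun i => (N i : ℝ) / n i) atTop (𝓝 μ)) (k : ℕ) :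
    Tendsto (fun i => ((N i).choose k : ℝ) / (n i : ℝ) ^ k) atTop (𝓝 (μ ^ k / k.factorial)) := by
  have hnR : Tendsto (fun i => (n i : ℝ)) atTop atTop := tendsto_natCast_atTop_atTop.comp hn
  have hup : Tendsto (fun i => ((N i : ℝ) / n i) ^ k / k.factorial) atTop
      (𝓝 (μ ^ k / k.factorial)) := (hN.pow k).div_const _
  have hlow : Tendsto (fun i => (max 0 ((N i : ℝ) / n i - k / n i)) ^ k / k.factorial) atTop
      (𝓝 (μ ^ k / k.factorial)) := by
    have hμ : 0 ≤ μ := ge_of_tendsto' hN fun i => by positivity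
    have h1 := (tendsto_const_nhds (x := (0 : ℝ))).max
      (hN.sub (tendsto_const_nhds (x := (k : ℝ)).div_atTop hnR))
    rw [sub_zero, max_eq_right hμ] at h1
    exact (h1.pow k).div_const _
  refine tendsto_of_tendsto_of_tendsto_of_le_of_le' hlow hup ?_ ?_
  · filter_upwards [hn.eventually_gt_atTop 0] with i hi
    have hi' : (0 : ℝ) < n i := by exact_mod_cast hi
    have hf : (0 : ℝ) < k.factorial := by exact_mod_cast k.factorial_pos
    have h1 : (max 0 ((N i : ℝ) / n i - k / n i)) ≤ ((N i + 1 - k : ℕ) : ℝ) / n i := by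
      refine max_le (by positivity) ?_
      rw [← sub_div]
      gcongr
      have : N i ≤ (N i + 1 - k) + k := by omega
      have : (N i : ℝ) ≤ ((N i + 1 - k : ℕ) : ℝ) + k := by exact_mod_cast this
      linarith
    have h2 : ((N i + 1 - k : ℕ) : ℝ) ^ k ≤ k.factorial * (N i).choose k := by
      have := Nat.pow_sub_le_descFactorial (N i) k
      rw [Nat.descFactorial_eq_factorial_mul_choose] at this
      exact_mod_cast this
    calc _ ≤ (((N i + 1 - k : ℕ) : ℝ) / n i) ^ k / k.factorial := by gcongr
      _ ≤ _ := by
        rw [div_pow, div_div, div_le_div_iff₀ (by positivity) (by positivity)]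
        nlinarith [mul_le_mul_of_nonneg_right h2 (show 0 ≤ (n i : ℝ) ^ k by positivity)]
  · filter_upwards with i
    rw [div_pow, div_div, mul_comm, ← div_div]
    gcongr
    exact Nat.choose_le_pow_div k (N i)

/-- In the threshold window, the number of vertices of degree at most one, in a set of vertices of
density `μ`, vanishes with asymptotic probability `exp (-μ * exp (-c₀))`. -/
theorem tendsto_bprob_forall_two_le {β : ℝ} {n d : ℕ → ℕ} {p : ℕ → ℝ} {c₀ : ℝ}
    (h : ThresholdWindow β n d p c₀)
    {V : ℕ → Type*} [∀ i, Fintype (V i)] [∀ i, DecidableEq (V i)]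
    (Γ : ∀ i, SimpleGraph (V i)) [∀ i, DecidableRel (Γ i).Adj] (M : ∀ i, Finset (V i))
    (hM : ∀ i, ∀ v ∈ M i, (Γ i).degree v = d i) {μ : ℝ}
    (hμ : Tendsto (fun i => ((M i).card : ℝ) / n i) atTop (𝓝 μ)) :
    Tendsto (fun i => bprob (Γ i).edgeFinset (p i)
      (fun S => ∀ v ∈ M i, 2 ≤ (S.filter (v ∈ ·)).card)) atTop
      (𝓝 (Real.exp (-(μ * Real.exp (-c₀))))) := by
  refine tendsto_exp_neg_of_bonferroni (e := fun k i => lowMoment (Γ i) (M i) (p i) k)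
    (fun i m => sum_lowMoment_le (h.nonneg i) (h.le_one i) _ m)
    (fun i m => le_sum_lowMoment (h.nonneg i) (h.le_one i) _ m) fun k => ?_
  -- Distribute `n ^ k`: the number of `k`-subsets over `n ^ k` tends to `μ ^ k / k!`, and `n` times
  -- the probability for one vertex tends to `exp (-c₀)`.
  have hch := tendsto_choose_div_pow h.tendsto_n hμ k
  have hup := hch.mul ((h.tendsto_mul_pow_sub_mul (k + 1)).pow k)
  have hlow := hch.mul ((h.tendsto_one_sub_pow (k ^ 2)).mul ((h.tendsto_mul_pow_mul_sub k).pow k))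
  have e : μ ^ k / k.factorial * Real.exp (-c₀) ^ k = (μ * Real.exp (-c₀)) ^ k / k.factorial := by
    rw [mul_pow]; ring
  rw [one_mul, e] at hlow
  rw [e] at hup
  refine tendsto_of_tendsto_of_tendsto_of_le_of_le' hlow hup ?_ ?_
  · filter_upwards [h.tendsto_n.eventually_gt_atTop 0] with i hi
    have hi' : (0 : ℝ) < n i := by exact_mod_cast hi
    refine le_trans (le_of_eq ?_) (le_lowMoment (h.nonneg i) (h.le_one i) (hM i) k)
    rw [mul_pow (n i : ℝ)]
    field_simp
  · filter_upwards [h.tendsto_n.eventually_gt_atTop 0] with i hi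
    have hi' : (0 : ℝ) < n i := by exact_mod_cast hi
    refine (lowMoment_le (h.nonneg i) (h.le_one i) (hM i) k).trans (le_of_eq ?_)
    rw [mul_pow (n i : ℝ), Nat.sub_sub]
    field_simp

/-- In the threshold window, Hamiltonicity is asymptotically equivalent to having minimum degree at
least two. -/
theorem tendsto_bprob_forall_two_le_and_not_isHamiltonian {β : ℝ} (hβ : 1 / 2 < β) {n d : ℕ → ℕ}
    {p : ℕ → ℝ} {c₀ : ℝ} (h : ThresholdWindow β n d p c₀)
    {V : ℕ → Type*} [∀ i, Fintype (V i)] [∀ i, DecidableEq (V i)]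
    (hn : ∀ i, Fintype.card (V i) = n i)
    (Γ : ∀ i, SimpleGraph (V i)) [∀ i, DecidableRel (Γ i).Adj]
    (hd : ∀ i v, d i ≤ (Γ i).degree v) :
    Tendsto (fun i => bprob (Γ i).edgeFinset (p i) (fun S =>
      (∀ v, 2 ≤ (S.filter (v ∈ ·)).card) ∧ ¬ (edgeGraph S).IsHamiltonian)) atTop (𝓝 0) := by
  refine tendsto_order.2 ⟨fun x hx => Eventually.of_forall fun i => hx.trans_le
    (bprob_nonneg (h.nonneg i) (h.le_one i) _), fun x hx => ?_⟩
  -- Half of the excess of `β` over `1/2` is given up to absorb the rounding error in `d`.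
  have hη : 0 < (β - 1 / 2) / 2 := by linarith
  have hβ4 : β⁻¹ < 4 := by
    rw [inv_lt_comm₀ (by linarith) (by norm_num)]; linarith
  filter_upwards [h.tendsto_n.eventually (eventually_bprob_not_isHamiltonian_le hη (half_pos hx)),
    h.tendsto_mul_div_log.eventually (gt_mem_nhds hβ4),
    (h.tendsto_natCast.const_mul_atTop hη).eventually_ge_atTop 1,
    h.tendsto_n.eventually_gt_atTop 0,
    (tendsto_log_comp h.tendsto_n).eventually_gt_atTop 0,
    h.tendsto_mul_degree_sub.eventually (lt_mem_nhds (sub_one_lt c₀)),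
    (tendsto_log_log_comp h.tendsto_n).eventually_ge_atTop (1 - c₀)] with i h1 h2 h3 h4 h5 h6 h7
  have h4' : (0 : ℝ) < n i := by exact_mod_cast h4
  refine (h1 (V i) (Γ i) (d i) (p i) (hn i) (hd i) ?_ ?_ ?_).trans_lt (half_lt_self hx)
  · linarith [(abs_le.1 (h.degree i)).1]
  · rw [le_div_iff₀ h4']
    rw [div_lt_iff₀ h5] at h2
    exact h2.le
  · linarith

end Threshold

/-! ### ### Hamiltonicity compared with minimum degree two -/

section Hamiltonian

variable {V : Type*} [Fintype V] [DecidableEq V] {Γ : SimpleGraph V} [DecidableRel Γ.Adj]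

lemma bprob_isHamiltonian_mono {p q : ℝ} (hp0 : 0 ≤ p) (hpq : p ≤ q) (hq1 : q ≤ 1) :
    bprob Γ.edgeFinset p (fun S => (edgeGraph S).IsHamiltonian) ≤
      bprob Γ.edgeFinset q (fun S => (edgeGraph S).IsHamiltonian) := by
  refine bexp_mono_param hp0 hpq hq1 fun S T hST _ => ?_
  by_cases h : (edgeGraph S).IsHamiltonian
  · simp [h, h.mono (edgeGraph_mono hST)]
  · simp only [h, if_false]
    split_ifs <;> norm_num

lemma two_le_card_filter_of_isHamiltonian_edgeGraph (h2 : 2 ≤ Fintype.card V)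
    {S : Finset (Sym2 V)} (hS : S ⊆ Γ.edgeFinset) (h : (edgeGraph S).IsHamiltonian) (v : V) :
    2 ≤ (S.filter (v ∈ ·)).card :=
  two_le_card_filter_of_isHamiltonian
    (fun _ he => Γ.not_isDiag_of_mem_edgeSet (SimpleGraph.mem_edgeFinset.1 (hS he))) h2 h v

/-- Hamiltonicity implies minimum degree at least two, so the two probabilities differ exactly by
the exceptional event shown to be negligible. -/
lemma bprob_isHamiltonian_eq {p : ℝ} (h2 : 2 ≤ Fintype.card V) :
    bprob Γ.edgeFinset p (fun S => (edgeGraph S).IsHamiltonian) =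
      bprob Γ.edgeFinset p (fun S => ∀ v, 2 ≤ (S.filter (v ∈ ·)).card) -
      bprob Γ.edgeFinset p (fun S => (∀ v, 2 ≤ (S.filter (v ∈ ·)).card) ∧
        ¬ (edgeGraph S).IsHamiltonian) := by
  rw [eq_sub_iff_add_eq, bprob, bprob, bprob, ← bexp_add]
  refine bexp_congr fun S hS => ?_
  by_cases h : (edgeGraph S).IsHamiltonian
  · have h' := two_le_card_filter_of_isHamiltonian_edgeGraph h2 hS h
    simp [h, h']
  · by_cases h' : ∀ v, 2 ≤ (S.filter (v ∈ ·)).card <;> simp [h, h']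

end Hamiltonian

/-! ### ### The three regimes -/

theorem corollary3
    {ε β : ℝ} (hε : 0 < ε) (hβ : 1 / 2 < β)
    {V : ℕ → Type*} [∀ i, Fintype (V i)] [∀ i, DecidableEq (V i)]
    (n : ℕ → ℕ) (hn : ∀ i, Fintype.card (V i) = n i) (hn_lim : Tendsto n atTop atTop)
    (Γ : ∀ i, SimpleGraph (V i)) [∀ i, DecidableRel (Γ i).Adj]
    -- `d i` is `β * n i` up to rounding
    (d : ℕ → ℕ) (hd : ∀ i, |(d i : ℝ) - β * n i| ≤ 1)
    (hmin : ∀ i, (Γ i).minDegree = d i)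
    (hmany : ∀ i, ε * n i ≤ (Finset.univ.filter fun v : V i => (Γ i).degree v = d i).card)
    (c : ℕ → ℝ) (p : ℕ → unitInterval)
    (hp : ∀ᶠ i in atTop,
      (p i : ℝ) = (Real.log (n i) + Real.log (Real.log (n i)) + c i) / (β * n i)) :
    (Tendsto c atTop atBot →
      Tendsto (fun i => probHamiltonian (Γ i) (p i)) atTop (𝓝 0)) ∧
    (Tendsto c atTop atTop →
      Tendsto (fun i => probHamiltonian (Γ i) (p i)) atTop (𝓝 1)) ∧
    ((∀ i, (Γ i).IsRegularOfDegree (d i)) →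
      ∀ c₀ : ℝ, Tendsto c atTop (𝓝 c₀) →
        Tendsto (fun i => probHamiltonian (Γ i) (p i)) atTop
          (𝓝 (Real.exp (-Real.exp (-c₀))))) := by
  have hβ0 : 0 < β := by linarith
  have hdeg : ∀ i v, d i ≤ (Γ i).degree v := fun i v => hmin i ▸ (Γ i).minDegree_le_degree v
  have hp0 : ∀ i, (0 : ℝ) ≤ p i := fun i => (p i).2.1
  have hp1 : ∀ i, (p i : ℝ) ≤ 1 := fun i => (p i).2.2
  have hprob : ∀ i, probHamiltonian (Γ i) (p i) =
      bprob (Γ i).edgeFinset (p i) (fun S => (edgeGraph S).IsHamiltonian) :=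
    fun i => probHamiltonian_eq_bprob (Γ i) (p i)
  simp only [hprob]
  refine ⟨fun hc => ?_, fun hc => ?_, fun hreg c₀ hc => ?_⟩
  · refine tendsto_order.2 ⟨fun x hx => Eventually.of_forall fun i => hx.trans_le
      (bprob_nonneg (hp0 i) (hp1 i) _), fun x hx => ?_⟩
    -- With constant `-K` in place of `c`, the limit bound is `exp (-ε exp K)`, which is small for
    -- large `K`; eventually `c i ≤ -K`.
    have hlim : Tendsto (fun K : ℝ => Real.exp (-(ε * Real.exp (- -K)))) atTop (𝓝 0) := by
      simp only [neg_neg]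
      exact Real.tendsto_exp_neg_atTop_nhds_zero.comp
        (Real.tendsto_exp_atTop.const_mul_atTop hε)
    obtain ⟨K, hK⟩ := (hlim.eventually (gt_mem_nhds hx)).exists
    obtain ⟨p', hw, hp'⟩ := exists_thresholdWindow hβ0 hn_lim hd (-K)
    -- Only `⌈ε n⌉` vertices of degree `d` are used, because the density of the set of all of them
    -- need not converge.
    have hceil : ∀ i, ⌈ε * n i⌉₊ ≤
        (Finset.univ.filter fun v : V i => (Γ i).degree v = d i).card :=
      fun i => Nat.ceil_le.2 (hmany i)
    choose M hM hMcard using fun i => Finset.exists_subset_card_eq (hceil i)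
    have hμ : Tendsto (fun i => ((M i).card : ℝ) / n i) atTop (𝓝 ε) := by
      simp only [hMcard]
      exact (tendsto_nat_ceil_mul_div_atTop hε.le).comp hw.tendsto_natCast
    filter_upwards [(tendsto_bprob_forall_two_le hw Γ M
      (fun i v hv => (Finset.mem_filter.1 (hM i hv)).2) hμ).eventually (gt_mem_nhds hK),
      hc.eventually_le_atBot (-K), hp, hp', hn_lim.eventually_ge_atTop 2] with i h1 h2 h3 h4 h5
    refine lt_of_le_of_lt ?_ h1
    refine (bprob_isHamiltonian_mono (hp0 i) (q := p' i) ?_ (hw.le_one i)).trans ?_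
    · rw [h3, h4]
      gcongr
    · exact bprob_mono (hw.nonneg i) (hw.le_one i) fun S hS h v _ =>
        two_le_card_filter_of_isHamiltonian_edgeGraph ((hn i).symm ▸ h5) hS h v
  · refine tendsto_order.2 ⟨fun x hx => ?_, fun x hx => Eventually.of_forall fun i =>
      (bprob_le_one (hp0 i) (hp1 i) _).trans_lt hx⟩
    have hx' : 0 < (1 - x) / 2 := by linarith
    obtain ⟨K, hK⟩ := (Real.tendsto_exp_neg_atTop_nhds_zero.eventually (gt_mem_nhds hx')).exists
    obtain ⟨p', hw, hp'⟩ := exists_thresholdWindow hβ0 hn_lim hd K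
    -- At constant `K` both sources of failure are eventually below `(1 - x) / 2`: the expected
    -- number of low vertices, of limit `exp (-K)`, and the exceptional event.
    filter_upwards [(hw.tendsto_mul_pow_sub_mul 1).eventually (gt_mem_nhds hK),
      (tendsto_bprob_forall_two_le_and_not_isHamiltonian hβ hw hn Γ hdeg).eventually
        (gt_mem_nhds hx'), hc.eventually_ge_atTop K, hp, hp', hn_lim.eventually_ge_atTop 2]
      with i h1 h2 h3 h4 h5 h6
    have h7 := bprob_not_forall_two_le_le (Γ := Γ i) (hw.nonneg i) (hw.le_one i) (hdeg i)
    rw [bprob_not, hn i] at h7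
    have h8 := bprob_isHamiltonian_eq (Γ := Γ i) (p := p' i) ((hn i).symm ▸ h6)
    have h9 : bprob (Γ i).edgeFinset (p' i) (fun S => (edgeGraph S).IsHamiltonian) ≤
        bprob (Γ i).edgeFinset (p i) (fun S => (edgeGraph S).IsHamiltonian) := by
      refine bprob_isHamiltonian_mono (hw.nonneg i) ?_ (hp1 i)
      rw [h4, h5]
      gcongr
    linarith
  · have hw : ThresholdWindow β n d (fun i => (p i : ℝ)) c₀ :=
      ⟨hβ0, hn_lim, hd, hp0, hp1, c, hc, hp⟩
    have hμ : Tendsto (fun i => (((Finset.univ : Finset (V i)).card : ℕ) : ℝ) / n i) atTop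
        (𝓝 1) := by
      refine tendsto_const_nhds.congr' ?_
      filter_upwards [hn_lim.eventually_gt_atTop 0] with i hi
      have : (n i : ℝ) ≠ 0 := by exact_mod_cast hi.ne'
      rw [Finset.card_univ, hn i, div_self this]
    have h1 := (tendsto_bprob_forall_two_le hw Γ (fun _ => Finset.univ)
      (fun i v _ => hreg i v) hμ).sub
      (tendsto_bprob_forall_two_le_and_not_isHamiltonian hβ hw hn Γ hdeg)
    rw [sub_zero, one_mul] at h1
    refine h1.congr' ?_
    filter_upwards [hn_lim.eventually_ge_atTop 2] with i hi
    rw [bprob_isHamiltonian_eq (Γ := Γ i) ((hn i).symm ▸ hi)]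
    simp only [Finset.mem_univ, true_imp_iff]
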